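/- **Model.** Let $\mathcal S\ge 1$ be an integer, $\beta\ge 0$, $h\ge 0$, $D\in\mathbb R$. For $\sigma\in\{0,\pm1,\dots,\pm\mathcal S\}^N$ let $$H_N(\sigma)=\frac{\beta}{\sqrt N}\sum_{i<j}g_{ij}\sigma_i\sigma_j+D\sum_{i=1}^N\sigma_i^2+h\sum_{i=1}^N\sigma_i ,$$ with $g_{ij}$ ($i<j$) i.i.d. standard Gaussian (the Ghatak–Sherrington model). Let $\langle\cdot\rangle$ be the average over independent replicas under the Gibbs measure with weights proportional to $e^{H_N(\sigma)}$, and $\nu(\cdot)=\mathbb E\langle\cdot\rangle$. **Cavity constants.** For reals $p,q$ and $\eta\sim\mathcal N(0,1)$, let $\langle\cdot\rangle_0$ be the average over i.i.d. spins $\epsilon_1,\epsilon_2,\dots\in\{0,\pm1,\dots,\pm\mathcal S\}$, each with law proportional to $$\exp\Big(\epsilon\,\beta\eta\sqrt q+\tfrac{\beta^2}{2}(p-q)\epsilon^2+D\epsilon^2+h\epsilon\Big),$$ and let $\nu_0(\cdot)=\mathbb E_\eta\langle\cdot\rangle_0$. With $\epsilon_{kl}=\epsilon_k\epsilon_l$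 put $$\begin{aligned} &A=\nu_0((\epsilon_1-\epsilon_3)(\epsilon_2-\epsilon_4)\epsilon_{12}),\quad F=\nu_0((\epsilon_{13}-\epsilon_{23})\epsilon_{13}),\quad G=\nu_0((\epsilon_{13}-\epsilon_{23})\epsilon_{14}),\\ &E=\nu_0((\epsilon_1^2-\epsilon_2^2)\epsilon_{13}),\quad \mathsf D=\nu_0((\epsilon_1^2-\epsilon_2^2)\epsilon_1^2),\quad I_3=\nu_0((\epsilon_{12}-q)\epsilon_{34}),\\ &I_5=\nu_0((\epsilon_{12}-q)\epsilon_{33}),\quad K_3=\nu_0((\epsilon_{11}-p)\epsilon_{23}),\quad K_4=\nu_0((\epsilon_{11}-p)\epsilon_{22}),\\ &M_1=1-\beta^2(F-3G),\quad M_2=1-\tfrac{\beta^2}{2}\mathsf D,\quad M_3=1-\beta^2(F-G),\quad M=M_1M_2+\beta^4E^2,\\ &A_2^2=\frac{A}{N(1-\beta^2A)},\quad A_1^2=\frac{GM_2+\frac{\beta^2}{2}E^2}{M}\cdot\frac1{NM_3},\quad B_1^2=\frac{\mathsf DM_1-2\beta^2E^2}{NM},\quad C_1^2=\frac{E}{NM}.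 \end{aligned}$$ **Theorem.** There is $\beta'>0$, depending only on $\mathcal S$, such that for all $0\le\beta<\beta'$, $h\ge0$, $D\in\mathbb R$ the system $p=\nu_0(\epsilon_1^2)$, $q=\nu_0(\epsilon_1\epsilon_2)$ has exactly one solution $(p,q)\in\mathbb{R}^2$; for this solution $M_1,M_2,M_3,M>0$, and the random variables $$T=\frac1N\sum_{i=1}^N\langle\sigma_i\rangle^2-q,\qquad S=\frac1N\sum_{i=1}^N\langle\sigma_i^2\rangle-p$$ satisfy $$\nu(T^2)=A_0^2+O_N(3),\qquad \nu(S^2)=B_0^2+O_N(3),\qquad \nu(ST)=C_0+O_N(3),$$ where $$\begin{aligned} A_0^2&=\tfrac{\beta^2}{M}(\beta^2EK_4+M_2I_5)C_1^2+\tfrac{2\beta^2}{M}\big(\beta^2E(E-K_3)+M_2(2G-I_3)\big)A_1^2\\ &\quad+\tfrac{\beta^2}{M}(\beta^2EK_3+M_2I_3)A_2^2+\tfrac1{MN}(\beta^2EK_3+M_2I_3),\\ B_0^2&=\tfrac{\beta^2}{2M}(M_1K_4-\beta^2EI_5)B_1^2+\tfrac{\beta^2}{M}\big(M_1(E-K_3)-\beta^2E(2G-I_3)\big)C_1^2+\tfrac1{MN}(M_1K_4-\beta^2EI_5),\\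 C_0&=\tfrac{\beta^2}{M}\big(\tfrac12M_2I_5+\tfrac12\beta^2EK_4\big)B_1^2+\tfrac{\beta^2}{M}\big(M_2(2G-I_3)+\beta^2E(E-K_3)\big)C_1^2+\tfrac1{MN}(M_2I_5+\beta^2EK_4). \end{aligned}$$ Here $X=O_N(3)$ means $|X|\le K N^{-3/2}$ for all $N\ge1$, with a constant $K$ that may depend on $\mathcal S,\beta,h,D$ but not on $N$. -/

import Mathlib

open MeasureTheory ProbabilityTheory

noncomputable section

namespace GhatakSherrington

/-- Parameters of the model: largest spin value `S`, inverse temperature `β`, external field `h`,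
crystal field `D`. -/
structure Params where
  S : ℕ
  β : ℝ
  h : ℝ
  D : ℝ

/-- The set of spin values `{0, ±1, …, ±S}`. -/
abbrev Spin (S : ℕ) : Type := ↥(Finset.Icc (-(S : ℤ)) (S : ℤ))

/-- The real value of a spin. -/
def Spin.val {S : ℕ} (s : Spin S) : ℝ := ((s : ℤ) : ℝ)

/-- Configurations of `N` spins. -/
abbrev Config (N S : ℕ) : Type := Fin N → Spin S

/-- The interaction parameters `g_{ij}`, one for each pair of sites `i < j`. -/
abbrev Disorder (N : ℕ) : Type := {e : Fin N × Fin N // e.1 < e.2} → ℝ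

/-- The law of the disorder: i.i.d. standard Gaussians. -/
def disorderLaw (N : ℕ) : Measure (Disorder N) := Measure.pi fun _ => gaussianReal 0 1

section Model

variable (P : Params) {N : ℕ}

/-- The Hamiltonian
`(β / √N) ∑_{i<j} g_{ij} σ_i σ_j + D ∑_i σ_i² + h ∑_i σ_i`. -/
def hamiltonian (g : Disorder N) (σ : Config N P.S) : ℝ :=
  P.β / √(N : ℝ) * ∑ e : {e : Fin N × Fin N // e.1 < e.2},
      g e * (σ e.1.1).val * (σ e.1.2).val
    + P.D * ∑ i, (σ i).val ^ 2 + P.h * ∑ i, (σ i).val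

/-- The partition function. -/
def partitionFunction (g : Disorder N) : ℝ := ∑ σ : Config N P.S, Real.exp (hamiltonian P g σ)

/-- The Gibbs probability of a configuration. -/
def gibbsWeight (g : Disorder N) (σ : Config N P.S) : ℝ :=
  Real.exp (hamiltonian P g σ) / partitionFunction P g

/-- The Gibbs average `⟨f⟩` of a function of `n` replicas. -/
def gibbs {n : ℕ} (g : Disorder N) (f : (Fin n → Config N P.S) → ℝ) : ℝ :=
  ∑ σ : Fin n → Config N P.S, (∏ k, gibbsWeight P g (σ k)) * f σ

/-- `ν(f) = 𝔼⟨f⟩`; the function `f` of `n` replicas may also depend on the disorder. -/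
def nu {n : ℕ} (f : Disorder N → (Fin n → Config N P.S) → ℝ) : ℝ :=
  ∫ g, gibbs P g (f g) ∂(disorderLaw N)

/-- `⟨σ_i⟩`. -/
def siteMean (g : Disorder N) (i : Fin N) : ℝ :=
  gibbs P g fun σ : Fin 1 → Config N P.S => (σ 0 i).val

/-- `⟨σ_i²⟩`. -/
def siteSecondMoment (g : Disorder N) (i : Fin N) : ℝ :=
  gibbs P g fun σ : Fin 1 → Config N P.S => (σ 0 i).val ^ 2

/-- The basis component `T = N⁻¹ ∑_i ⟨σ_i⟩² - q` of the overlaps. -/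
def basisT (q : ℝ) (g : Disorder N) : ℝ :=
  (1 / (N : ℝ)) * ∑ i, siteMean P g i ^ 2 - q

/-- The basis component `S = N⁻¹ ∑_i ⟨σ_i²⟩ - p` of the self-overlaps. -/
def basisS (p : ℝ) (g : Disorder N) : ℝ :=
  (1 / (N : ℝ)) * ∑ i, siteSecondMoment P g i - p

end Model

section Cavity

variable (P : Params) (p q : ℝ)

/-- The Boltzmann weight of the last spin at time `0` of the cavity interpolation, where the last
spin is decoupled from the other spins. -/
def cavityWeight (η : ℝ) (s : Spin P.S) : ℝ :=
  Real.exp (s.val * (P.β * η * √q) + P.β ^ 2 / 2 * (p - q) * s.val ^ 2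
    + P.D * s.val ^ 2 + P.h * s.val)

/-- The average `⟨φ⟩₀` of a function of the last spins `ε_1, …, ε_n` of `n` replicas. -/
def cavityGibbs {n : ℕ} (η : ℝ) (φ : (Fin n → ℝ) → ℝ) : ℝ :=
  ∑ ε : Fin n → Spin P.S,
    (∏ k, cavityWeight P p q η (ε k) / ∑ s, cavityWeight P p q η s) * φ fun k => (ε k).val

/-- `ν₀(φ)` for a function `φ` of the last spins of `n` replicas. -/
def nu0 {n : ℕ} (φ : (Fin n → ℝ) → ℝ) : ℝ :=
  ∫ η, cavityGibbs P p q η φ ∂(gaussianReal 0 1)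

/-- The replica symmetric equations `p = ν₀(ε_1²)`, `q = ν₀(ε_1 ε_2)`. -/
def IsReplicaSymmetric : Prop :=
  p = nu0 P p q (fun ε : Fin 1 → ℝ => ε 0 ^ 2) ∧
  q = nu0 P p q (fun ε : Fin 2 → ℝ => ε 0 * ε 1)

/-! Constants of the last spins. Replicas `1, 2, 3, 4` have indices `0, 1, 2, 3`. -/

def constF : ℝ :=
  nu0 P p q fun ε : Fin 4 → ℝ => (ε 0 * ε 2 - ε 1 * ε 2) * (ε 0 * ε 2)

def constG : ℝ :=
  nu0 P p q fun ε : Fin 4 → ℝ => (ε 0 * ε 2 - ε 1 * ε 2) * (ε 0 * ε 3)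

def constE : ℝ :=
  nu0 P p q fun ε : Fin 4 → ℝ => (ε 0 ^ 2 - ε 1 ^ 2) * (ε 0 * ε 2)

def constD : ℝ :=
  nu0 P p q fun ε : Fin 4 → ℝ => (ε 0 ^ 2 - ε 1 ^ 2) * ε 0 ^ 2

def constA : ℝ :=
  nu0 P p q fun ε : Fin 4 → ℝ => (ε 0 - ε 2) * (ε 1 - ε 3) * (ε 0 * ε 1)

def constI3 : ℝ :=
  nu0 P p q fun ε : Fin 4 → ℝ => (ε 0 * ε 1 - q) * (ε 2 * ε 3)

def constI5 : ℝ :=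
  nu0 P p q fun ε : Fin 4 → ℝ => (ε 0 * ε 1 - q) * (ε 2 * ε 2)

def constK3 : ℝ :=
  nu0 P p q fun ε : Fin 4 → ℝ => (ε 0 * ε 0 - p) * (ε 1 * ε 2)

def constK4 : ℝ :=
  nu0 P p q fun ε : Fin 4 → ℝ => (ε 0 * ε 0 - p) * (ε 1 * ε 1)

def constM1 : ℝ := 1 - P.β ^ 2 * (constF P p q - 3 * constG P p q)

def constM2 : ℝ := 1 - P.β ^ 2 / 2 * constD P p q

def constM3 : ℝ := 1 - P.β ^ 2 * (constF P p q - constG P p q)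

def constM : ℝ := constM1 P p q * constM2 P p q + P.β ^ 4 * constE P p q ^ 2

/-- `A_2²`, the leading term of `ν(T_{12}²)`. -/
def A2sq (N : ℕ) : ℝ := constA P p q / (N * (1 - P.β ^ 2 * constA P p q))

/-- `A_1²`, the leading term of `ν(T_1²)`. -/
def A1sq (N : ℕ) : ℝ :=
  (constG P p q * constM2 P p q + P.β ^ 2 / 2 * constE P p q ^ 2) / constM P p q
    * (1 / (N * constM3 P p q))

/-- `B_1²`, the leading term of `ν(S_1²)`. -/
def B1sq (N : ℕ) : ℝ :=
  (constD P p q * constM1 P p q - 2 * P.β ^ 2 * constE P p q ^ 2) / (N * constM P p q)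

/-- `C_1²`, the leading term of `ν(S_1 T_1)`. -/
def C1sq (N : ℕ) : ℝ := constE P p q / (N * constM P p q)

/-- `A_0²`, the leading term of `ν(T²)`. -/
def A0sq (N : ℕ) : ℝ :=
  let β := P.β
  let E := constE P p q
  let G := constG P p q
  let I3 := constI3 P p q
  let I5 := constI5 P p q
  let K3 := constK3 P p q
  let K4 := constK4 P p q
  let M2 := constM2 P p q
  let M := constM P p q
  β ^ 2 / M * (β ^ 2 * E * K4 + M2 * I5) * C1sq P p q N
    + 2 * (β ^ 2 / M) * (β ^ 2 * E * (E - K3) + M2 * (2 * G - I3)) * A1sq P p q N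
    + β ^ 2 / M * (β ^ 2 * E * K3 + M2 * I3) * A2sq P p q N
    + 1 / (M * N) * (β ^ 2 * E * K3 + M2 * I3)

/-- `B_0²`, the leading term of `ν(S²)`. -/
def B0sq (N : ℕ) : ℝ :=
  let β := P.β
  let E := constE P p q
  let G := constG P p q
  let I3 := constI3 P p q
  let I5 := constI5 P p q
  let K3 := constK3 P p q
  let K4 := constK4 P p q
  let M1 := constM1 P p q
  let M := constM P p q
  β ^ 2 / (2 * M) * (M1 * K4 - β ^ 2 * E * I5) * B1sq P p q N
    + β ^ 2 / M * (M1 * (E - K3) - E * β ^ 2 * (2 * G - I3)) * C1sq P p q N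
    + 1 / (M * N) * (M1 * K4 - β ^ 2 * E * I5)

/-- `C_0`, the leading term of `ν(S T)`. -/
def C0 (N : ℕ) : ℝ :=
  let β := P.β
  let E := constE P p q
  let G := constG P p q
  let I3 := constI3 P p q
  let I5 := constI5 P p q
  let K3 := constK3 P p q
  let K4 := constK4 P p q
  let M2 := constM2 P p q
  let M := constM P p q
  β ^ 2 / M * (1 / 2 * M2 * I5 + 1 / 2 * β ^ 2 * E * K4) * B1sq P p q N
    + β ^ 2 / M * (M2 * (2 * G - I3) + β ^ 2 * E * (E - K3)) * C1sq P p q N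
    + 1 / (M * N) * (M2 * I5 + β ^ 2 * E * K4)

end Cavity

end GhatakSherrington

end

/-!
Write `X` for the centred overlaps. By symmetry among sites, `ν(X_{kl} X_{k'l'})` can be computed
with one factor evaluated at a single site. Decoupling that site from all the others by a Gaussian
interpolation and integrating by parts gives, at time `0`, a product of an average over the spins of
that site with an average over the remaining sites; the derivative brings in one further overlap per
factor `β²`.

At small `β` the first-order version of this bounds the moments of the overlaps in terms of
themselves, whence `ν|X_{kl}|^r = O(N^{-r/2})` for `r ≤ 3`. The second-order version then expresses
each covariance through the others, up to `O(N^{-3/2})`. By exchangeability of the replicas a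
covariance depends only on which of its four replicas coincide, so that these cavity equations form
a linear system in seven unknowns. Its operator is a contraction, so every approximate solution is
close to the exact one, which is triangular up to blocks of size two in the orthogonal components
`T_{kl}`, `T_k`, `T`, `S_k`, `S` of the overlaps. Finally `ν(T²)`, `ν(ST)` and `ν(S²)` are
themselves covariances of overlaps, of disjoint replicas.
-/

noncomputable section

namespace GhatakSherrington

section ProductMeasure

variable {J : Type*} [Fintype J] {X : J → Type*} [∀ j, MeasurableSpace (X j)]
  (μ : ∀ j, Measure (X j)) [∀ j, IsProbabilityMeasure (μ j)]

theorem measurePreserving_pi_precomp {I : Type*} [Fintype I] {e : I → J}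
    (he : Function.Injective e) :
    MeasurePreserving (fun (z : ∀ j, X j) i => z (e i)) (Measure.pi μ)
      (Measure.pi fun i => μ (e i)) := by
  have hind : iIndepFun (fun i (z : ∀ j, X j) => z (e i)) (Measure.pi μ) :=
    (iIndepFun_pi (X := fun _ x => x) fun _ => aemeasurable_id).precomp he
  refine ⟨by fun_prop, ?_⟩
  rw [(iIndepFun_iff_map_fun_eq_pi_map fun i =>
    (measurable_pi_apply (e i)).aemeasurable).1 hind]
  simp only [(measurePreserving_eval μ _).map_eq]

variable [DecidableEq J]

theorem measurePreserving_pi_update (j : J) :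
    MeasurePreserving (fun x : X j × (∀ j, X j) => Function.update x.2 j x.1)
      ((μ j).prod (Measure.pi μ)) (Measure.pi μ) := by
  have hmeas : Measurable fun x : X j × (∀ j, X j) => Function.update x.2 j x.1 :=
    measurable_update'.comp measurable_swap
  refine ⟨hmeas, (Measure.pi_eq fun s hs => ?_).symm⟩
  have hpre : (fun x : X j × (∀ j, X j) => Function.update x.2 j x.1) ⁻¹' Set.univ.pi s
      = s j ×ˢ Set.univ.pi (Function.update s j Set.univ) := by
    ext ⟨x, z⟩
    simp only [Set.mem_preimage, Set.mem_univ_pi, Set.mem_prod, Function.forall_update_iff z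
      (fun k y => y ∈ s k), Function.forall_update_iff s (fun k t => z k ∈ t),
      Set.mem_univ, true_and]
  rw [Measure.map_apply hmeas (MeasurableSet.univ_pi hs), hpre, Measure.prod_prod, Measure.pi_pi,
    ← Finset.mul_prod_erase _ _ (Finset.mem_univ j),
    ← Finset.mul_prod_erase _ (fun k => μ k (s k)) (Finset.mem_univ j), Function.update_self,
    measure_univ, one_mul]
  congr 1
  refine Finset.prod_congr rfl fun k hk => ?_
  rw [Function.update_of_ne (Finset.ne_of_mem_erase hk)]

theorem integral_pi_eq_integral_update {E : Type*} [NormedAddCommGroup E] [NormedSpace ℝ E]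
    (j : J) {F : (∀ j, X j) → E} (hF : AEStronglyMeasurable F (Measure.pi μ)) :
    ∫ z, F z ∂(Measure.pi μ)
      = ∫ x : X j × (∀ j, X j), F (Function.update x.2 j x.1) ∂((μ j).prod (Measure.pi μ)) := by
  have hupd := measurePreserving_pi_update μ j
  conv_lhs => rw [← hupd.map_eq]
  exact integral_map hupd.measurable.aemeasurable (hupd.map_eq.symm ▸ hF)

theorem integral_pi_eval_mul_of_update {𝕜 : Type*} [RCLike 𝕜] (j : J) {F : X j → 𝕜}
    {G : (∀ j, X j) → 𝕜} (hGj : ∀ z x, G (Function.update z j x) = G z)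
    (hF : AEStronglyMeasurable F (μ j)) (hG : AEStronglyMeasurable G (Measure.pi μ)) :
    ∫ z, F (z j) * G z ∂(Measure.pi μ) = (∫ x, F x ∂(μ j)) * ∫ z, G z ∂(Measure.pi μ) := by
  have hFj : AEStronglyMeasurable (fun z : ∀ j, X j => F (z j)) (Measure.pi μ) :=
    hF.comp_measurePreserving (measurePreserving_eval μ j)
  rw [integral_pi_eq_integral_update μ j (F := fun z => F (z j) * G z) (hFj.mul hG)]
  simp only [Function.update_self, hGj]
  exact integral_prod_mul F G

end ProductMeasure

section GaussianIntegrationByParts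

open scoped NNReal

theorem hasDerivAt_gaussianPDFReal (m : ℝ) (v : ℝ≥0) (x : ℝ) :
    HasDerivAt (gaussianPDFReal m v) (-((x - m) / v) * gaussianPDFReal m v x) x := by
  have hsq : HasDerivAt (fun y : ℝ => -(y - m) ^ 2 / (2 * v)) (-((x - m) / v)) x := by
    refine (((((hasDerivAt_id x).sub_const m).pow 2).neg).div_const (2 * (v : ℝ))).congr_deriv ?_
    simp only [id, Nat.cast_ofNat, Nat.add_one_sub_one, pow_one, mul_one]
    rw [← mul_neg, mul_div_mul_left _ _ two_ne_zero, neg_div]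
  refine (hsq.exp.const_mul (√(2 * Real.pi * v))⁻¹).congr_deriv ?_
  rw [gaussianPDFReal]
  ring

theorem integrable_gaussianReal_iff (m : ℝ) {v : ℝ≥0} (hv : v ≠ 0) (f : ℝ → ℝ) :
    Integrable f (gaussianReal m v) ↔ Integrable fun x => gaussianPDFReal m v x * f x := by
  rw [gaussianReal_of_var_ne_zero m hv,
    integrable_withDensity_iff_integrable_smul' (measurable_gaussianPDF m v)
      (ae_of_all _ fun x => gaussianPDF_lt_top)]
  simp only [toReal_gaussianPDF, smul_eq_mul]

theorem integrable_id_gaussianReal (m : ℝ) (v : ℝ≥0) :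
    Integrable (fun x : ℝ => x) (gaussianReal m v) :=
  (memLp_id_gaussianReal 1).integrable (by norm_num)

theorem integral_sub_mul_gaussianReal (m : ℝ) (v : ℝ≥0) {f f' : ℝ → ℝ}
    (hf : ∀ x, HasDerivAt f (f' x) x) (hfi : Integrable f (gaussianReal m v))
    (hfi' : Integrable f' (gaussianReal m v))
    (hxf : Integrable (fun x => (x - m) * f x) (gaussianReal m v)) :
    ∫ x, (x - m) * f x ∂(gaussianReal m v) = v * ∫ x, f' x ∂(gaussianReal m v) := by
  rcases eq_or_ne v 0 with rfl | hv
  · simp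
  have hv' : (v : ℝ) ≠ 0 := by exact_mod_cast hv
  rw [integrable_gaussianReal_iff m hv] at hfi hfi' hxf
  have hparts := integral_mul_deriv_eq_deriv_mul_of_integrable (fun x _ => hf x)
    (fun x _ => hasDerivAt_gaussianPDFReal m v x)
    ((hxf.const_mul (-(v : ℝ)⁻¹)).congr (ae_of_all _ fun x => by simp only [Pi.mul_apply]; ring))
    (hfi'.congr (ae_of_all _ fun x => mul_comm _ _))
    (hfi.congr (ae_of_all _ fun x => mul_comm _ _))
  rw [integral_gaussianReal_eq_integral_smul hv, integral_gaussianReal_eq_integral_smul hv]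
  calc ∫ x, gaussianPDFReal m v x • ((x - m) * f x)
      = ∫ x, -v * (f x * (-((x - m) / v) * gaussianPDFReal m v x)) := by
        congr 1 with x; rw [smul_eq_mul]; field_simp
    _ = v * ∫ x, f' x * gaussianPDFReal m v x := by
        rw [integral_const_mul, hparts]; ring
    _ = v * ∫ x, gaussianPDFReal m v x • f' x := by
        congr 2 with x; exact mul_comm _ _

/-- The law of a family of i.i.d. standard Gaussian variables. -/
abbrev gaussianPi (J : Type*) [Fintype J] : Measure (J → ℝ) :=
  Measure.pi fun _ => gaussianReal 0 1

variable {J : Type*} [Fintype J]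

theorem integrable_eval_gaussianPi (j : J) : Integrable (fun z : J → ℝ => z j) (gaussianPi J) :=
  (measurePreserving_eval (fun _ : J => gaussianReal 0 1) j).integrable_comp_of_integrable
    (integrable_id_gaussianReal 0 1)

theorem integral_eval_mul_gaussianPi [DecidableEq J] (j : J) {F F' : (J → ℝ) → ℝ}
    (hF : ∀ z x, HasDerivAt (fun y => F (Function.update z j y)) (F' (Function.update z j x)) x)
    (hFi : Integrable F (gaussianPi J)) (hFi' : Integrable F' (gaussianPi J))
    (hzF : Integrable (fun z => z j * F z) (gaussianPi J)) :
    ∫ z, z j * F z ∂(gaussianPi J) = ∫ z, F' z ∂(gaussianPi J) := by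
  have hupd := measurePreserving_pi_update (fun _ : J => gaussianReal 0 1) j
  have hi := hupd.integrable_comp_of_integrable hFi
  have hi' := hupd.integrable_comp_of_integrable hFi'
  have hzi := hupd.integrable_comp_of_integrable hzF
  simp only [Function.comp_def, Function.update_self] at hi hi' hzi
  rw [integral_pi_eq_integral_update _ j hzF.aestronglyMeasurable,
    integral_pi_eq_integral_update _ j hFi'.aestronglyMeasurable]
  simp only [Function.update_self]
  rw [integral_prod_symm _ hzi, integral_prod_symm _ hi']
  refine integral_congr_ae ?_
  filter_upwards [hi.prod_left_ae, hi'.prod_left_ae, hzi.prod_left_ae] with z h h' hz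
  simpa using integral_sub_mul_gaussianReal 0 1 (hF z) h h' (by simpa using hz)

end GaussianIntegrationByParts

section Marginal

variable {C R α : Type*} [Fintype C] [CommSemiring R] [Fintype α] [DecidableEq α] {w : C → R}

theorem sum_prod_eq_one (hw : ∑ s, w s = 1) : ∑ σ : α → C, ∏ k, w (σ k) = 1 := by
  have hexp := Finset.prod_univ_sum (fun _ : α => (Finset.univ : Finset C)) fun _ => w
  simp only [hw, Finset.prod_const_one, Fintype.piFinset_univ] at hexp
  exact hexp.symm

theorem sum_prod_mul_comp_injective {γ : Type*} [Fintype γ] [DecidableEq γ]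
    (hw : ∑ s, w s = 1) {ι : γ → α} (hι : Function.Injective ι) (f : (γ → C) → R) :
    ∑ σ : α → C, (∏ k, w (σ k)) * f (fun c => σ (ι c)) = ∑ τ : γ → C, (∏ c, w (τ c)) * f τ := by
  classical
  let range : α → Prop := fun k => ∃ c, ι c = k
  let toRange : γ ≃ {k // range k} := Equiv.ofInjective ι hι
  let e : ((γ → C) × ({k // ¬range k} → C)) ≃ (α → C) :=
    (Equiv.prodCongr (toRange.arrowCongr (Equiv.refl C)) (Equiv.refl _)).trans
      (Equiv.piEquivPiSubtypeProd range fun _ => C).symm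
  have he_range : ∀ x c, e x (ι c) = x.1 c := fun x c => by
    have hmem : range (ι c) := ⟨c, rfl⟩
    simp only [e, hmem, Equiv.piEquivPiSubtypeProd, Equiv.trans_apply, Equiv.coe_fn_symm_mk,
      dif_pos]
    exact congrArg x.1 (toRange.symm_apply_apply c)
  have he_compl : ∀ x (k : {k // ¬range k}), e x k = x.2 k := fun x k => by
    simp [e, Equiv.piEquivPiSubtypeProd, k.2]
  have hprod : ∀ x, ∏ k, w (e x k) = (∏ c, w (x.1 c)) * ∏ k, w (x.2 k) := fun x => by
    rw [← Fintype.prod_subtype_mul_prod_subtype range]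
    congr 1
    · exact (Fintype.prod_equiv toRange (fun c => w (x.1 c)) (fun k => w (e x k))
        fun c => congrArg w (he_range x c).symm).symm
    · exact Finset.prod_congr rfl fun k _ => congrArg w (he_compl x k)
  rw [← Equiv.sum_comp e, Fintype.sum_prod_type]
  refine Finset.sum_congr rfl fun τ _ => ?_
  simp only [hprod, he_range, ← Finset.mul_sum, ← Finset.sum_mul, sum_prod_eq_one hw, mul_one]

end Marginal

section Gibbs

theorem abs_le_sum_abs {I : Type*} [Fintype I] (f : I → ℝ) (i : I) : |f i| ≤ ∑ j, |f j| :=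
  Finset.single_le_sum (f := fun j => |f j|) (fun _ _ => abs_nonneg _) (Finset.mem_univ i)

variable {C : Type*} [Fintype C]

/-- The Gibbs probability with exponent `H` on a finite set. -/
def gibbsProb (H : C → ℝ) (s : C) : ℝ := Real.exp (H s) / ∑ t, Real.exp (H t)

/-- The average over i.i.d. replicas under the Gibbs probability with exponent `H`; the replicas are
indexed by an arbitrary finite type. -/
def gibbsAvg {α : Type*} [Fintype α] [DecidableEq α] (H : C → ℝ) (f : (α → C) → ℝ) : ℝ :=
  ∑ σ : α → C, (∏ k, gibbsProb H (σ k)) * f σ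

theorem gibbsProb_nonneg (H : C → ℝ) (s : C) : 0 ≤ gibbsProb H s := by
  unfold gibbsProb; positivity

theorem sum_gibbsProb_mul (H f : C → ℝ) :
    ∑ s, gibbsProb H s * f s = (∑ s, Real.exp (H s) * f s) / ∑ s, Real.exp (H s) := by
  simp only [gibbsProb, div_mul_eq_mul_div, Finset.sum_div]

theorem prod_gibbsProb_nonneg {α : Type*} [Fintype α] (H : C → ℝ) (σ : α → C) :
    0 ≤ ∏ k, gibbsProb H (σ k) :=
  Finset.prod_nonneg fun _ _ => gibbsProb_nonneg _ _

section GibbsProb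

variable [Nonempty C]

theorem sum_exp_pos (H : C → ℝ) : 0 < ∑ t, Real.exp (H t) :=
  Finset.sum_pos (fun _ _ => Real.exp_pos _) Finset.univ_nonempty

theorem sum_gibbsProb (H : C → ℝ) : ∑ s, gibbsProb H s = 1 := by
  simp only [gibbsProb, ← Finset.sum_div, div_self (sum_exp_pos H).ne']

theorem hasDerivAt_gibbsProb {H : ℝ → C → ℝ} {H' : C → ℝ} {t : ℝ}
    (hH : ∀ s, HasDerivAt (fun u => H u s) (H' s) t) (s : C) :
    HasDerivAt (fun u => gibbsProb (H u) s)
      (gibbsProb (H t) s * (H' s - ∑ r, gibbsProb (H t) r * H' r)) t := by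
  have hZ : HasDerivAt (fun u => ∑ r, Real.exp (H u r)) (∑ r, Real.exp (H t r) * H' r) t :=
    HasDerivAt.fun_sum fun r _ => (hH r).exp
  have hZ0 := (sum_exp_pos (H t)).ne'
  refine ((hH s).exp.div hZ hZ0).congr_deriv ?_
  rw [sum_gibbsProb_mul, gibbsProb]
  field_simp

theorem continuous_gibbsProb {Z : Type*} [TopologicalSpace Z] {H : Z → C → ℝ}
    (hH : ∀ s, Continuous fun z => H z s) (s : C) : Continuous fun z => gibbsProb (H z) s :=
  (Real.continuous_exp.comp (hH s)).div
    (continuous_finsetSum _ fun r _ => Real.continuous_exp.comp (hH r))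
    fun z => (sum_exp_pos (H z)).ne'

end GibbsProb

section Replicas

variable {α : Type*} [Fintype α] [DecidableEq α]

theorem sum_prod_gibbsProb [Nonempty C] (H : C → ℝ) :
    ∑ σ : α → C, ∏ k, gibbsProb H (σ k) = 1 :=
  sum_prod_eq_one (sum_gibbsProb H)

theorem continuous_gibbsAvg [Nonempty C] {Z : Type*} [TopologicalSpace Z] {H : Z → C → ℝ}
    (hH : ∀ s, Continuous fun z => H z s) (f : (α → C) → ℝ) :
    Continuous fun z => gibbsAvg (H z) f :=
  continuous_finsetSum _ fun _ _ =>
    (continuous_finsetProd _ fun _ _ => continuous_gibbsProb hH _).mul continuous_const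

theorem abs_gibbsAvg_le [Nonempty C] (H : C → ℝ) {f : (α → C) → ℝ} {K : ℝ}
    (hf : ∀ σ, |f σ| ≤ K) : |gibbsAvg H f| ≤ K :=
  calc |∑ σ : α → C, (∏ k, gibbsProb H (σ k)) * f σ|
      ≤ ∑ σ : α → C, |(∏ k, gibbsProb H (σ k)) * f σ| := Finset.abs_sum_le_sum_abs _ _
    _ ≤ ∑ σ : α → C, (∏ k, gibbsProb H (σ k)) * K := by
        refine Finset.sum_le_sum fun σ _ => ?_
        rw [abs_mul, abs_of_nonneg (prod_gibbsProb_nonneg H σ)]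
        exact mul_le_mul_of_nonneg_left (hf σ) (prod_gibbsProb_nonneg H σ)
    _ = K := by rw [← Finset.sum_mul, sum_prod_gibbsProb, one_mul]

theorem gibbsAvg_comp_injective [Nonempty C] {γ : Type*} [Fintype γ] [DecidableEq γ] (H : C → ℝ)
    {ι : γ → α} (hι : Function.Injective ι) (f : (γ → C) → ℝ) :
    gibbsAvg H (fun σ : α → C => f (fun c => σ (ι c))) = gibbsAvg H f :=
  sum_prod_mul_comp_injective (sum_gibbsProb H) hι f

theorem gibbsProb_comp_equiv_add {A B : Type*} [Fintype A] [Fintype B] (e : C ≃ A × B)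
    (a : A → ℝ) (b : B → ℝ) (s : C) :
    gibbsProb (fun s => a (e s).1 + b (e s).2) s = gibbsProb a (e s).1 * gibbsProb b (e s).2 := by
  simp only [gibbsProb]
  rw [Equiv.sum_comp e (fun x : A × B => Real.exp (a x.1 + b x.2)), Fintype.sum_prod_type]
  simp only [Real.exp_add, ← Finset.mul_sum, ← Finset.sum_mul]
  rw [mul_div_mul_comm]

theorem gibbsAvg_comp_equiv_mul {A B : Type*} [Fintype A] [Fintype B] (e : C ≃ A × B)
    (a : A → ℝ) (b : B → ℝ) (φ : (α → A) → ℝ) (ψ : (α → B) → ℝ) :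
    gibbsAvg (fun s => a (e s).1 + b (e s).2)
      (fun σ : α → C => φ (fun k => (e (σ k)).1) * ψ (fun k => (e (σ k)).2))
      = gibbsAvg a φ * gibbsAvg b ψ := by
  unfold gibbsAvg
  rw [Finset.sum_mul_sum, ← Fintype.sum_prod_type',
    ← Equiv.sum_comp ((Equiv.arrowCongr (Equiv.refl α) e).trans
      (Equiv.arrowProdEquivProdArrow α (fun _ => A) (fun _ => B)))]
  refine Finset.sum_congr rfl fun σ _ => ?_
  simp only [gibbsProb_comp_equiv_add, Finset.prod_mul_distrib, Equiv.trans_apply,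
    Equiv.arrowCongr_apply, Equiv.coe_refl, Equiv.arrowProdEquivProdArrow_apply,
    Function.comp_apply, Equiv.refl_symm, id]
  ring

theorem gibbsAvg_affine [Nonempty C] {I : Type*} [Fintype I] (H : C → ℝ) (a c : ℝ)
    (f : I → (α → C) → ℝ) :
    gibbsAvg H (fun σ => a * ∑ i, f i σ - c) = a * ∑ i, gibbsAvg H (f i) - c := by
  unfold gibbsAvg
  simp only [mul_sub, Finset.sum_sub_distrib, ← Finset.sum_mul, sum_prod_gibbsProb, one_mul]
  rw [Finset.sum_comm, Finset.mul_sum]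
  simp only [Finset.mul_sum, mul_left_comm]

end Replicas

section FinReplicas

variable {m n : ℕ}

theorem gibbsAvg_append (H : C → ℝ) (f : (Fin m → C) → ℝ) (g : (Fin n → C) → ℝ) :
    gibbsAvg H (fun σ : Fin (m + n) → C =>
      f (fun k => σ (Fin.castAdd n k)) * g (fun k => σ (Fin.natAdd m k)))
      = gibbsAvg H f * gibbsAvg H g := by
  unfold gibbsAvg
  rw [Finset.sum_mul_sum, ← Fintype.sum_prod_type', ← Equiv.sum_comp (Fin.appendEquiv m n)]
  refine Finset.sum_congr rfl fun x _ => ?_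
  simp only [Fin.appendEquiv, Equiv.coe_fn_mk, Fin.prod_univ_add, Fin.append_left,
    Fin.append_right]
  ring

theorem gibbsAvg_snoc (H : C → ℝ) (F : (Fin n → C) → C → ℝ) :
    gibbsAvg H (fun σ : Fin (n + 1) → C => F (fun k => σ k.castSucc) (σ (Fin.last n)))
      = gibbsAvg H fun τ => ∑ s, gibbsProb H s * F τ s := by
  unfold gibbsAvg
  rw [← Equiv.sum_comp (Fin.snocEquiv fun _ : Fin (n + 1) => C), Fintype.sum_prod_type_right]
  refine Finset.sum_congr rfl fun τ _ => ?_
  simp only [Finset.mul_sum, Fin.snocEquiv, Equiv.coe_fn_mk, Fin.prod_univ_castSucc,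
    Fin.snoc_castSucc, Fin.snoc_last, mul_assoc]

/-- The derivation rule for Gibbs averages: the function of `n + 1` replicas whose average is the
derivative of the average of `f` when the exponent has derivative `h`. -/
def replicaDeriv (f : (Fin n → C) → ℝ) (h : C → ℝ) (σ : Fin (n + 1) → C) : ℝ :=
  f (fun k => σ k.castSucc) * (∑ k : Fin n, h (σ k.castSucc) - n * h (σ (Fin.last n)))

theorem gibbsAvg_replicaDeriv [Nonempty C] (H : C → ℝ) (f : (Fin n → C) → ℝ) (h : C → ℝ) :
    gibbsAvg H (replicaDeriv f h)
      = gibbsAvg H fun τ => f τ * ∑ k, (h (τ k) - ∑ r, gibbsProb H r * h r) := by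
  unfold replicaDeriv
  rw [gibbsAvg_snoc H fun τ s => f τ * (∑ k : Fin n, h (τ k) - n * h s)]
  congr 1 with τ
  calc ∑ s, gibbsProb H s * (f τ * (∑ k, h (τ k) - n * h s))
      = f τ * ((∑ s, gibbsProb H s) * ∑ k, h (τ k) - n * ∑ s, gibbsProb H s * h s) := by
        rw [Finset.sum_mul, Finset.mul_sum (a := (n : ℝ)), ← Finset.sum_sub_distrib, Finset.mul_sum]
        exact Finset.sum_congr rfl fun s _ => by ring
    _ = f τ * ∑ k, (h (τ k) - ∑ r, gibbsProb H r * h r) := by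
        simp only [sum_gibbsProb, one_mul, Finset.sum_sub_distrib, Finset.sum_const,
          Finset.card_univ, Fintype.card_fin, nsmul_eq_mul]

theorem hasDerivAt_gibbsAvg [Nonempty C] {H : ℝ → C → ℝ} {H' : C → ℝ} {t : ℝ}
    (hH : ∀ s, HasDerivAt (fun u => H u s) (H' s) t) (f : (Fin n → C) → ℝ) :
    HasDerivAt (fun u => gibbsAvg (H u) f) (gibbsAvg (H t) (replicaDeriv f H')) t := by
  rw [gibbsAvg_replicaDeriv]
  unfold gibbsAvg
  refine HasDerivAt.fun_sum fun σ _ => ?_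
  have hprod := HasDerivAt.fun_finsetProd (u := Finset.univ) (x := t)
    fun k _ => hasDerivAt_gibbsProb hH (σ k)
  refine (hprod.mul_const (f σ)).congr_deriv ?_
  simp only [Finset.mul_sum, Finset.sum_mul]
  refine Finset.sum_congr rfl fun k hk => ?_
  rw [smul_eq_mul, ← Finset.mul_prod_erase _ _ hk]
  ring

theorem abs_replicaDeriv_le {C : Type*} {f : (Fin n → C) → ℝ} {h : C → ℝ} {K L : ℝ}
    (hf : ∀ σ, |f σ| ≤ K) (hh : ∀ s, |h s| ≤ L) (σ : Fin (n + 1) → C) :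
    |replicaDeriv f h σ| ≤ K * (2 * n * L) := by
  rw [replicaDeriv, abs_mul]
  refine mul_le_mul (hf _) ?_ (abs_nonneg _) ((abs_nonneg _).trans (hf fun k => σ k.castSucc))
  calc |∑ k : Fin n, h (σ k.castSucc) - n * h (σ (Fin.last n))|
      ≤ ∑ k : Fin n, |h (σ k.castSucc)| + n * |h (σ (Fin.last n))| := by
        refine (abs_sub _ _).trans (add_le_add (Finset.abs_sum_le_sum_abs _ _) ?_)
        rw [abs_mul, Nat.abs_cast]
    _ ≤ ∑ _k : Fin n, L + n * L := by gcongr <;> exact hh _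
    _ = 2 * n * L := by
        simp only [Finset.sum_const, Finset.card_univ, Fintype.card_fin, nsmul_eq_mul]; ring

end FinReplicas

end Gibbs

/-- A path, parametrized by an angle, of Gaussian Hamiltonians on a configuration space `C`: at
angle `θ` the Hamiltonian is `∑ j, z j * c θ j s + d θ s` with `z` i.i.d. standard Gaussian. Its
covariance and its deterministic part vary at the rates `sin θ cos θ • cov` and
`sin θ cos θ • diag`. -/
structure GaussianPath (J C : Type*) [Fintype J] where
  c : ℝ → J → C → ℝ
  c' : ℝ → J → C → ℝ
  d : ℝ → C → ℝ
  bound : ℝ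
  cov : C → C → ℝ
  diag : C → ℝ
  hasDerivAt_c : ∀ θ j s, HasDerivAt (fun t => c t j s) (c' θ j s) θ
  hasDerivAt_d : ∀ θ s, HasDerivAt (fun t => d t s) (Real.sin θ * Real.cos θ * diag s) θ
  abs_c'_le : ∀ θ j s, |c' θ j s| ≤ bound
  sum_c' : ∀ θ s t, ∑ j, c' θ j s * c θ j t = Real.sin θ * Real.cos θ * cov s t

/-- The coefficients of the `n + 2` replicas in the first derivation of an average of `n`
replicas. -/
def driftU (n : ℕ) (k : Fin (n + 2)) : ℝ :=
  if (k : ℕ) < n then 1 else if (k : ℕ) = n then -n else 0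

/-- The coefficients of the `n + 2` replicas in the second derivation of an average of `n`
replicas. -/
def driftV (n : ℕ) (k : Fin (n + 2)) : ℝ := if (k : ℕ) < n + 1 then 1 else -(n + 1)

theorem sum_driftU_mul {n : ℕ} (x : Fin (n + 2) → ℝ) :
    ∑ k, driftU n k * x k
      = ∑ k : Fin n, x k.castSucc.castSucc - n * x (Fin.last n).castSucc := by
  rw [Fin.sum_univ_castSucc, Fin.sum_univ_castSucc]
  simp [driftU]
  ring

theorem sum_driftV_mul {n : ℕ} (x : Fin (n + 2) → ℝ) :
    ∑ k, driftV n k * x k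
      = ∑ k : Fin (n + 1), x k.castSucc - (n + 1 : ℕ) * x (Fin.last (n + 1)) := by
  have hcast : ∀ k : Fin (n + 1), driftV n k.castSucc = 1 := fun k => if_pos k.isLt
  have hlast : driftV n (Fin.last (n + 1)) = -(n + 1) := if_neg (lt_irrefl _)
  rw [Fin.sum_univ_castSucc]
  simp only [hcast, hlast]
  push_cast
  ring_nf

section ReplicaDeriv

variable {C : Type*} {n : ℕ} (f : (Fin n → C) → ℝ)

theorem replicaDeriv_replicaDeriv (a b : C → ℝ) (σ : Fin (n + 2) → C) :
    replicaDeriv (replicaDeriv f a) b σ = f (fun k => σ k.castSucc.castSucc) *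
      ((∑ k, driftU n k * a (σ k)) * ∑ l, driftV n l * b (σ l)) := by
  rw [sum_driftU_mul, sum_driftV_mul]
  unfold replicaDeriv
  ring

theorem replicaDeriv_sum_add {J : Type*} [Fintype J] (z : J → ℝ) (h : J → C → ℝ) (e : C → ℝ)
    (σ : Fin (n + 1) → C) :
    replicaDeriv f (fun s => ∑ j, z j * h j s + e s) σ
      = ∑ j, z j * replicaDeriv f (h j) σ + replicaDeriv f e σ := by
  simp only [replicaDeriv, Finset.sum_add_distrib, mul_add, mul_sub, Finset.mul_sum,
    Finset.sum_sub_distrib]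
  rw [Finset.sum_comm]
  simp only [mul_left_comm]
  ring

theorem gibbsAvg_replicaDeriv_sum_add {J : Type*} [Fintype J] [Fintype C] (H : C → ℝ)
    (z : J → ℝ) (h : J → C → ℝ) (e : C → ℝ) :
    gibbsAvg H (replicaDeriv f fun s => ∑ j, z j * h j s + e s)
      = ∑ j, z j * gibbsAvg H (replicaDeriv f (h j)) + gibbsAvg H (replicaDeriv f e) := by
  simp only [gibbsAvg, replicaDeriv_sum_add, mul_add, Finset.sum_add_distrib, Finset.mul_sum]
  rw [Finset.sum_comm]
  simp only [mul_left_comm]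

end ReplicaDeriv

namespace GaussianPath

variable {J C : Type*} [Fintype J] (X : GaussianPath J C)

/-- The Hamiltonian at angle `θ` and disorder `z`. -/
def energy (θ : ℝ) (z : J → ℝ) (s : C) : ℝ := ∑ j, z j * X.c θ j s + X.d θ s

/-- The derivative of the Hamiltonian in the angle. -/
def energyDeriv (θ : ℝ) (z : J → ℝ) (s : C) : ℝ :=
  ∑ j, z j * X.c' θ j s + Real.sin θ * Real.cos θ * X.diag s

/-- The average over the disorder and over replicas. -/
def avg [Fintype C] {n : ℕ} (θ : ℝ) (f : (Fin n → C) → ℝ) : ℝ :=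
  ∫ z, gibbsAvg (X.energy θ z) f ∂(gaussianPi J)

/-- The function of `n + 2` replicas whose average gives the derivative of the average of `f`. -/
def drift {n : ℕ} (f : (Fin n → C) → ℝ) (σ : Fin (n + 2) → C) : ℝ :=
  f (fun k => σ k.castSucc.castSucc) *
    (∑ k, ∑ l, driftU n k * driftV n l * X.cov (σ k) (σ l) + ∑ k, driftU n k * X.diag (σ k))

theorem continuous_energy (θ : ℝ) (s : C) : Continuous fun z => X.energy θ z s := by
  unfold energy; fun_prop

theorem hasDerivAt_energy (z : J → ℝ) (θ : ℝ) (s : C) :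
    HasDerivAt (fun t => X.energy t z s) (X.energyDeriv θ z s) θ :=
  (HasDerivAt.fun_sum fun j _ => (X.hasDerivAt_c θ j s).const_mul _).add (X.hasDerivAt_d θ s)

theorem hasDerivAt_energy_update [DecidableEq J] (θ : ℝ) (z : J → ℝ) (j : J) (x : ℝ) (s : C) :
    HasDerivAt (fun y => X.energy θ (Function.update z j y) s) (X.c θ j s) x := by
  have hcoord : ∀ i, HasDerivAt (fun y => Function.update z j y i * X.c θ i s)
      ((Pi.single j 1 : J → ℝ) i * X.c θ i s) x := fun i =>
    (hasDerivAt_pi.1 (hasDerivAt_update z j x) i).mul_const _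
  refine ((HasDerivAt.fun_sum (u := Finset.univ) fun i _ => hcoord i).add_const
    (X.d θ s)).congr_deriv ?_
  simp [Pi.single_apply]

theorem abs_energyDeriv_le [Fintype C] (z : J → ℝ) (θ : ℝ) (s : C) :
    |X.energyDeriv θ z s| ≤ ∑ j, |z j| * X.bound + ∑ s, |X.diag s| := by
  have hsc : |Real.sin θ * Real.cos θ| ≤ 1 := by
    rw [abs_mul]
    exact mul_le_one₀ (Real.abs_sin_le_one θ) (abs_nonneg _) (Real.abs_cos_le_one θ)
  calc |X.energyDeriv θ z s|
      ≤ |∑ j, z j * X.c' θ j s| + |Real.sin θ * Real.cos θ * X.diag s| := abs_add_le _ _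
    _ ≤ ∑ j, |z j * X.c' θ j s| + |Real.sin θ * Real.cos θ| * |X.diag s| := by
        rw [abs_mul (_ * _)]
        gcongr
        exact Finset.abs_sum_le_sum_abs _ _
    _ ≤ ∑ j, |z j| * X.bound + 1 * ∑ s, |X.diag s| := by
        simp only [abs_mul (z _)]
        gcongr
        · exact X.abs_c'_le θ _ s
        · exact abs_le_sum_abs X.diag s
    _ = ∑ j, |z j| * X.bound + ∑ s, |X.diag s| := by rw [one_mul]

variable [Fintype C] [Nonempty C] {n : ℕ}

theorem abs_gibbsAvg_energy_le (θ : ℝ) (f : (Fin n → C) → ℝ) (z : J → ℝ) :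
    |gibbsAvg (X.energy θ z) f| ≤ ∑ σ, |f σ| :=
  abs_gibbsAvg_le _ (abs_le_sum_abs f)

theorem integrable_gibbsAvg (θ : ℝ) (f : (Fin n → C) → ℝ) :
    Integrable (fun z => gibbsAvg (X.energy θ z) f) (gaussianPi J) :=
  Integrable.of_bound (continuous_gibbsAvg (X.continuous_energy θ) f).aestronglyMeasurable _
    (ae_of_all _ (X.abs_gibbsAvg_energy_le θ f))

theorem integrable_eval_mul_gibbsAvg (θ : ℝ) (f : (Fin n → C) → ℝ) (j : J) :
    Integrable (fun z => z j * gibbsAvg (X.energy θ z) f) (gaussianPi J) :=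
  (integrable_eval_gaussianPi j).mul_bdd (X.integrable_gibbsAvg θ f).aestronglyMeasurable
    (ae_of_all _ (X.abs_gibbsAvg_energy_le θ f))

section Linear

variable (θ : ℝ)

/-- The averaged probability of a configuration of replicas. -/
def weight (σ : Fin n → C) : ℝ := ∫ z, ∏ k, gibbsProb (X.energy θ z) (σ k) ∂(gaussianPi J)

omit [Nonempty C] in
theorem weight_nonneg (σ : Fin n → C) : 0 ≤ X.weight θ σ :=
  integral_nonneg fun _ => prod_gibbsProb_nonneg _ _

theorem integrable_prod_gibbsProb (σ : Fin n → C) :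
    Integrable (fun z => ∏ k, gibbsProb (X.energy θ z) (σ k)) (gaussianPi J) := by
  classical
  refine (X.integrable_gibbsAvg θ (Pi.single σ (1 : ℝ))).congr (ae_of_all _ fun z => ?_)
  simp [gibbsAvg, Pi.single_apply]

theorem avg_eq_sum (f : (Fin n → C) → ℝ) : X.avg θ f = ∑ σ, X.weight θ σ * f σ := by
  unfold avg weight gibbsAvg
  rw [integral_finsetSum _ fun σ _ => (X.integrable_prod_gibbsProb θ σ).mul_const _]
  simp_rw [integral_mul_const]

theorem avg_const (a : ℝ) : X.avg θ (fun _ : Fin n → C => a) = a := by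
  simp [avg, gibbsAvg, ← Finset.sum_mul, sum_prod_gibbsProb]

theorem avg_add (f g : (Fin n → C) → ℝ) :
    X.avg θ (fun σ => f σ + g σ) = X.avg θ f + X.avg θ g := by
  simp only [avg_eq_sum, mul_add, Finset.sum_add_distrib]

theorem avg_sub (f g : (Fin n → C) → ℝ) :
    X.avg θ (fun σ => f σ - g σ) = X.avg θ f - X.avg θ g := by
  simp only [avg_eq_sum, mul_sub, Finset.sum_sub_distrib]

theorem avg_const_mul (a : ℝ) (f : (Fin n → C) → ℝ) :
    X.avg θ (fun σ => a * f σ) = a * X.avg θ f := by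
  simp only [avg_eq_sum, Finset.mul_sum, mul_left_comm]

theorem avg_sum {I : Type*} (t : Finset I) (f : I → (Fin n → C) → ℝ) :
    X.avg θ (fun σ => ∑ i ∈ t, f i σ) = ∑ i ∈ t, X.avg θ (f i) := by
  simp only [avg_eq_sum, Finset.mul_sum]
  exact Finset.sum_comm

theorem avg_mono {f g : (Fin n → C) → ℝ} (h : ∀ σ, f σ ≤ g σ) : X.avg θ f ≤ X.avg θ g := by
  simp only [avg_eq_sum]
  exact Finset.sum_le_sum fun σ _ => mul_le_mul_of_nonneg_left (h σ) (X.weight_nonneg θ σ)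

theorem avg_nonneg {f : (Fin n → C) → ℝ} (h : ∀ σ, 0 ≤ f σ) : 0 ≤ X.avg θ f := by
  simpa only [avg_const] using X.avg_mono θ h

theorem abs_avg_le {f g : (Fin n → C) → ℝ} (h : ∀ σ, |f σ| ≤ g σ) : |X.avg θ f| ≤ X.avg θ g := by
  have hneg := X.avg_mono θ (f := fun σ => -1 * g σ) (g := f) fun σ => by
    linarith [neg_abs_le (f σ), h σ]
  rw [avg_const_mul] at hneg
  exact abs_le.2 ⟨by linarith, X.avg_mono θ fun σ => (le_abs_self _).trans (h σ)⟩

theorem avg_comp_injective {m : ℕ} {ι : Fin m → Fin n} (hι : Function.Injective ι)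
    (f : (Fin m → C) → ℝ) : X.avg θ (fun σ : Fin n → C => f (fun c => σ (ι c))) = X.avg θ f := by
  simp_rw [avg, gibbsAvg_comp_injective _ hι f]

theorem avg_comp_castSucc_castSucc (f : (Fin n → C) → ℝ) :
    X.avg θ (fun σ : Fin (n + 2) → C => f fun k => σ k.castSucc.castSucc) = X.avg θ f :=
  X.avg_comp_injective θ ((Fin.castSucc_injective (n + 1)).comp (Fin.castSucc_injective n)) f

theorem avg_replicaDeriv (f : (Fin n → C) → ℝ) (h : C → ℝ) :
    X.avg θ (replicaDeriv f h) = X.avg θ fun σ : Fin (n + 2) → C =>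
      f (fun k => σ k.castSucc.castSucc) * ∑ k, driftU n k * h (σ k) := by
  simp only [sum_driftU_mul]
  exact (X.avg_comp_injective θ (Fin.castSucc_injective _) (replicaDeriv f h)).symm

end Linear

section Derivative

theorem hasDerivAt_avg_integral (f : (Fin n → C) → ℝ) (θ : ℝ) :
    HasDerivAt (fun t => X.avg t f)
      (∫ z, gibbsAvg (X.energy θ z) (replicaDeriv f (X.energyDeriv θ z)) ∂(gaussianPi J)) θ := by
  have hderiv_int : Integrable (fun z =>
      gibbsAvg (X.energy θ z) (replicaDeriv f (X.energyDeriv θ z))) (gaussianPi J) := by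
    unfold energyDeriv
    simp_rw [gibbsAvg_replicaDeriv_sum_add]
    exact (integrable_finsetSum _ fun j _ => X.integrable_eval_mul_gibbsAvg θ _ j).add
      (X.integrable_gibbsAvg θ _)
  have hbound_int : Integrable (fun z : J → ℝ =>
      (∑ σ, |f σ|) * (2 * n * (∑ j, |z j| * X.bound + ∑ s, |X.diag s|))) (gaussianPi J) :=
    (((integrable_finsetSum _ fun j _ => (integrable_eval_gaussianPi j).abs.mul_const _).add
      (integrable_const _)).const_mul _).const_mul _
  exact (hasDerivAt_integral_of_dominated_loc_of_deriv_le (s := Set.univ)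
    (F' := fun t z => gibbsAvg (X.energy t z) (replicaDeriv f (X.energyDeriv t z)))
    Filter.univ_mem (.of_forall fun t => (X.integrable_gibbsAvg t f).aestronglyMeasurable)
    (X.integrable_gibbsAvg θ f) hderiv_int.aestronglyMeasurable
    (ae_of_all _ fun z t _ => abs_gibbsAvg_le _
      (abs_replicaDeriv_le (abs_le_sum_abs f) (X.abs_energyDeriv_le z t))) hbound_int
    (ae_of_all _ fun z t _ => hasDerivAt_gibbsAvg (X.hasDerivAt_energy z t) f)).2

theorem integral_eval_mul_gibbsAvg (θ : ℝ) (j : J) (g : (Fin n → C) → ℝ) :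
    ∫ z, z j * gibbsAvg (X.energy θ z) g ∂(gaussianPi J)
      = X.avg θ (replicaDeriv g (X.c θ j)) := by
  classical
  exact integral_eval_mul_gaussianPi j
    (fun z x => hasDerivAt_gibbsAvg (fun s => X.hasDerivAt_energy_update θ z j x s) g)
    (X.integrable_gibbsAvg θ g) (X.integrable_gibbsAvg θ _) (X.integrable_eval_mul_gibbsAvg θ g j)

omit [Fintype C] [Nonempty C] in
theorem sum_driftU_mul_driftV (θ : ℝ) (σ : Fin (n + 2) → C) :
    ∑ j, (∑ k, driftU n k * X.c' θ j (σ k)) * ∑ l, driftV n l * X.c θ j (σ l)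
      = Real.sin θ * Real.cos θ * ∑ k, ∑ l, driftU n k * driftV n l * X.cov (σ k) (σ l) := by
  calc ∑ j, (∑ k, driftU n k * X.c' θ j (σ k)) * ∑ l, driftV n l * X.c θ j (σ l)
      = ∑ k, ∑ l, driftU n k * driftV n l * ∑ j, X.c' θ j (σ k) * X.c θ j (σ l) := by
        simp_rw [Finset.sum_mul_sum, Finset.mul_sum, mul_mul_mul_comm]
        rw [Finset.sum_comm]
        exact Finset.sum_congr rfl fun k _ => Finset.sum_comm
    _ = _ := by simp only [X.sum_c', Finset.mul_sum, mul_left_comm]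

theorem hasDerivAt_avg (f : (Fin n → C) → ℝ) (θ : ℝ) :
    HasDerivAt (fun t => X.avg t f) (Real.sin θ * Real.cos θ * X.avg θ (X.drift f)) θ := by
  refine (X.hasDerivAt_avg_integral f θ).congr_deriv ?_
  unfold energyDeriv
  simp_rw [gibbsAvg_replicaDeriv_sum_add]
  rw [integral_add (integrable_finsetSum _ fun j _ => X.integrable_eval_mul_gibbsAvg θ _ j)
      (X.integrable_gibbsAvg θ _),
    integral_finsetSum _ fun j _ => X.integrable_eval_mul_gibbsAvg θ _ j]
  simp_rw [integral_eval_mul_gibbsAvg]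
  rw [← avg, avg_replicaDeriv, ← avg_sum, ← avg_add, ← avg_const_mul]
  congr 1 with σ
  simp only [replicaDeriv_replicaDeriv, ← Finset.mul_sum, sum_driftU_mul_driftV, drift,
    mul_left_comm _ (Real.sin θ * Real.cos θ)]
  ring

end Derivative

section MeanValue

theorem abs_sin_mul_cos_le (θ : ℝ) : |Real.sin θ * Real.cos θ| ≤ 1 / 2 := by
  rw [abs_le]
  constructor <;> nlinarith [sq_nonneg (Real.sin θ + Real.cos θ),
    sq_nonneg (Real.sin θ - Real.cos θ), Real.sin_sq_add_cos_sq θ]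

theorem abs_sub_le_of_hasDerivAt_sin_mul_cos_mul {φ ψ : ℝ → ℝ} {B : ℝ}
    (h : ∀ θ, HasDerivAt φ (Real.sin θ * Real.cos θ * ψ θ) θ)
    (hB : ∀ θ ∈ Set.Icc 0 (Real.pi / 2), |ψ θ| ≤ B) {x y : ℝ}
    (hx : x ∈ Set.Icc 0 (Real.pi / 2)) (hy : y ∈ Set.Icc 0 (Real.pi / 2)) :
    |φ y - φ x| ≤ B := by
  have hB0 : 0 ≤ B := (abs_nonneg _).trans (hB _ hx)
  have hderiv_le : ∀ θ ∈ Set.Icc 0 (Real.pi / 2), ‖Real.sin θ * Real.cos θ * ψ θ‖ ≤ 1 / 2 * B :=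
    fun θ hθ => by
      rw [Real.norm_eq_abs, abs_mul]
      exact mul_le_mul (abs_sin_mul_cos_le θ) (hB θ hθ) (abs_nonneg _) (by norm_num)
  have hyx : ‖y - x‖ ≤ 2 := by
    rw [Real.norm_eq_abs, abs_le]
    constructor <;> linarith [hx.1, hx.2, hy.1, hy.2, Real.pi_le_four]
  calc |φ y - φ x| ≤ 1 / 2 * B * ‖y - x‖ :=
        (convex_Icc 0 (Real.pi / 2)).norm_image_sub_le_of_norm_hasDerivWithin_le
          (fun θ _ => (h θ).hasDerivWithinAt) hderiv_le hx hy
    _ ≤ 1 / 2 * B * 2 := by gcongr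
    _ = B := by ring

theorem zero_mem_Icc_pi_div_two : (0 : ℝ) ∈ Set.Icc 0 (Real.pi / 2) := ⟨le_rfl, by positivity⟩

theorem pi_div_two_mem_Icc : Real.pi / 2 ∈ Set.Icc 0 (Real.pi / 2) := ⟨by positivity, le_rfl⟩

theorem abs_avg_sub_avg_le {f : (Fin n → C) → ℝ} {B : ℝ}
    (hB : ∀ θ ∈ Set.Icc 0 (Real.pi / 2), |X.avg θ (X.drift f)| ≤ B) {x y : ℝ}
    (hx : x ∈ Set.Icc 0 (Real.pi / 2)) (hy : y ∈ Set.Icc 0 (Real.pi / 2)) :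
    |X.avg y f - X.avg x f| ≤ B :=
  abs_sub_le_of_hasDerivAt_sin_mul_cos_mul (X.hasDerivAt_avg f) hB hx hy

theorem abs_avg_sub_avg_sub_le {f : (Fin n → C) → ℝ} {B : ℝ}
    (hB : ∀ θ ∈ Set.Icc 0 (Real.pi / 2), |X.avg θ (X.drift (X.drift f))| ≤ B) :
    |X.avg (Real.pi / 2) f - X.avg 0 f - 1 / 2 * X.avg 0 (X.drift f)| ≤ B := by
  have hdrift : ∀ θ ∈ Set.Icc 0 (Real.pi / 2),
      |X.avg θ (X.drift f) - X.avg 0 (X.drift f)| ≤ B := fun θ hθ =>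
    X.abs_avg_sub_avg_le hB zero_mem_Icc_pi_div_two hθ
  have hderiv : ∀ θ, HasDerivAt
      (fun t => X.avg t f - 1 / 2 * Real.sin t ^ 2 * X.avg 0 (X.drift f))
      (Real.sin θ * Real.cos θ * (X.avg θ (X.drift f) - X.avg 0 (X.drift f))) θ := fun θ => by
    refine ((X.hasDerivAt_avg f θ).sub
      ((((Real.hasDerivAt_sin θ).pow 2).const_mul (1 / 2)).mul_const _)).congr_deriv ?_
    norm_num
    ring
  have hends := abs_sub_le_of_hasDerivAt_sin_mul_cos_mul hderiv hdrift zero_mem_Icc_pi_div_two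
    pi_div_two_mem_Icc
  simp only [Real.sin_pi_div_two, Real.sin_zero] at hends
  convert hends using 2
  ring

theorem abs_avg_drift_le {f : (Fin n → C) → ℝ} {G : ℝ}
    (h : ∀ σ, |X.drift f σ| ≤ G * f fun k => σ k.castSucc.castSucc) (θ : ℝ) :
    |X.avg θ (X.drift f)| ≤ G * X.avg θ f := by
  refine (X.abs_avg_le θ h).trans_eq ?_
  rw [avg_const_mul, avg_comp_castSucc_castSucc]

theorem monotone_exp_mul_avg {f : (Fin n → C) → ℝ} {G : ℝ}
    (h : ∀ σ, |X.drift f σ| ≤ G * f fun k => σ k.castSucc.castSucc) :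
    Monotone fun θ => Real.exp (G / 2 * θ) * X.avg θ f := by
  have hlower : ∀ θ, -(G / 2 * X.avg θ f) ≤ Real.sin θ * Real.cos θ * X.avg θ (X.drift f) := by
    intro θ
    have hle : |Real.sin θ * Real.cos θ * X.avg θ (X.drift f)| ≤ 1 / 2 * (G * X.avg θ f) := by
      rw [abs_mul]
      exact mul_le_mul (abs_sin_mul_cos_le θ) (X.abs_avg_drift_le h θ) (abs_nonneg _)
        (by norm_num)
    linarith [neg_le_of_abs_le hle]
  have hderiv : ∀ θ, HasDerivAt (fun u => Real.exp (G / 2 * u) * X.avg u f)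
      (Real.exp (G / 2 * θ) * (G / 2 * X.avg θ f
        + Real.sin θ * Real.cos θ * X.avg θ (X.drift f))) θ := fun θ => by
    refine ((((hasDerivAt_id θ).const_mul (G / 2)).exp).mul
      (X.hasDerivAt_avg f θ)).congr_deriv ?_
    simp only [id, mul_one]
    ring
  refine monotone_of_deriv_nonneg (fun θ => (hderiv θ).differentiableAt) fun θ => ?_
  rw [(hderiv θ).deriv]
  exact mul_nonneg (Real.exp_pos _).le (by linarith [hlower θ])

theorem avg_le_exp_mul_avg {f : (Fin n → C) → ℝ} {G : ℝ} (hf : ∀ σ, 0 ≤ f σ) (hG : 0 ≤ G)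
    (h : ∀ σ, |X.drift f σ| ≤ G * f fun k => σ k.castSucc.castSucc) {θ : ℝ}
    (hθ : θ ∈ Set.Icc 0 (Real.pi / 2)) :
    X.avg θ f ≤ Real.exp G * X.avg (Real.pi / 2) f :=
  calc X.avg θ f ≤ Real.exp (G / 2 * θ) * X.avg θ f :=
        le_mul_of_one_le_left (X.avg_nonneg θ hf)
          (Real.one_le_exp (mul_nonneg (by linarith) hθ.1))
    _ ≤ Real.exp (G / 2 * (Real.pi / 2)) * X.avg (Real.pi / 2) f := X.monotone_exp_mul_avg h hθ.2
    _ ≤ Real.exp G * X.avg (Real.pi / 2) f := by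
        refine mul_le_mul_of_nonneg_right (Real.exp_le_exp.2 ?_) (X.avg_nonneg _ hf)
        nlinarith [Real.pi_le_four]

end MeanValue

end GaussianPath

section Bounds

instance (S : ℕ) : Nonempty (Spin S) := ⟨⟨0, by simp⟩⟩

theorem Spin.abs_val_le {S : ℕ} (s : Spin S) : |s.val| ≤ S := by
  have hs := Finset.mem_Icc.1 s.2
  unfold Spin.val
  exact abs_le.2 ⟨by exact_mod_cast hs.1, by exact_mod_cast hs.2⟩

theorem Spin.abs_val_mul_val_le {S : ℕ} (s t : Spin S) : |s.val * t.val| ≤ (S : ℝ) ^ 2 := by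
  rw [abs_mul, sq]
  exact mul_le_mul s.abs_val_le t.abs_val_le (abs_nonneg _) (Nat.cast_nonneg S)

theorem Spin.abs_val_sq_le {S : ℕ} (s : Spin S) : |s.val ^ 2| ≤ (S : ℝ) ^ 2 := by
  rw [sq s.val]
  exact s.abs_val_mul_val_le s

theorem abs_driftU_le {n : ℕ} (k : Fin (n + 2)) : |driftU n k| ≤ n + 1 := by
  unfold driftU
  split_ifs
  · rw [abs_one]; linarith [n.cast_nonneg (α := ℝ)]
  · rw [abs_neg, Nat.abs_cast]; linarith
  · rw [abs_zero]; positivity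

theorem abs_driftV_le {n : ℕ} (k : Fin (n + 2)) : |driftV n k| ≤ n + 1 := by
  unfold driftV
  split_ifs
  · rw [abs_one]; linarith [n.cast_nonneg (α := ℝ)]
  · rw [abs_neg, abs_of_nonneg (by positivity)]

theorem GaussianPath.abs_drift_le {J C : Type*} [Fintype J] (X : GaussianPath J C) {n : ℕ}
    {f : (Fin n → C) → ℝ} {B a b : ℝ} (hf : ∀ σ, |f σ| ≤ B) (ha : ∀ s t, |X.cov s t| ≤ a)
    (hb : ∀ s, |X.diag s| ≤ b) (σ : Fin (n + 2) → C) :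
    |X.drift f σ| ≤ B * ((n + 2) ^ 2 * (n + 1) ^ 2 * a + (n + 2) * (n + 1) * b) := by
  have hcov : ∀ k l, |driftU n k * driftV n l * X.cov (σ k) (σ l)| ≤ ((n : ℝ) + 1) * (n + 1) * a :=
    fun k l => by
      rw [abs_mul, abs_mul]
      gcongr
      exacts [abs_driftU_le k, abs_driftV_le l, ha _ _]
  have hdiag : ∀ k, |driftU n k * X.diag (σ k)| ≤ ((n : ℝ) + 1) * b := fun k => by
    rw [abs_mul]
    gcongr
    exacts [abs_driftU_le k, hb _]
  have hcov_sum : |∑ k, ∑ l, driftU n k * driftV n l * X.cov (σ k) (σ l)|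
      ≤ (n + 2) ^ 2 * (n + 1) ^ 2 * a :=
    calc |∑ k, ∑ l, driftU n k * driftV n l * X.cov (σ k) (σ l)|
        ≤ ∑ k, ∑ l, |driftU n k * driftV n l * X.cov (σ k) (σ l)| :=
          (Finset.abs_sum_le_sum_abs _ _).trans
            (Finset.sum_le_sum fun k _ => Finset.abs_sum_le_sum_abs _ _)
      _ ≤ ∑ _k : Fin (n + 2), ∑ _l : Fin (n + 2), ((n : ℝ) + 1) * (n + 1) * a :=
          Finset.sum_le_sum fun k _ => Finset.sum_le_sum fun l _ => hcov k l
      _ = (n + 2) ^ 2 * (n + 1) ^ 2 * a := by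
          simp only [Finset.sum_const, Finset.card_univ, Fintype.card_fin, nsmul_eq_mul]
          push_cast
          ring
  have hdiag_sum : |∑ k, driftU n k * X.diag (σ k)| ≤ (n + 2) * (n + 1) * b :=
    calc |∑ k, driftU n k * X.diag (σ k)| ≤ ∑ k, |driftU n k * X.diag (σ k)| :=
          Finset.abs_sum_le_sum_abs _ _
      _ ≤ ∑ _k : Fin (n + 2), ((n : ℝ) + 1) * b := Finset.sum_le_sum fun k _ => hdiag k
      _ = (n + 2) * (n + 1) * b := by
          simp only [Finset.sum_const, Finset.card_univ, Fintype.card_fin, nsmul_eq_mul]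
          push_cast
          ring
  rw [GaussianPath.drift, abs_mul]
  exact mul_le_mul (hf _) ((abs_add_le _ _).trans (add_le_add hcov_sum hdiag_sum)) (abs_nonneg _)
    ((abs_nonneg _).trans (hf fun k => σ k.castSucc.castSucc))

end Bounds

section ReplicaSymmetric

variable (P : Params) (p q : ℝ)

/-- The logarithm of `cavityWeight`, so that `nu0` is an average of Gibbs averages with this
exponent. -/
def cavityExponent (η : ℝ) (s : Spin P.S) : ℝ :=
  s.val * (P.β * η * √q) + P.β ^ 2 / 2 * (p - q) * s.val ^ 2 + P.D * s.val ^ 2 + P.h * s.val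

theorem continuous_cavityExponent (s : Spin P.S) :
    Continuous fun η => cavityExponent P p q η s := by
  unfold cavityExponent; fun_prop

theorem nu0_eq {n : ℕ} (φ : (Fin n → ℝ) → ℝ) :
    nu0 P p q φ = ∫ η, gibbsAvg (cavityExponent P p q η)
      (fun ε : Fin n → Spin P.S => φ fun k => (ε k).val) ∂(gaussianReal 0 1) :=
  rfl

theorem abs_nu0_le {n : ℕ} {φ : (Fin n → ℝ) → ℝ} {K : ℝ}
    (h : ∀ ε : Fin n → Spin P.S, |φ fun k => (ε k).val| ≤ K) : |nu0 P p q φ| ≤ K := by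
  rw [nu0_eq, ← Real.norm_eq_abs]
  refine (norm_integral_le_of_norm_le_const (C := K) (ae_of_all _ fun η =>
    abs_gibbsAvg_le _ h)).trans_eq ?_
  rw [probReal_univ, mul_one]

theorem nu0_mul_nonneg : 0 ≤ nu0 P p q fun ε : Fin 2 → ℝ => ε 0 * ε 1 := by
  rw [nu0_eq]
  refine integral_nonneg fun η => ?_
  let meanSpin := gibbsAvg (cavityExponent P p q η) fun ε : Fin 1 → Spin P.S => (ε 0).val
  calc (0 : ℝ) ≤ meanSpin * meanSpin := mul_self_nonneg _
    _ = _ := (gibbsAvg_append _ _ _).symm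

variable {P p q} in
theorem GaussianPath.avg_eq_nu0 {J : Type*} [Fintype J] (X : GaussianPath J (Spin P.S)) {θ : ℝ}
    (j : J) (hX : ∀ z, X.energy θ z = cavityExponent P p q (z j)) {n : ℕ} (φ : (Fin n → ℝ) → ℝ) :
    X.avg θ (fun ε => φ fun k => (ε k).val) = nu0 P p q φ := by
  have hj := measurePreserving_eval (fun _ : J => gaussianReal 0 1) j
  unfold GaussianPath.avg
  simp_rw [hX]
  rw [nu0_eq, ← hj.map_eq, integral_map hj.measurable.aemeasurable]
  exact (continuous_gibbsAvg (continuous_cavityExponent P p q) _).aestronglyMeasurable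

theorem abs_mul_mul_spin_le {S : ℕ} (s : Spin S) {a b r : ℝ} (ha : |a| ≤ 1) (hr : 0 ≤ r) :
    |a * (b * r * s.val)| ≤ |b| * r * S := by
  rw [abs_mul, abs_mul, abs_mul, abs_of_nonneg hr]
  calc |a| * (|b| * r * |s.val|) ≤ 1 * (|b| * r * S) := by gcongr; exact s.abs_val_le
    _ = |b| * r * S := one_mul _

/-- The Gaussian path from the cavity weights with parameters `(p', q')`, driven by the variable
`false`, to those with parameters `(p, q)`, driven by the variable `true`. -/
def cavityParamPath (p' q' : ℝ) (hq : 0 ≤ q) (hq' : 0 ≤ q') : GaussianPath Bool (Spin P.S) where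
  c θ b s := if b then Real.sin θ * (P.β * √q * s.val) else Real.cos θ * (P.β * √q' * s.val)
  c' θ b s := if b then Real.cos θ * (P.β * √q * s.val) else -Real.sin θ * (P.β * √q' * s.val)
  d θ s := P.D * s.val ^ 2 + P.h * s.val + P.β ^ 2 / 2 *
    (Real.sin θ ^ 2 * (p - q) + Real.cos θ ^ 2 * (p' - q')) * s.val ^ 2
  bound := |P.β| * √q * P.S + |P.β| * √q' * P.S
  cov s t := P.β ^ 2 * (q - q') * (s.val * t.val)
  diag s := P.β ^ 2 * ((p - q) - (p' - q')) * (s.val * s.val)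
  hasDerivAt_c θ b s := by
    cases b
    · simpa using (Real.hasDerivAt_cos θ).mul_const _
    · simpa using (Real.hasDerivAt_sin θ).mul_const _
  hasDerivAt_d θ s := by
    have hparam := (((Real.hasDerivAt_sin θ).pow 2).mul_const (p - q)).add
      (((Real.hasDerivAt_cos θ).pow 2).mul_const (p' - q'))
    refine (((hparam.const_mul (P.β ^ 2 / 2)).mul_const (s.val ^ 2)).const_add
      (P.D * s.val ^ 2 + P.h * s.val)).congr_deriv ?_
    norm_num
    ring
  abs_c'_le θ b s := by
    cases b
    · exact le_add_of_nonneg_of_le (by positivity) (abs_mul_mul_spin_le s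
        ((abs_neg _).trans_le (Real.abs_sin_le_one θ)) (Real.sqrt_nonneg q'))
    · exact le_add_of_le_of_nonneg (abs_mul_mul_spin_le s (Real.abs_cos_le_one θ)
        (Real.sqrt_nonneg q)) (by positivity)
  sum_c' θ s t := by
    simp only [Fintype.sum_bool, if_true, Bool.false_eq_true, if_false]
    linear_combination (Real.sin θ * Real.cos θ * P.β ^ 2 * s.val * t.val)
      * (Real.mul_self_sqrt hq - Real.mul_self_sqrt hq')

theorem cavityParamPath_avg_zero {n : ℕ} (p' q' : ℝ) (hq : 0 ≤ q) (hq' : 0 ≤ q')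
    (φ : (Fin n → ℝ) → ℝ) :
    (cavityParamPath P p q p' q' hq hq').avg 0 (fun ε => φ fun k => (ε k).val)
      = nu0 P p' q' φ := by
  refine GaussianPath.avg_eq_nu0 _ false (fun z => funext fun s => ?_) φ
  simp only [GaussianPath.energy, cavityParamPath, cavityExponent, Fintype.sum_bool, if_true,
    Bool.false_eq_true, if_false, Real.sin_zero, Real.cos_zero]
  ring

theorem cavityParamPath_avg_pi_div_two {n : ℕ} (p' q' : ℝ) (hq : 0 ≤ q) (hq' : 0 ≤ q')
    (φ : (Fin n → ℝ) → ℝ) :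
    (cavityParamPath P p q p' q' hq hq').avg (Real.pi / 2) (fun ε => φ fun k => (ε k).val)
      = nu0 P p q φ := by
  refine GaussianPath.avg_eq_nu0 _ true (fun z => funext fun s => ?_) φ
  simp only [GaussianPath.energy, cavityParamPath, cavityExponent, Fintype.sum_bool, if_true,
    Bool.false_eq_true, if_false, Real.sin_pi_div_two, Real.cos_pi_div_two]
  ring

theorem abs_nu0_sub_nu0_le {n : ℕ} {p' q' δ : ℝ} (hq : 0 ≤ q) (hq' : 0 ≤ q')
    (hpp' : |p - p'| ≤ δ) (hqq' : |q - q'| ≤ δ) {φ : (Fin n → ℝ) → ℝ} {B : ℝ}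
    (hφ : ∀ ε : Fin n → Spin P.S, |φ fun k => (ε k).val| ≤ B) :
    |nu0 P p q φ - nu0 P p' q' φ| ≤ B * ((n + 2) ^ 2 * (n + 1) ^ 2 * (P.β ^ 2 * δ * P.S ^ 2)
      + (n + 2) * (n + 1) * (P.β ^ 2 * (2 * δ) * P.S ^ 2)) := by
  let X := cavityParamPath P p q p' q' hq hq'
  have hscaled : ∀ (x K : ℝ) (s t : Spin P.S), |x| ≤ K →
      |P.β ^ 2 * x * (s.val * t.val)| ≤ P.β ^ 2 * K * P.S ^ 2 := fun x K s t hx => by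
    rw [abs_mul, abs_mul, abs_of_nonneg (sq_nonneg P.β)]
    have hK : 0 ≤ K := (abs_nonneg x).trans hx
    gcongr
    exact s.abs_val_mul_val_le t
  have hdiff : |(p - q) - (p' - q')| ≤ 2 * δ :=
    calc |(p - q) - (p' - q')| = |(p - p') - (q - q')| := by ring_nf
      _ ≤ |p - p'| + |q - q'| := abs_sub _ _
      _ ≤ 2 * δ := by linarith
  rw [← cavityParamPath_avg_zero P p q p' q' hq hq',
    ← cavityParamPath_avg_pi_div_two P p q p' q' hq hq']
  refine X.abs_avg_sub_avg_le (fun θ _ => ?_) GaussianPath.zero_mem_Icc_pi_div_two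
    GaussianPath.pi_div_two_mem_Icc
  exact (X.abs_avg_le θ (g := fun _ => _) (X.abs_drift_le hφ
    (fun s t => hscaled _ _ s t hqq') fun s => hscaled _ _ s s hdiff)).trans_eq (X.avg_const θ _)

variable {P p q}

theorem IsReplicaSymmetric.nonneg (h : IsReplicaSymmetric P p q) : 0 ≤ q :=
  h.2 ▸ nu0_mul_nonneg P p q

theorem IsReplicaSymmetric.abs_le (h : IsReplicaSymmetric P p q) :
    |p| ≤ (P.S : ℝ) ^ 2 ∧ |q| ≤ (P.S : ℝ) ^ 2 := by
  constructor
  · rw [h.1]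
    exact abs_nu0_le P p q fun ε => (ε 0).abs_val_sq_le
  · rw [h.2]
    exact abs_nu0_le P p q fun ε => (ε 0).abs_val_mul_val_le (ε 1)

/-- The map whose fixed points are the solutions of the replica symmetric equations. Negative `q`
are truncated to `0`, where the dependence on `√q` is controlled; no solution has `q < 0`. -/
def replicaSymmetricMap (P : Params) (x : ℝ × ℝ) : ℝ × ℝ :=
  (nu0 P x.1 (max x.2 0) fun ε : Fin 1 → ℝ => ε 0 ^ 2,
    nu0 P x.1 (max x.2 0) fun ε : Fin 2 → ℝ => ε 0 * ε 1)

theorem isReplicaSymmetric_iff_isFixedPt :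
    IsReplicaSymmetric P p q ↔ Function.IsFixedPt (replicaSymmetricMap P) (p, q) := by
  constructor
  · intro h
    refine Prod.ext ?_ ?_ <;> simp only [replicaSymmetricMap, max_eq_left h.nonneg]
    exacts [h.1.symm, h.2.symm]
  · intro h
    have hp : nu0 P p (max q 0) (fun ε : Fin 1 → ℝ => ε 0 ^ 2) = p := congrArg Prod.fst h
    have hq : nu0 P p (max q 0) (fun ε : Fin 2 → ℝ => ε 0 * ε 1) = q := congrArg Prod.snd h
    have hq0 : 0 ≤ q := hq ▸ nu0_mul_nonneg P p (max q 0)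
    rw [max_eq_left hq0] at hp hq
    exact ⟨hp.symm, hq.symm⟩

theorem contractingWith_replicaSymmetricMap (hβ : 336 * (P.S : ℝ) ^ 4 * P.β ^ 2 ≤ 1) :
    ContractingWith (1 / 2) (replicaSymmetricMap P) := by
  refine ⟨by rw [← NNReal.coe_lt_coe]; norm_num, LipschitzWith.of_dist_le_mul fun x y => ?_⟩
  have hfst : |x.1 - y.1| ≤ dist x y := by
    rw [← Real.dist_eq, Prod.dist_eq]; exact le_max_left _ _
  have hsnd : |max x.2 0 - max y.2 0| ≤ dist x y := by
    refine (abs_max_sub_max_le_abs _ _ _).trans ?_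
    rw [← Real.dist_eq, Prod.dist_eq]; exact le_max_right _ _
  have hsmall : 336 * ((P.S : ℝ) ^ 4 * P.β ^ 2 * dist x y) ≤ dist x y := by
    calc 336 * ((P.S : ℝ) ^ 4 * P.β ^ 2 * dist x y)
        = 336 * (P.S : ℝ) ^ 4 * P.β ^ 2 * dist x y := by ring
      _ ≤ 1 * dist x y := mul_le_mul_of_nonneg_right hβ dist_nonneg
      _ = dist x y := one_mul _
  have hnonneg : 0 ≤ (P.S : ℝ) ^ 4 * P.β ^ 2 * dist x y := by positivity
  have hlip : ∀ {n : ℕ} {φ : (Fin n → ℝ) → ℝ},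
      (∀ ε : Fin n → Spin P.S, |φ fun k => (ε k).val| ≤ (P.S : ℝ) ^ 2) →
      |nu0 P x.1 (max x.2 0) φ - nu0 P y.1 (max y.2 0) φ| ≤ _ :=
    abs_nu0_sub_nu0_le P _ _ (le_max_right _ _) (le_max_right _ _) hfst hsnd
  rw [Prod.dist_eq, NNReal.coe_div, NNReal.coe_one, NNReal.coe_ofNat]
  refine max_le ((hlip fun ε => (ε 0).abs_val_sq_le).trans ?_)
    ((hlip fun ε => (ε 0).abs_val_mul_val_le (ε 1)).trans ?_)
  · push_cast; linarith
  · push_cast; linarith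

theorem existsUnique_isReplicaSymmetric (hβ : 336 * (P.S : ℝ) ^ 4 * P.β ^ 2 ≤ 1) :
    ∃ p q : ℝ, IsReplicaSymmetric P p q ∧
      ∀ p' q' : ℝ, IsReplicaSymmetric P p' q' → p' = p ∧ q' = q := by
  have hΦ := contractingWith_replicaSymmetricMap hβ
  refine ⟨_, _, isReplicaSymmetric_iff_isFixedPt.2 hΦ.fixedPoint_isFixedPt, fun p' q' h => ?_⟩
  exact Prod.ext_iff.1 (hΦ.fixedPoint_unique (isReplicaSymmetric_iff_isFixedPt.1 h))

end ReplicaSymmetric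

section Overlaps

variable {N S n : ℕ}

/-- The product of the spins at site `i` of the replicas `k` and `l`. -/
def spinProduct (i : Fin N) (σ : Fin n → Config N S) (k l : Fin n) : ℝ :=
  (σ k i).val * (σ l i).val

/-- The centering constants of the overlaps: `p` on the diagonal, `q` off it. -/
def rsParam (p q : ℝ) (k l : Fin n) : ℝ := if k = l then p else q

/-- The centered overlap of the replicas `k` and `l`. -/
def overlap (p q : ℝ) (σ : Fin n → Config N S) (k l : Fin n) : ℝ :=
  1 / (N : ℝ) * ∑ i, spinProduct i σ k l - rsParam p q k l

/-- The centered overlap of the replicas `k` and `l` without the contribution of site `i`; the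
normalization is still `1 / N`. -/
def cavityOverlap (p q : ℝ) (i : Fin N) (σ : Fin n → Config N S) (k l : Fin n) : ℝ :=
  overlap p q σ k l - spinProduct i σ k l / N

/-- The configuration with the spin at site `i` replaced by `0`. Functions invariant under this map
are the functions of the spins at the other sites. -/
def eraseSpin (i : Fin N) (σ : Config N S) : Config N S := Function.update σ i ⟨0, by simp⟩

@[simp] theorem eraseSpin_self (i : Fin N) (σ : Config N S) : (eraseSpin i σ i).val = 0 := by
  simp [eraseSpin, Spin.val]

theorem eraseSpin_of_ne {i j : Fin N} (h : j ≠ i) (σ : Config N S) : eraseSpin i σ j = σ j := by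
  simp [eraseSpin, h]

theorem sum_eraseSpin (i : Fin N) (σ : Config N S) {f : ℝ → ℝ} (hf : f 0 = 0) :
    ∑ j, f (eraseSpin i σ j).val = ∑ j, f (σ j).val - f (σ i).val := by
  rw [← Finset.sum_erase_eq_sub (Finset.mem_univ i),
    ← Finset.add_sum_erase _ _ (Finset.mem_univ i), eraseSpin_self, hf, zero_add]
  exact Finset.sum_congr rfl fun j hj => by rw [eraseSpin_of_ne (Finset.ne_of_mem_erase hj)]

theorem cavityOverlap_eraseSpin (p q : ℝ) (i : Fin N) (σ : Fin n → Config N S) (k l : Fin n) :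
    cavityOverlap p q i (fun m => eraseSpin i (σ m)) k l = cavityOverlap p q i σ k l := by
  have hsum : ∑ j, spinProduct j (fun m => eraseSpin i (σ m)) k l
      = ∑ j, spinProduct j σ k l - spinProduct i σ k l := by
    rw [← Finset.sum_erase_eq_sub (Finset.mem_univ i),
      ← Finset.add_sum_erase _ _ (Finset.mem_univ i)]
    simp only [spinProduct, eraseSpin_self, zero_mul, zero_add]
    exact Finset.sum_congr rfl fun j hj => by
      simp only [eraseSpin_of_ne (Finset.ne_of_mem_erase hj)]
  simp only [cavityOverlap, overlap, hsum]
  simp only [spinProduct, eraseSpin_self]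
  ring

theorem gibbsAvg_add_eraseSpin (i : Fin N) (a : Spin S → ℝ) (b : Config N S → ℝ)
    (φ : (Fin n → Spin S) → ℝ) {Y : (Fin n → Config N S) → ℝ}
    (hY : ∀ σ, Y (fun k => eraseSpin i (σ k)) = Y σ) :
    gibbsAvg (fun σ => a (σ i) + b (eraseSpin i σ)) (fun σ => φ (fun k => σ k i) * Y σ)
      = gibbsAvg a φ * gibbsAvg (fun σ => b (eraseSpin i σ)) Y := by
  classical
  let e : Config N S ≃ Spin S × ({j // j ≠ i} → Spin S) := Equiv.funSplitAt i (Spin S)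
  let extend : ({j // j ≠ i} → Spin S) → Config N S := fun ρ => e.symm (⟨0, by simp⟩, ρ)
  have hextend : ∀ σ, extend (e σ).2 = eraseSpin i σ := fun σ => funext fun j => by
    by_cases h : j = i
    · subst h; simp [extend, e, eraseSpin]
    · simp [extend, e, eraseSpin, h]
  have hfactor : ∀ (a : Spin S → ℝ) (φ : (Fin n → Spin S) → ℝ),
      gibbsAvg (fun σ => a (σ i) + b (eraseSpin i σ)) (fun σ => φ (fun k => σ k i) * Y σ)
        = gibbsAvg a φ * gibbsAvg (fun ρ => b (extend ρ)) fun ρ => Y fun k => extend (ρ k) :=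
    fun a φ => by
      rw [← gibbsAvg_comp_equiv_mul e]
      simp only [hextend, hY]
      rfl
  have hrest := hfactor (fun _ => 0) fun _ => 1
  have hone : gibbsAvg (fun _ : Spin S => 0) (fun _ : Fin n → Spin S => (1 : ℝ)) = 1 := by
    simp only [gibbsAvg, mul_one, sum_prod_gibbsProb]
  simp only [zero_add, one_mul, hone] at hrest
  rw [hfactor, hrest]

end Overlaps

section Edges

variable {N : ℕ}

/-- The pairs of sites, the index set of the disorder. -/
abbrev Edge (N : ℕ) : Type := {e : Fin N × Fin N // e.1 < e.2}

theorem sum_edge (f : Fin N → Fin N → ℝ) :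
    ∑ e : Edge N, f e.1.1 e.1.2 = ∑ a, ∑ b, if a < b then f a b else 0 := by
  classical
  rw [← Finset.sum_subtype {e : Fin N × Fin N | e.1 < e.2} (fun e => by simp)
    fun e : Fin N × Fin N => f e.1 e.2, Finset.sum_filter, Fintype.sum_prod_type]

theorem sum_edge_incident (i : Fin N) (x : Fin N → ℝ) :
    ∑ e : Edge N, (if e.1.1 = i ∨ e.1.2 = i then x e.1.1 * x e.1.2 else 0)
      = x i * (∑ j, x j - x i) := by
  have hsplit : ∀ a b : Fin N,
      (if a < b then (if a = i ∨ b = i then x a * x b else 0) else 0)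
        = (if a = i then (if i < b then x i * x b else 0) else 0)
          + (if b = i then (if a < i then x i * x a else 0) else 0) := fun a b => by
    rcases eq_or_ne i a with rfl | ha <;> rcases eq_or_ne i b with rfl | hb
    · simp
    · simp [hb.symm]
    · simp [ha.symm, mul_comm]
    · simp [ha.symm, hb.symm]
  have htrichotomy : ∀ j, (if i < j then x i * x j else 0) + (if j < i then x i * x j else 0)
      = if j = i then 0 else x i * x j := fun j => by
    rcases lt_trichotomy i j with h | rfl | h
    · simp [h, h.not_gt, h.ne']
    · simp
    · simp [h, h.not_gt, h.ne]
  rw [sum_edge fun a b => if a = i ∨ b = i then x a * x b else 0]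
  simp only [hsplit, Finset.sum_add_distrib, Finset.sum_ite_eq', Finset.mem_univ, if_true]
  rw [Finset.sum_comm]
  simp only [Finset.sum_ite_eq', Finset.mem_univ, if_true]
  rw [← Finset.sum_add_distrib, Finset.sum_congr rfl fun j _ => htrichotomy j,
    ← Finset.sum_erase_eq_sub (Finset.mem_univ i), Finset.mul_sum,
    ← Finset.add_sum_erase _ _ (Finset.mem_univ i), if_pos rfl, zero_add]
  exact Finset.sum_congr rfl fun j hj => if_neg (Finset.ne_of_mem_erase hj)

theorem sum_edge_incident_mul (i : Fin N) (u v : Fin N → ℝ) (a b c : ℝ) :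
    ∑ e : Edge N, (if e.1.1 = i ∨ e.1.2 = i then a else 0) * (c * (u e.1.1 * u e.1.2)) *
        ((if e.1.1 = i ∨ e.1.2 = i then b else 1) * (c * (v e.1.1 * v e.1.2)))
      = a * b * c ^ 2 * (u i * v i * (∑ j, u j * v j - u i * v i)) := by
  rw [← sum_edge_incident i fun j => u j * v j, Finset.mul_sum]
  refine Finset.sum_congr rfl fun e _ => ?_
  split_ifs <;> ring

end Edges

section CavityPath

variable {N : ℕ}

/-- `ν(f)` for a function `f` of the replicas, which unlike in `nu` does not depend on the
disorder. -/
def modelAvg (P : Params) {n : ℕ} (f : (Fin n → Config N P.S) → ℝ) : ℝ := nu P fun _ => f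

theorem cast_pos_of_fin (i : Fin N) : (0 : ℝ) < N := Nat.cast_pos.2 i.pos

theorem abs_mul_mul_spin_mul_spin_le {S : ℕ} (s t : Spin S) {a b r : ℝ} (ha : |a| ≤ 1)
    (hr : 0 ≤ r) : |a * (b / r * (s.val * t.val))| ≤ |b| / r * S ^ 2 := by
  rw [abs_mul, abs_mul, abs_div, abs_of_nonneg hr]
  calc |a| * (|b| / r * |s.val * t.val|) ≤ 1 * (|b| / r * S ^ 2) := by
        gcongr
        exact s.abs_val_mul_val_le t
    _ = |b| / r * S ^ 2 := one_mul _

variable (P : Params) (p q : ℝ)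

/-- The interpolation which decouples the spin at site `i` from the others at angle `0`: the
couplings of site `i` are switched on as `sin θ`, the external field `none` acting on it is switched
off as `cos θ`. -/
def cavityPath (hq : 0 ≤ q) (i : Fin N) : GaussianPath (Option (Edge N)) (Config N P.S) where
  c θ j σ := j.elim (Real.cos θ * (P.β * √q * (σ i).val)) fun e =>
    (if e.1.1 = i ∨ e.1.2 = i then Real.sin θ else 1) *
      (P.β / √(N : ℝ) * ((σ e.1.1).val * (σ e.1.2).val))
  c' θ j σ := j.elim (-Real.sin θ * (P.β * √q * (σ i).val)) fun e =>
    (if e.1.1 = i ∨ e.1.2 = i then Real.cos θ else 0) *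
      (P.β / √(N : ℝ) * ((σ e.1.1).val * (σ e.1.2).val))
  d θ σ := P.D * ∑ j, (σ j).val ^ 2 + P.h * ∑ j, (σ j).val
    + Real.cos θ ^ 2 * (P.β ^ 2 / 2 * (p - q) * (σ i).val ^ 2)
  bound := |P.β| * √q * P.S + |P.β| / √(N : ℝ) * P.S ^ 2
  cov σ τ := P.β ^ 2 * ((σ i).val * (τ i).val) *
    (1 / (N : ℝ) * ∑ j, (σ j).val * (τ j).val - q - (σ i).val * (τ i).val / N)
  diag σ := -(P.β ^ 2 * (p - q) * ((σ i).val * (σ i).val))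
  hasDerivAt_c θ j σ := by
    cases j with
    | none => exact (Real.hasDerivAt_cos θ).mul_const _
    | some e =>
      by_cases h : e.1.1 = i ∨ e.1.2 = i
      · simpa [h] using (Real.hasDerivAt_sin θ).mul_const _
      · simpa [h] using hasDerivAt_const θ _
  hasDerivAt_d θ σ := by
    refine ((((Real.hasDerivAt_cos θ).pow 2).mul_const _).const_add
      (P.D * ∑ j, (σ j).val ^ 2 + P.h * ∑ j, (σ j).val)).congr_deriv ?_
    norm_num
    ring
  abs_c'_le θ j σ := by
    cases j with
    | none =>
      exact le_add_of_le_of_nonneg (abs_mul_mul_spin_le _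
        ((abs_neg _).trans_le (Real.abs_sin_le_one θ)) (Real.sqrt_nonneg q)) (by positivity)
    | some e =>
      refine le_add_of_nonneg_of_le (by positivity)
        (abs_mul_mul_spin_mul_spin_le _ _ ?_ (Real.sqrt_nonneg _))
      split_ifs
      exacts [Real.abs_cos_le_one θ, by simp]
  sum_c' θ σ τ := by
    have hN := cast_pos_of_fin i
    simp only [Fintype.sum_option, Option.elim_none, Option.elim_some]
    rw [sum_edge_incident_mul i (fun j => (σ j).val) fun j => (τ j).val, div_pow,
      Real.sq_sqrt hN.le]
    field_simp
    linear_combination (-N * P.β ^ 2 * Real.sin θ * (σ i).val * Real.cos θ * (τ i).val)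
      * Real.sq_sqrt hq

variable (hq : 0 ≤ q) (i : Fin N)

theorem cavityPath_energy_pi_div_two (z : Option (Edge N) → ℝ) :
    (cavityPath P p q hq i).energy (Real.pi / 2) z
      = hamiltonian P fun e : Edge N => z (some e) := by
  funext σ
  simp only [GaussianPath.energy, cavityPath, hamiltonian, Fintype.sum_option, Option.elim_none,
    Option.elim_some, Real.cos_pi_div_two, Real.sin_pi_div_two, ite_self, Finset.mul_sum]
  have hedge : ∀ e : Edge N,
      z (some e) * (1 * (P.β / √(N : ℝ) * ((σ e.1.1).val * (σ e.1.2).val)))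
        = P.β / √(N : ℝ) * (z (some e) * (σ e.1.1).val * (σ e.1.2).val) := fun e => by ring
  simp only [hedge]
  ring

theorem cavityPath_avg_pi_div_two {n : ℕ} (f : (Fin n → Config N P.S) → ℝ) :
    (cavityPath P p q hq i).avg (Real.pi / 2) f = modelAvg P f := by
  have hsome := measurePreserving_pi_precomp (fun _ : Option (Edge N) => gaussianReal 0 1)
    (Option.some_injective (Edge N))
  have hcont : Continuous fun g => gibbsAvg (hamiltonian P (N := N) g) f :=
    continuous_gibbsAvg (fun s => by unfold hamiltonian; fun_prop) f
  unfold GaussianPath.avg modelAvg nu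
  simp_rw [cavityPath_energy_pi_div_two]
  change _ = ∫ g, gibbsAvg (hamiltonian P g) f ∂(Measure.pi fun _ : Edge N => gaussianReal 0 1)
  rw [← hsome.map_eq, integral_map hsome.measurable.aemeasurable hcont.aestronglyMeasurable]

theorem cavityPath_energy_zero (z : Option (Edge N) → ℝ) (σ : Config N P.S) :
    (cavityPath P p q hq i).energy 0 z σ = cavityExponent P p q (z none) (σ i)
      + (cavityPath P p q hq i).energy 0 z (eraseSpin i σ) := by
  have hedge : ∀ e : Edge N, (if e.1.1 = i ∨ e.1.2 = i then 0 else 1) *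
        (P.β / √(N : ℝ) * ((eraseSpin i σ e.1.1).val * (eraseSpin i σ e.1.2).val))
      = (if e.1.1 = i ∨ e.1.2 = i then 0 else 1) *
        (P.β / √(N : ℝ) * ((σ e.1.1).val * (σ e.1.2).val)) := fun e => by
    split_ifs with he
    · simp only [zero_mul]
    · rw [not_or] at he
      rw [eraseSpin_of_ne he.1, eraseSpin_of_ne he.2]
  simp only [GaussianPath.energy, cavityPath, cavityExponent, Fintype.sum_option,
    Option.elim_none, Option.elim_some, Real.cos_zero, Real.sin_zero, eraseSpin_self, hedge,
    sum_eraseSpin i σ (f := fun x => x ^ 2) (zero_pow two_ne_zero),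
    sum_eraseSpin i σ (f := fun x => x) rfl]
  ring

theorem cavityPath_energy_zero_eraseSpin_update (z : Option (Edge N) → ℝ) (x : ℝ)
    (σ : Config N P.S) :
    (cavityPath P p q hq i).energy 0 (Function.update z none x) (eraseSpin i σ)
      = (cavityPath P p q hq i).energy 0 z (eraseSpin i σ) := by
  simp [GaussianPath.energy, cavityPath, Fintype.sum_option]

theorem cavityPath_avg_zero_mul {n : ℕ} (φ : (Fin n → ℝ) → ℝ) {Y : (Fin n → Config N P.S) → ℝ}
    (hY : ∀ σ, Y (fun k => eraseSpin i (σ k)) = Y σ) :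
    (cavityPath P p q hq i).avg 0 (fun σ => φ (fun k => (σ k i).val) * Y σ)
      = nu0 P p q φ * (cavityPath P p q hq i).avg 0 Y := by
  let X := cavityPath P p q hq i
  let cavityAvg : (Option (Edge N) → ℝ) → ℝ := fun z =>
    gibbsAvg (fun σ => X.energy 0 z (eraseSpin i σ)) Y
  have hfactor : ∀ (φ : (Fin n → ℝ) → ℝ) z,
      gibbsAvg (X.energy 0 z) (fun σ => φ (fun k => (σ k i).val) * Y σ)
        = gibbsAvg (cavityExponent P p q (z none))
          (fun ε : Fin n → Spin P.S => φ fun k => (ε k).val) * cavityAvg z := fun φ z => by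
    rw [← gibbsAvg_add_eraseSpin i _ _ _ hY, ← funext (cavityPath_energy_zero P p q hq i z)]
  have hcavityAvg : ∀ z, cavityAvg z = gibbsAvg (X.energy 0 z) Y := fun z => by
    have hone := hfactor (fun _ => 1) z
    simp only [one_mul, gibbsAvg, mul_one, sum_prod_gibbsProb] at hone
    exact hone.symm
  unfold GaussianPath.avg
  simp_rw [show cavityPath P p q hq i = X from rfl, hfactor φ, ← hcavityAvg]
  refine integral_pi_eval_mul_of_update (fun _ => gaussianReal 0 1) none
    (F := fun x => gibbsAvg (cavityExponent P p q x)
      fun ε : Fin n → Spin P.S => φ fun k => (ε k).val)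
    (fun z x => ?_) (continuous_gibbsAvg (continuous_cavityExponent P p q) _).aestronglyMeasurable
    (continuous_gibbsAvg (fun σ => X.continuous_energy 0 _) _).aestronglyMeasurable
  simp only [cavityAvg, X, cavityPath_energy_zero_eraseSpin_update]

theorem driftU_mul_driftV_self {n : ℕ} (k : Fin (n + 2)) :
    driftU n k * driftV n k = driftU n k := by
  unfold driftU driftV
  split_ifs <;> first | omega | simp

theorem cavityPath_drift {n : ℕ} (f : (Fin n → Config N P.S) → ℝ)
    (σ : Fin (n + 2) → Config N P.S) :
    (cavityPath P p q hq i).drift f σ = f (fun k => σ k.castSucc.castSucc) *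
      (P.β ^ 2 * ∑ k, ∑ l, driftU n k * driftV n l *
        (spinProduct i σ k l * cavityOverlap p q i σ k l)) := by
  have hdiag : ∀ k, driftU n k * (cavityPath P p q hq i).diag (σ k)
      = ∑ l, if k = l then driftU n k * driftV n l * (cavityPath P p q hq i).diag (σ k) else 0 :=
    fun k => by rw [Finset.sum_ite_eq, if_pos (Finset.mem_univ k), driftU_mul_driftV_self]
  unfold GaussianPath.drift
  simp only [hdiag, ← Finset.sum_add_distrib, Finset.mul_sum]
  refine Finset.sum_congr rfl fun k _ => Finset.sum_congr rfl fun l _ => ?_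
  simp only [cavityPath, spinProduct, cavityOverlap, overlap, rsParam]
  split_ifs with hkl
  · subst hkl; ring
  · ring

end CavityPath

section ModelAvg

variable (P : Params) {N n : ℕ} [NeZero N]

theorem modelAvg_eq_avg (f : (Fin n → Config N P.S) → ℝ) :
    modelAvg P f = (cavityPath P 0 0 le_rfl (0 : Fin N)).avg (Real.pi / 2) f :=
  (cavityPath_avg_pi_div_two P 0 0 le_rfl 0 f).symm

theorem modelAvg_add (f g : (Fin n → Config N P.S) → ℝ) :
    modelAvg P (fun σ => f σ + g σ) = modelAvg P f + modelAvg P g := by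
  simp only [modelAvg_eq_avg, GaussianPath.avg_add]

theorem modelAvg_sub (f g : (Fin n → Config N P.S) → ℝ) :
    modelAvg P (fun σ => f σ - g σ) = modelAvg P f - modelAvg P g := by
  simp only [modelAvg_eq_avg, GaussianPath.avg_sub]

theorem modelAvg_const_mul (a : ℝ) (f : (Fin n → Config N P.S) → ℝ) :
    modelAvg P (fun σ => a * f σ) = a * modelAvg P f := by
  simp only [modelAvg_eq_avg, GaussianPath.avg_const_mul]

theorem modelAvg_sum {I : Type*} (t : Finset I) (f : I → (Fin n → Config N P.S) → ℝ) :
    modelAvg P (fun σ => ∑ i ∈ t, f i σ) = ∑ i ∈ t, modelAvg P (f i) := by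
  simp only [modelAvg_eq_avg, GaussianPath.avg_sum]

theorem modelAvg_const (a : ℝ) : modelAvg P (fun _ : Fin n → Config N P.S => a) = a := by
  simp only [modelAvg_eq_avg, GaussianPath.avg_const]

theorem modelAvg_mono {f g : (Fin n → Config N P.S) → ℝ} (h : ∀ σ, f σ ≤ g σ) :
    modelAvg P f ≤ modelAvg P g := by
  simpa only [modelAvg_eq_avg] using GaussianPath.avg_mono _ _ h

theorem modelAvg_nonneg {f : (Fin n → Config N P.S) → ℝ} (h : ∀ σ, 0 ≤ f σ) :
    0 ≤ modelAvg P f := by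
  simpa only [modelAvg_eq_avg] using GaussianPath.avg_nonneg _ _ h

theorem abs_modelAvg_le {f g : (Fin n → Config N P.S) → ℝ} (h : ∀ σ, |f σ| ≤ g σ) :
    |modelAvg P f| ≤ modelAvg P g := by
  simpa only [modelAvg_eq_avg] using GaussianPath.abs_avg_le _ _ h

theorem modelAvg_comp_injective {m : ℕ} {ι : Fin m → Fin n} (hι : Function.Injective ι)
    (f : (Fin m → Config N P.S) → ℝ) :
    modelAvg P (fun σ : Fin n → Config N P.S => f (fun c => σ (ι c))) = modelAvg P f := by
  simp only [modelAvg_eq_avg, GaussianPath.avg_comp_injective _ _ hι]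

end ModelAvg

section OverlapBounds

variable {N S n : ℕ} (p q : ℝ)

theorem abs_spinProduct_le (i : Fin N) (σ : Fin n → Config N S) (k l : Fin n) :
    |spinProduct i σ k l| ≤ (S : ℝ) ^ 2 := Spin.abs_val_mul_val_le _ _

theorem spinProduct_comp {m : ℕ} (ι : Fin m → Fin n) (i : Fin N)
    (σ : Fin n → Config N S) (k l : Fin m) :
    spinProduct i (fun c => σ (ι c)) k l = spinProduct i σ (ι k) (ι l) := rfl

theorem rsParam_comp {m : ℕ} {ι : Fin m → Fin n} (hι : Function.Injective ι) (k l : Fin m) :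
    rsParam p q (ι k) (ι l) = rsParam p q k l := by
  simp only [rsParam, hι.eq_iff]

theorem overlap_comp {m : ℕ} {ι : Fin m → Fin n} (hι : Function.Injective ι)
    (σ : Fin n → Config N S) (k l : Fin m) :
    overlap p q (fun c => σ (ι c)) k l = overlap p q σ (ι k) (ι l) := by
  simp only [overlap, spinProduct_comp, rsParam_comp p q hι]

theorem cavityOverlap_comp {m : ℕ} {ι : Fin m → Fin n} (hι : Function.Injective ι) (i : Fin N)
    (σ : Fin n → Config N S) (k l : Fin m) :
    cavityOverlap p q i (fun c => σ (ι c)) k l = cavityOverlap p q i σ (ι k) (ι l) := by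
  simp only [cavityOverlap, overlap_comp p q hι, spinProduct_comp]

theorem overlap_eq_sum [NeZero N] (σ : Fin n → Config N S) (k l : Fin n) :
    overlap p q σ k l = 1 / (N : ℝ) * ∑ i, (spinProduct i σ k l - rsParam p q k l) := by
  have hN : (N : ℝ) ≠ 0 := Nat.cast_ne_zero.2 (NeZero.ne N)
  unfold overlap
  rw [Finset.sum_sub_distrib, Finset.sum_const, Finset.card_univ, Fintype.card_fin, nsmul_eq_mul]
  field_simp

theorem abs_overlap_sub_cavityOverlap_le (i : Fin N) (σ : Fin n → Config N S) (k l : Fin n) :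
    |overlap p q σ k l - cavityOverlap p q i σ k l| ≤ (S : ℝ) ^ 2 / N := by
  unfold cavityOverlap
  rw [sub_sub_cancel, abs_div, Nat.abs_cast]
  exact div_le_div_of_nonneg_right (abs_spinProduct_le i σ k l) (Nat.cast_nonneg N)

theorem abs_cavityOverlap_le_add (i : Fin N) (σ : Fin n → Config N S) (k l : Fin n) :
    |cavityOverlap p q i σ k l| ≤ |overlap p q σ k l| + (S : ℝ) ^ 2 / N := by
  have hsub := abs_overlap_sub_cavityOverlap_le p q i σ k l
  have htri := abs_sub_abs_le_abs_sub (cavityOverlap p q i σ k l) (overlap p q σ k l)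
  rw [abs_sub_comm] at htri
  linarith

variable {p q} (hp : |p| ≤ (S : ℝ) ^ 2) (hq : |q| ≤ (S : ℝ) ^ 2)

include hp hq

theorem abs_rsParam_le (k l : Fin n) : |rsParam p q k l| ≤ (S : ℝ) ^ 2 := by
  unfold rsParam; split_ifs <;> assumption

theorem abs_spinProduct_sub_rsParam_le (i : Fin N) (σ : Fin n → Config N S) (k l : Fin n) :
    |spinProduct i σ k l - rsParam p q k l| ≤ 2 * (S : ℝ) ^ 2 := by
  have htri := abs_sub (spinProduct i σ k l) (rsParam p q k l)
  linarith [abs_spinProduct_le i σ k l, abs_rsParam_le hp hq k l]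

theorem abs_overlap_le [NeZero N] (σ : Fin n → Config N S) (k l : Fin n) :
    |overlap p q σ k l| ≤ 2 * (S : ℝ) ^ 2 := by
  have hN : (0 : ℝ) < N := Nat.cast_pos.2 (NeZero.pos N)
  rw [overlap_eq_sum, abs_mul, abs_of_nonneg (by positivity), one_div, inv_mul_le_iff₀ hN]
  calc _ ≤ ∑ i, |spinProduct i σ k l - rsParam p q k l| := Finset.abs_sum_le_sum_abs _ _
    _ ≤ ∑ _i : Fin N, 2 * (S : ℝ) ^ 2 :=
        Finset.sum_le_sum fun i _ => abs_spinProduct_sub_rsParam_le hp hq i σ k l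
    _ = N * (2 * (S : ℝ) ^ 2) := by
        rw [Finset.sum_const, Finset.card_univ, Fintype.card_fin, nsmul_eq_mul]

theorem abs_cavityOverlap_le (i : Fin N) (σ : Fin n → Config N S) (k l : Fin n) :
    |cavityOverlap p q i σ k l| ≤ 3 * (S : ℝ) ^ 2 := by
  have : NeZero N := .of_pos i.pos
  have hdiv : (S : ℝ) ^ 2 / N ≤ (S : ℝ) ^ 2 :=
    div_le_self (by positivity) (by exact_mod_cast i.pos)
  linarith [abs_cavityOverlap_le_add p q i σ k l, abs_overlap_le hp hq σ k l]

end OverlapBounds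

section CavityOverlapSum

variable {P : Params} {p q : ℝ} {N n : ℕ}

theorem sum_sum_fin_le {f : Fin n → Fin n → ℝ} {M : ℝ} (h : ∀ k l, f k l ≤ M) :
    ∑ k, ∑ l, f k l ≤ (n : ℝ) ^ 2 * M := by
  calc _ ≤ ∑ _k : Fin n, ∑ _l : Fin n, M :=
        Finset.sum_le_sum fun k _ => Finset.sum_le_sum fun l _ => h k l
    _ = (n : ℝ) ^ 2 * M := by
        simp only [Finset.sum_const, Finset.card_univ, Fintype.card_fin, nsmul_eq_mul]
        ring

variable (p q) in
/-- The total size of the centered overlaps without site `i`, which controls the drift of the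
cavity path. -/
def cavityOverlapSum {S : ℕ} (i : Fin N) (σ : Fin n → Config N S) : ℝ :=
  ∑ k, ∑ l, |cavityOverlap p q i σ k l|

theorem cavityOverlapSum_nonneg {S : ℕ} (i : Fin N) (σ : Fin n → Config N S) :
    0 ≤ cavityOverlapSum p q i σ :=
  Finset.sum_nonneg fun _ _ => Finset.sum_nonneg fun _ _ => abs_nonneg _

theorem modelAvg_mul_cavityOverlapSum_le (i : Fin N) {m : ℕ} {ι : Fin m → Fin n}
    (hι : Function.Injective ι) {F : (Fin n → Config N P.S) → ℝ} {M : ℝ}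
    (hM : ∀ k l, modelAvg P (fun σ => F σ * |cavityOverlap p q i σ (ι k) (ι l)|) ≤ M) :
    modelAvg P (fun σ => F σ * cavityOverlapSum p q i fun c => σ (ι c)) ≤ (m : ℝ) ^ 2 * M := by
  have : NeZero N := .of_pos i.pos
  simp only [cavityOverlapSum, cavityOverlap_comp p q hι, Finset.mul_sum, modelAvg_sum]
  exact sum_sum_fin_le hM

end CavityOverlapSum

section CavityRate

/-- A bound for the logarithmic derivative along the cavity path of the average of a nonnegative
function of `n` replicas. -/
def cavityRate (S n : ℕ) : ℝ := 3 * ((n : ℝ) + 1) ^ 2 * (n + 2) ^ 2 * (S : ℝ) ^ 4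

/-- Bounds the derivative along the cavity path of the average of a function of `n` replicas, in
units of `β ^ 2` and of the size of that function times an overlap. -/
def driftConst (S n : ℕ) : ℝ :=
  ((n : ℝ) + 1) ^ 2 * (n + 2) ^ 2 * (S : ℝ) ^ 2 * Real.exp (cavityRate S (n + 2))

/-- The analogue of `driftConst` for the second derivative, in units of `β ^ 4` and of the size of
the function times two overlaps. -/
def driftSqConst (S n : ℕ) : ℝ :=
  ((n : ℝ) + 1) ^ 2 * (n + 2) ^ 2 * (S : ℝ) ^ 2 * driftConst S (n + 2)

theorem driftConst_nonneg (S n : ℕ) : 0 ≤ driftConst S n := by unfold driftConst; positivity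

theorem driftSqConst_nonneg (S n : ℕ) : 0 ≤ driftSqConst S n :=
  mul_nonneg (by positivity) (driftConst_nonneg S _)

variable {P : Params} {p q : ℝ} {N n : ℕ} (hq : 0 ≤ q) (i : Fin N)

theorem abs_cavityPath_drift_le (f : (Fin n → Config N P.S) → ℝ)
    (σ : Fin (n + 2) → Config N P.S) :
    |(cavityPath P p q hq i).drift f σ| ≤ P.β ^ 2 * ((n + 1) ^ 2 * (P.S : ℝ) ^ 2) *
      (|f (fun k => σ k.castSucc.castSucc)| * cavityOverlapSum p q i σ) := by
  have hterm : ∀ k l, |driftU n k * driftV n l *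
      (spinProduct i σ k l * cavityOverlap p q i σ k l)|
      ≤ (n + 1) ^ 2 * (P.S : ℝ) ^ 2 * |cavityOverlap p q i σ k l| := fun k l => by
    rw [abs_mul, abs_mul, abs_mul, ← mul_assoc, sq ((n : ℝ) + 1)]
    gcongr
    · exact abs_driftU_le k
    · exact abs_driftV_le l
    · exact abs_spinProduct_le i σ k l
  have hsum : |∑ k, ∑ l, driftU n k * driftV n l *
      (spinProduct i σ k l * cavityOverlap p q i σ k l)|
      ≤ (n + 1) ^ 2 * (P.S : ℝ) ^ 2 * cavityOverlapSum p q i σ := by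
    simp_rw [cavityOverlapSum, Finset.mul_sum]
    exact (Finset.abs_sum_le_sum_abs _ _).trans (Finset.sum_le_sum fun k _ =>
      (Finset.abs_sum_le_sum_abs _ _).trans (Finset.sum_le_sum fun l _ => hterm k l))
  rw [cavityPath_drift, abs_mul, abs_mul, abs_of_nonneg (sq_nonneg P.β)]
  calc _ ≤ |f (fun k => σ k.castSucc.castSucc)| * (P.β ^ 2 * ((n + 1) ^ 2 * (P.S : ℝ) ^ 2 *
        cavityOverlapSum p q i σ)) := by gcongr
    _ = _ := by ring

variable (hβ : P.β ^ 2 ≤ 1) (hp : |p| ≤ (P.S : ℝ) ^ 2) (hqS : |q| ≤ (P.S : ℝ) ^ 2)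

include hβ hp hqS

theorem cavityPath_avg_le {f : (Fin n → Config N P.S) → ℝ} (hf : ∀ σ, 0 ≤ f σ) {θ : ℝ}
    (hθ : θ ∈ Set.Icc 0 (Real.pi / 2)) :
    (cavityPath P p q hq i).avg θ f ≤ Real.exp (cavityRate P.S n) * modelAvg P f := by
  rw [← cavityPath_avg_pi_div_two P p q hq i]
  refine GaussianPath.avg_le_exp_mul_avg _ hf (by unfold cavityRate; positivity) (fun σ => ?_) hθ
  have hsum : cavityOverlapSum p q i σ ≤ ((n + 2 : ℕ) : ℝ) ^ 2 * (3 * (P.S : ℝ) ^ 2) :=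
    sum_sum_fin_le fun k l => abs_cavityOverlap_le hp hqS i σ k l
  have hnonneg := hf fun k => σ k.castSucc.castSucc
  have hsum_nonneg := cavityOverlapSum_nonneg (p := p) (q := q) i σ
  refine (abs_cavityPath_drift_le hq i f σ).trans ?_
  rw [abs_of_nonneg hnonneg]
  calc _ ≤ 1 * ((n + 1) ^ 2 * (P.S : ℝ) ^ 2) * (f (fun k => σ k.castSucc.castSucc) *
        (((n + 2 : ℕ) : ℝ) ^ 2 * (3 * (P.S : ℝ) ^ 2))) := by gcongr
    _ = _ := by unfold cavityRate; push_cast; ring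

theorem abs_cavityPath_avg_drift_le {f g : (Fin n → Config N P.S) → ℝ} (hf : ∀ σ, |f σ| ≤ g σ)
    {M : ℝ} (hM : ∀ k l : Fin (n + 2), (modelAvg P fun σ : Fin (n + 2) → Config N P.S =>
      g (fun k => σ k.castSucc.castSucc) * |cavityOverlap p q i σ k l|) ≤ M)
    {θ : ℝ} (hθ : θ ∈ Set.Icc 0 (Real.pi / 2)) :
    |(cavityPath P p q hq i).avg θ ((cavityPath P p q hq i).drift f)|
      ≤ P.β ^ 2 * driftConst P.S n * M := by
  let F : (Fin (n + 2) → Config N P.S) → ℝ := fun σ =>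
    g (fun k => σ k.castSucc.castSucc) * cavityOverlapSum p q i σ
  have hdrift : ∀ σ, |(cavityPath P p q hq i).drift f σ|
      ≤ P.β ^ 2 * ((n + 1) ^ 2 * (P.S : ℝ) ^ 2) * F σ := fun σ =>
    (abs_cavityPath_drift_le hq i f σ).trans <| mul_le_mul_of_nonneg_left
      (mul_le_mul_of_nonneg_right (hf _) (cavityOverlapSum_nonneg i σ)) (by positivity)
  have hF : ∀ σ, 0 ≤ F σ := fun σ =>
    mul_nonneg ((abs_nonneg _).trans (hf _)) (cavityOverlapSum_nonneg i σ)
  calc _ ≤ P.β ^ 2 * ((n + 1) ^ 2 * (P.S : ℝ) ^ 2) * (cavityPath P p q hq i).avg θ F :=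
        (GaussianPath.abs_avg_le _ θ hdrift).trans_eq (GaussianPath.avg_const_mul _ _ _ _)
    _ ≤ P.β ^ 2 * ((n + 1) ^ 2 * (P.S : ℝ) ^ 2) *
        (Real.exp (cavityRate P.S (n + 2)) * (((n + 2 : ℕ) : ℝ) ^ 2 * M)) := by
        gcongr
        refine (cavityPath_avg_le hq i hβ hp hqS hF hθ).trans ?_
        gcongr
        exact modelAvg_mul_cavityOverlapSum_le i Function.injective_id hM
    _ = _ := by unfold driftConst; push_cast; ring

theorem abs_modelAvg_sub_avg_zero_le {f g : (Fin n → Config N P.S) → ℝ} (hf : ∀ σ, |f σ| ≤ g σ)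
    {M : ℝ} (hM : ∀ k l : Fin (n + 2), (modelAvg P fun σ : Fin (n + 2) → Config N P.S =>
      g (fun k => σ k.castSucc.castSucc) * |cavityOverlap p q i σ k l|) ≤ M) :
    |modelAvg P f - (cavityPath P p q hq i).avg 0 f| ≤ P.β ^ 2 * driftConst P.S n * M := by
  rw [← cavityPath_avg_pi_div_two P p q hq i]
  exact GaussianPath.abs_avg_sub_avg_le _
    (fun θ hθ => abs_cavityPath_avg_drift_le hq i hβ hp hqS hf hM hθ)
    GaussianPath.zero_mem_Icc_pi_div_two GaussianPath.pi_div_two_mem_Icc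

theorem abs_cavityPath_avg_drift_drift_le {f g : (Fin n → Config N P.S) → ℝ}
    (hf : ∀ σ, |f σ| ≤ g σ) {M : ℝ} (hM : ∀ (k l : Fin (n + 2)) (a b : Fin (n + 4)),
      (modelAvg P fun σ : Fin (n + 4) → Config N P.S =>
        g (fun m => σ m.castSucc.castSucc.castSucc.castSucc) *
          |cavityOverlap p q i σ k.castSucc.castSucc l.castSucc.castSucc| *
          |cavityOverlap p q i σ a b|) ≤ M) {θ : ℝ} (hθ : θ ∈ Set.Icc 0 (Real.pi / 2)) :
    |(cavityPath P p q hq i).avg θ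
      ((cavityPath P p q hq i).drift ((cavityPath P p q hq i).drift f))|
      ≤ P.β ^ 4 * driftSqConst P.S n * M := by
  have : NeZero N := .of_pos i.pos
  have hι : Function.Injective fun k : Fin (n + 2) => k.castSucc.castSucc :=
    (Fin.castSucc_injective _).comp (Fin.castSucc_injective _)
  let A : ℝ := P.β ^ 2 * ((n + 1) ^ 2 * (P.S : ℝ) ^ 2)
  let F : (Fin (n + 2) → Config N P.S) → ℝ := fun σ =>
    A * (g (fun k => σ k.castSucc.castSucc) * cavityOverlapSum p q i σ)
  have hF : ∀ σ, |(cavityPath P p q hq i).drift f σ| ≤ F σ := fun σ =>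
    (abs_cavityPath_drift_le hq i f σ).trans <| mul_le_mul_of_nonneg_left
      (mul_le_mul_of_nonneg_right (hf _) (cavityOverlapSum_nonneg i σ)) (by positivity)
  have havg : ∀ a b : Fin (n + 2 + 2), (modelAvg P fun σ : Fin (n + 2 + 2) → Config N P.S =>
      F (fun k => σ k.castSucc.castSucc) * |cavityOverlap p q i σ a b|)
      ≤ A * (((n + 2 : ℕ) : ℝ) ^ 2 * M) := fun a b => by
    have hreorder : ∀ σ : Fin (n + 2 + 2) → Config N P.S,
        F (fun k => σ k.castSucc.castSucc) * |cavityOverlap p q i σ a b|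
          = A * (g (fun m => σ m.castSucc.castSucc.castSucc.castSucc) *
            |cavityOverlap p q i σ a b| *
            cavityOverlapSum p q i fun k => σ k.castSucc.castSucc) := fun σ => by
      simp only [F]; ring
    simp only [hreorder, modelAvg_const_mul]
    refine mul_le_mul_of_nonneg_left (modelAvg_mul_cavityOverlapSum_le i hι fun k l => ?_)
      (by positivity)
    simpa only [mul_right_comm] using hM k l a b
  refine (abs_cavityPath_avg_drift_le hq i hβ hp hqS hF havg hθ).trans_eq ?_
  simp only [A, driftSqConst]
  push_cast
  ring

theorem abs_modelAvg_sub_avg_zero_sub_le {f g : (Fin n → Config N P.S) → ℝ}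
    (hf : ∀ σ, |f σ| ≤ g σ) {M : ℝ} (hM : ∀ (k l : Fin (n + 2)) (a b : Fin (n + 4)),
      (modelAvg P fun σ : Fin (n + 4) → Config N P.S =>
        g (fun m => σ m.castSucc.castSucc.castSucc.castSucc) *
          |cavityOverlap p q i σ k.castSucc.castSucc l.castSucc.castSucc| *
          |cavityOverlap p q i σ a b|) ≤ M) :
    |modelAvg P f - (cavityPath P p q hq i).avg 0 f
        - 1 / 2 * (cavityPath P p q hq i).avg 0 ((cavityPath P p q hq i).drift f)|
      ≤ P.β ^ 4 * driftSqConst P.S n * M := by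
  rw [← cavityPath_avg_pi_div_two P p q hq i]
  exact GaussianPath.abs_avg_sub_avg_sub_le _
    fun θ hθ => abs_cavityPath_avg_drift_drift_le hq i hβ hp hqS hf hM hθ

end CavityRate

theorem nu0_comp_injective (P : Params) (p q : ℝ) {m n : ℕ} {ι : Fin m → Fin n}
    (hι : Function.Injective ι) (φ : (Fin m → ℝ) → ℝ) :
    (nu0 P p q fun ε : Fin n → ℝ => φ fun c => ε (ι c)) = nu0 P p q φ := by
  simp only [nu0_eq]
  simp_rw [gibbsAvg_comp_injective _ hι fun ε : Fin m → Spin P.S => φ fun k => (ε k).val]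

section Nu0

variable {P : Params} {p q : ℝ} (hq : 0 ≤ q) {n : ℕ}

include hq

theorem nu0_eq_avg (φ : (Fin n → ℝ) → ℝ) :
    nu0 P p q φ = (cavityParamPath P p q p q hq hq).avg 0
      (fun ε : Fin n → Spin P.S => φ fun k => (ε k).val) :=
  (cavityParamPath_avg_zero P p q p q hq hq φ).symm

theorem nu0_sub (φ ψ : (Fin n → ℝ) → ℝ) :
    (nu0 P p q fun ε => φ ε - ψ ε) = nu0 P p q φ - nu0 P p q ψ := by
  simp only [nu0_eq_avg hq, GaussianPath.avg_sub]

theorem nu0_const_mul (a : ℝ) (φ : (Fin n → ℝ) → ℝ) :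
    (nu0 P p q fun ε => a * φ ε) = a * nu0 P p q φ := by
  simp only [nu0_eq_avg hq, GaussianPath.avg_const_mul]

theorem nu0_const (a : ℝ) : (nu0 P p q fun _ : Fin n → ℝ => a) = a := by
  simp only [nu0_eq_avg hq, GaussianPath.avg_const]

end Nu0

theorem injective_pair {n : ℕ} {k l : Fin n} (h : k ≠ l) : Function.Injective ![k, l] := by
  intro a b
  fin_cases a <;> fin_cases b <;> simp [h, h.symm]

theorem injective_singleton {n : ℕ} (k : Fin n) : Function.Injective ![k] :=
  Function.injective_of_subsingleton _

section ReplicaSymmetric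

variable {P : Params} {p q : ℝ} (h : IsReplicaSymmetric P p q) {n : ℕ} (k l : Fin n)

include h

theorem IsReplicaSymmetric.nu0_mul : (nu0 P p q fun ε => ε k * ε l) = rsParam p q k l := by
  rcases eq_or_ne k l with rfl | hkl
  · rw [rsParam, if_pos rfl]
    simp only [← sq]
    exact (nu0_comp_injective P p q (injective_singleton k) fun ε => ε 0 ^ 2).trans h.1.symm
  · rw [rsParam, if_neg hkl]
    exact (nu0_comp_injective P p q (injective_pair hkl) fun ε => ε 0 * ε 1).trans h.2.symm

theorem IsReplicaSymmetric.nu0_mul_sub :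
    (nu0 P p q fun ε => ε k * ε l - rsParam p q k l) = 0 := by
  rw [nu0_sub h.nonneg, nu0_const h.nonneg, h.nu0_mul, sub_self]

end ReplicaSymmetric

section Moments

theorem pow_mul_le_pow_add_pow {x y : ℝ} (hx : 0 ≤ x) (hy : 0 ≤ y) (r : ℕ) :
    x ^ r * y ≤ x ^ (r + 1) + y ^ (r + 1) := by
  rcases le_total x y with hxy | hxy
  · calc x ^ r * y ≤ y ^ r * y := by gcongr
      _ = y ^ (r + 1) := (pow_succ _ _).symm
      _ ≤ _ := le_add_of_nonneg_left (by positivity)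
  · calc x ^ r * y ≤ x ^ r * x := by gcongr
      _ = x ^ (r + 1) := (pow_succ _ _).symm
      _ ≤ _ := le_add_of_nonneg_right (by positivity)

theorem abs_pow_succ_sub_pow_succ_le (x y : ℝ) (r : ℕ) :
    |x ^ (r + 1) - y ^ (r + 1)| ≤ (r + 1) * |x - y| * (|x| ^ r + |y| ^ r) := by
  have hmax : max |x| |y| ^ r ≤ |x| ^ r + |y| ^ r := by
    rcases max_choice |x| |y| with hm | hm <;> rw [hm]
    · exact le_add_of_nonneg_right (by positivity)
    · exact le_add_of_nonneg_left (by positivity)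
  calc _ ≤ |x - y| * (r + 1 : ℕ) * max |x| |y| ^ r := abs_pow_sub_pow_le _ _ _
    _ = (r + 1) * |x - y| * max |x| |y| ^ r := by push_cast; ring
    _ ≤ _ := by gcongr

variable (P : Params) (p q : ℝ) (N : ℕ)

/-- The sum of the `r`-th absolute moments of the overlap and of the self-overlap. -/
def overlapMoment (r : ℕ) : ℝ :=
  (modelAvg P fun σ : Fin 2 → Config N P.S => |overlap p q σ 0 1| ^ r)
    + modelAvg P fun σ : Fin 1 → Config N P.S => |overlap p q σ 0 0| ^ r

/-- Bounds, up to the factor `2 ^ r`, the `r`-th absolute moments of the overlaps without a site: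
removing a site changes an overlap by at most `S ^ 2 / N`. -/
def cavityMoment (r : ℕ) : ℝ := overlapMoment P p q N r + ((P.S : ℝ) ^ 2 / N) ^ r

variable {P p q N} [NeZero N]

theorem modelAvg_abs_overlap_pow {n : ℕ} (k l : Fin n) (r : ℕ) :
    (modelAvg P fun σ : Fin n → Config N P.S => |overlap p q σ k l| ^ r)
      = if k = l then modelAvg P fun σ : Fin 1 → Config N P.S => |overlap p q σ 0 0| ^ r
        else modelAvg P fun σ : Fin 2 → Config N P.S => |overlap p q σ 0 1| ^ r := by
  rcases eq_or_ne k l with rfl | hkl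
  · rw [if_pos rfl, ← modelAvg_comp_injective P (injective_singleton k)]
    simp only [overlap_comp p q (injective_singleton k), Matrix.cons_val_zero]
  · rw [if_neg hkl, ← modelAvg_comp_injective P (injective_pair hkl)]
    simp only [overlap_comp p q (injective_pair hkl), Matrix.cons_val_zero, Matrix.cons_val_one]

theorem modelAvg_abs_overlap_pow_nonneg {n : ℕ} (k l : Fin n) (r : ℕ) :
    0 ≤ modelAvg P fun σ : Fin n → Config N P.S => |overlap p q σ k l| ^ r :=
  modelAvg_nonneg P fun _ => by positivity

theorem overlapMoment_nonneg (r : ℕ) : 0 ≤ overlapMoment P p q N r :=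
  add_nonneg (modelAvg_abs_overlap_pow_nonneg _ _ r) (modelAvg_abs_overlap_pow_nonneg _ _ r)

theorem cavityMoment_nonneg (r : ℕ) : 0 ≤ cavityMoment P p q N r :=
  add_nonneg (overlapMoment_nonneg r) (by positivity)

theorem overlapMoment_le {r : ℕ} {B : ℝ}
    (h : ∀ k l : Fin 2, (modelAvg P fun σ : Fin 2 → Config N P.S => |overlap p q σ k l| ^ r) ≤ B) :
    overlapMoment P p q N r ≤ 2 * B := by
  have hself := h 0 0
  rw [modelAvg_abs_overlap_pow, if_pos rfl] at hself
  unfold overlapMoment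
  linarith [h 0 1]

theorem modelAvg_abs_overlap_pow_le {n : ℕ} (k l : Fin n) (r : ℕ) :
    (modelAvg P fun σ : Fin n → Config N P.S => |overlap p q σ k l| ^ r)
      ≤ overlapMoment P p q N r := by
  rw [modelAvg_abs_overlap_pow]
  split_ifs
  · exact le_add_of_nonneg_left (modelAvg_abs_overlap_pow_nonneg _ _ r)
  · exact le_add_of_nonneg_right (modelAvg_abs_overlap_pow_nonneg _ _ r)

theorem modelAvg_abs_cavityOverlap_pow_le {n : ℕ} (i : Fin N) (k l : Fin n) (r : ℕ) :
    (modelAvg P fun σ : Fin n → Config N P.S => |cavityOverlap p q i σ k l| ^ r)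
      ≤ 2 ^ r * cavityMoment P p q N r := by
  have hpoint : ∀ σ : Fin n → Config N P.S, |cavityOverlap p q i σ k l| ^ r
      ≤ 2 ^ r * (|overlap p q σ k l| ^ r + ((P.S : ℝ) ^ 2 / N) ^ r) := fun σ => by
    calc _ ≤ (|overlap p q σ k l| + (P.S : ℝ) ^ 2 / N) ^ r :=
          pow_le_pow_left₀ (abs_nonneg _) (abs_cavityOverlap_le_add p q i σ k l) r
      _ ≤ 2 ^ (r - 1) * (|overlap p q σ k l| ^ r + ((P.S : ℝ) ^ 2 / N) ^ r) :=
          add_pow_le (abs_nonneg _) (by positivity) r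
      _ ≤ _ := by
          gcongr
          · exact one_le_two
          · exact Nat.sub_le r 1
  refine (modelAvg_mono P hpoint).trans ?_
  rw [modelAvg_const_mul, modelAvg_add, modelAvg_const, cavityMoment]
  gcongr
  exact modelAvg_abs_overlap_pow_le k l r

end Moments

section SelfConsistency

/-- The constant of the self-consistent bound for the moments of the overlaps. -/
def momentRate (S : ℕ) : ℝ := 64 * (S : ℝ) ^ 2 * driftConst S 2

theorem abs_overlap_pow_eq_sum {N S n : ℕ} [NeZero N] (p q : ℝ) (σ : Fin n → Config N S)
    (k l : Fin n) {r : ℕ} (hr : Even r) :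
    |overlap p q σ k l| ^ (r + 2)
      = 1 / (N : ℝ) * ∑ i,
        ((spinProduct i σ k l - rsParam p q k l) * cavityOverlap p q i σ k l ^ (r + 1)
        + (spinProduct i σ k l - rsParam p q k l) *
          (overlap p q σ k l ^ (r + 1) - cavityOverlap p q i σ k l ^ (r + 1))) := by
  simp_rw [(hr.add even_two).pow_abs, ← mul_add, add_sub_cancel, ← Finset.sum_mul, ← mul_assoc,
    ← overlap_eq_sum, ← pow_succ']
  rfl

variable {P : Params} {p q : ℝ} {N : ℕ} [NeZero N]

theorem modelAvg_abs_cavityOverlap_pow_mul_abs_le {n : ℕ} (i : Fin N) (k l a b : Fin n) (r : ℕ) :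
    (modelAvg P fun σ : Fin n → Config N P.S =>
      |cavityOverlap p q i σ k l| ^ r * |cavityOverlap p q i σ a b|)
      ≤ 2 ^ (r + 2) * cavityMoment P p q N (r + 1) := by
  calc _ ≤ modelAvg P fun σ : Fin n → Config N P.S =>
        |cavityOverlap p q i σ k l| ^ (r + 1) + |cavityOverlap p q i σ a b| ^ (r + 1) :=
        modelAvg_mono P fun σ => pow_mul_le_pow_add_pow (abs_nonneg _) (abs_nonneg _) r
    _ ≤ 2 ^ (r + 1) * cavityMoment P p q N (r + 1)
        + 2 ^ (r + 1) * cavityMoment P p q N (r + 1) := by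
        rw [modelAvg_add]
        exact add_le_add (modelAvg_abs_cavityOverlap_pow_le i _ _ _)
          (modelAvg_abs_cavityOverlap_pow_le i _ _ _)
    _ = _ := by ring

theorem abs_modelAvg_centered_mul_pow_sub_pow_le (hp : |p| ≤ (P.S : ℝ) ^ 2)
    (hq : |q| ≤ (P.S : ℝ) ^ 2) (i : Fin N) {n : ℕ} (k l : Fin n) {r : ℕ} (hr : r ≤ 2) :
    |modelAvg P fun σ : Fin n → Config N P.S => (spinProduct i σ k l - rsParam p q k l) *
        (overlap p q σ k l ^ (r + 1) - cavityOverlap p q i σ k l ^ (r + 1))|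
      ≤ 30 * (P.S : ℝ) ^ 4 / N * cavityMoment P p q N r := by
  have hr' : (r : ℝ) + 1 ≤ 3 := by exact_mod_cast Nat.succ_le_succ hr
  have hpoint : ∀ σ : Fin n → Config N P.S, |(spinProduct i σ k l - rsParam p q k l) *
          (overlap p q σ k l ^ (r + 1) - cavityOverlap p q i σ k l ^ (r + 1))|
      ≤ 2 * (P.S : ℝ) ^ 2 * (3 * ((P.S : ℝ) ^ 2 / N)) *
        (|overlap p q σ k l| ^ r + |cavityOverlap p q i σ k l| ^ r) := fun σ => by
    rw [abs_mul, mul_assoc]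
    gcongr
    · exact abs_spinProduct_sub_rsParam_le hp hq i σ k l
    · refine (abs_pow_succ_sub_pow_succ_le _ _ r).trans ?_
      gcongr
      exact abs_overlap_sub_cavityOverlap_le p q i σ k l
  have hoverlap : (modelAvg P fun σ : Fin n → Config N P.S => |overlap p q σ k l| ^ r)
      ≤ cavityMoment P p q N r :=
    (modelAvg_abs_overlap_pow_le k l r).trans (le_add_of_nonneg_right (by positivity))
  have hcavity : (modelAvg P fun σ : Fin n → Config N P.S => |cavityOverlap p q i σ k l| ^ r)
      ≤ 2 ^ 2 * cavityMoment P p q N r :=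
    (modelAvg_abs_cavityOverlap_pow_le i k l r).trans <| mul_le_mul_of_nonneg_right
      (pow_le_pow_right₀ one_le_two hr) (cavityMoment_nonneg r)
  refine (abs_modelAvg_le P hpoint).trans ?_
  rw [modelAvg_const_mul, modelAvg_add]
  calc _ ≤ 2 * (P.S : ℝ) ^ 2 * (3 * ((P.S : ℝ) ^ 2 / N)) *
        (cavityMoment P p q N r + 2 ^ 2 * cavityMoment P p q N r) := by gcongr
    _ = _ := by ring

variable (h : IsReplicaSymmetric P p q) (hβ : P.β ^ 2 ≤ 1)

include h

omit [NeZero N] in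
theorem cavityPath_avg_zero_centered_mul (i : Fin N) {n : ℕ} (k l : Fin n) (r : ℕ) :
    (cavityPath P p q h.nonneg i).avg 0 (fun σ : Fin n → Config N P.S =>
      (spinProduct i σ k l - rsParam p q k l) * cavityOverlap p q i σ k l ^ r) = 0 := by
  have hfactor := cavityPath_avg_zero_mul P p q h.nonneg i
    (fun ε => ε k * ε l - rsParam p q k l) (Y := fun σ => cavityOverlap p q i σ k l ^ r)
    (fun σ => by rw [cavityOverlap_eraseSpin])
  rwa [h.nu0_mul_sub, zero_mul] at hfactor

include hβ

theorem abs_modelAvg_centered_mul_cavityOverlap_pow_le (i : Fin N) (k l : Fin 2) {r : ℕ}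
    (hr : r ≤ 3) :
    |modelAvg P fun σ : Fin 2 → Config N P.S =>
      (spinProduct i σ k l - rsParam p q k l) * cavityOverlap p q i σ k l ^ r|
      ≤ P.β ^ 2 * momentRate P.S * cavityMoment P p q N (r + 1) := by
  obtain ⟨hp, hq⟩ := h.abs_le
  have hM : 0 ≤ cavityMoment P p q N (r + 1) := cavityMoment_nonneg _
  have hf : ∀ σ : Fin 2 → Config N P.S,
      |(spinProduct i σ k l - rsParam p q k l) * cavityOverlap p q i σ k l ^ r|
        ≤ 2 * (P.S : ℝ) ^ 2 * |cavityOverlap p q i σ k l| ^ r := fun σ => by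
    rw [abs_mul, abs_pow]
    gcongr
    exact abs_spinProduct_sub_rsParam_le hp hq i σ k l
  have hι : Function.Injective fun k : Fin 2 => k.castSucc.castSucc :=
    (Fin.castSucc_injective _).comp (Fin.castSucc_injective _)
  have havg : ∀ a b : Fin 4, (modelAvg P fun σ : Fin 4 → Config N P.S =>
      (2 * (P.S : ℝ) ^ 2 * |cavityOverlap p q i (fun m : Fin 2 => σ m.castSucc.castSucc) k l| ^ r)
        * |cavityOverlap p q i σ a b|)
      ≤ 2 * (P.S : ℝ) ^ 2 * (2 ^ 5 * cavityMoment P p q N (r + 1)) := fun a b => by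
    simp only [cavityOverlap_comp p q hι, mul_assoc (2 * (P.S : ℝ) ^ 2), modelAvg_const_mul]
    gcongr
    refine (modelAvg_abs_cavityOverlap_pow_mul_abs_le i _ _ a b r).trans ?_
    gcongr
    · exact one_le_two
    · omega
  have hcavity := abs_modelAvg_sub_avg_zero_le h.nonneg i hβ hp hq hf havg
  rw [cavityPath_avg_zero_centered_mul h, sub_zero] at hcavity
  refine hcavity.trans_eq ?_
  unfold momentRate
  ring

theorem modelAvg_abs_overlap_pow_add_two_le (k l : Fin 2) {r : ℕ} (hr : r ≤ 2) (heven : Even r) :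
    (modelAvg P fun σ : Fin 2 → Config N P.S => |overlap p q σ k l| ^ (r + 2))
      ≤ P.β ^ 2 * momentRate P.S * cavityMoment P p q N (r + 2)
        + 30 * (P.S : ℝ) ^ 4 / N * cavityMoment P p q N r := by
  have hN : (0 : ℝ) < N := Nat.cast_pos.2 (NeZero.pos N)
  obtain ⟨hp, hq⟩ := h.abs_le
  simp_rw [abs_overlap_pow_eq_sum p q _ k l heven, modelAvg_const_mul, modelAvg_sum, modelAvg_add]
  rw [one_div, inv_mul_le_iff₀ hN]
  calc _ ≤ ∑ _i : Fin N, (P.β ^ 2 * momentRate P.S * cavityMoment P p q N (r + 2)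
        + 30 * (P.S : ℝ) ^ 4 / N * cavityMoment P p q N r) :=
        Finset.sum_le_sum fun i _ => add_le_add
          ((le_abs_self _).trans
            (abs_modelAvg_centered_mul_cavityOverlap_pow_le h hβ i k l (Nat.succ_le_succ hr)))
          ((le_abs_self _).trans (abs_modelAvg_centered_mul_pow_sub_pow_le hp hq i k l hr))
    _ = _ := by rw [Finset.sum_const, Finset.card_univ, Fintype.card_fin, nsmul_eq_mul]

theorem overlapMoment_add_two_le {r : ℕ} (hr : r ≤ 2) (heven : Even r)
    (hsmall : 4 * (P.β ^ 2 * momentRate P.S) ≤ 1) :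
    overlapMoment P p q N (r + 2) ≤ ((P.S : ℝ) ^ 2 / N) ^ (r + 2)
      + 120 * (P.S : ℝ) ^ 4 / N * cavityMoment P p q N r := by
  have hmoment := overlapMoment_le fun k l =>
    modelAvg_abs_overlap_pow_add_two_le (N := N) h hβ k l hr heven
  have habsorb := mul_le_mul_of_nonneg_right hsmall (cavityMoment_nonneg (P := P) (p := p) (q := q)
    (N := N) (r + 2))
  have hconst : 120 * (P.S : ℝ) ^ 4 / N * cavityMoment P p q N r
      = 4 * (30 * (P.S : ℝ) ^ 4 / N * cavityMoment P p q N r) := by ring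
  rw [hconst]
  have hdef : cavityMoment P p q N (r + 2)
    = overlapMoment P p q N (r + 2) + ((P.S : ℝ) ^ 2 / N) ^ (r + 2) := rfl
  linarith

end SelfConsistency

section FluctScale

/-- The order `N ^ (-1/2)` of the overlaps. -/
def fluctScale (N : ℕ) : ℝ := (√(N : ℝ))⁻¹

theorem fluctScale_nonneg (N : ℕ) : 0 ≤ fluctScale N := by unfold fluctScale; positivity

theorem fluctScale_sq (N : ℕ) : fluctScale N ^ 2 = 1 / N := by
  unfold fluctScale
  rw [inv_pow, Real.sq_sqrt (Nat.cast_nonneg N), one_div]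

theorem fluctScale_cube (N : ℕ) : fluctScale N ^ 3 = (N : ℝ) ^ (-(3 / 2) : ℝ) := by
  unfold fluctScale
  rw [inv_pow, Real.sqrt_eq_rpow, ← Real.rpow_natCast, ← Real.rpow_mul (Nat.cast_nonneg N),
    ← Real.rpow_neg (Nat.cast_nonneg N)]
  norm_num

theorem div_eq_mul_fluctScale_sq (a : ℝ) (N : ℕ) : a / N = a * fluctScale N ^ 2 := by
  rw [fluctScale_sq, mul_one_div]

theorem fluctScale_pos (N : ℕ) [NeZero N] : 0 < fluctScale N :=
  inv_pos.2 (Real.sqrt_pos.2 (Nat.cast_pos.2 (NeZero.pos N)))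

theorem fluctScale_le_one (N : ℕ) [NeZero N] : fluctScale N ≤ 1 :=
  inv_le_one_of_one_le₀ (Real.one_le_sqrt.2 (by exact_mod_cast NeZero.one_le))

end FluctScale

section MomentBounds

/-- The `r`-th moments of the overlaps are `O(N ^ (-r/2))`. -/
def HasMomentBound (P : Params) (p q : ℝ) (r : ℕ) : Prop :=
  ∃ C : ℝ, 0 ≤ C ∧ ∀ (N : ℕ) [NeZero N], overlapMoment P p q N r ≤ C * fluctScale N ^ r

variable {P : Params} {p q : ℝ} {r : ℕ}

theorem hasMomentBound_zero (P : Params) (p q : ℝ) : HasMomentBound P p q 0 := by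
  refine ⟨2, zero_le_two, fun N _ => le_of_eq ?_⟩
  simp only [overlapMoment, pow_zero, modelAvg_const]
  norm_num

theorem cavityMoment_le {C : ℝ} (N : ℕ) [NeZero N]
    (hC : overlapMoment P p q N r ≤ C * fluctScale N ^ r) :
    cavityMoment P p q N r ≤ (C + ((P.S : ℝ) ^ 2) ^ r) * fluctScale N ^ r := by
  have hscale : (fluctScale N ^ 2) ^ r ≤ fluctScale N ^ r := by
    rw [← pow_mul]
    exact pow_le_pow_of_le_one (fluctScale_nonneg N) (fluctScale_le_one N)
      (Nat.le_mul_of_pos_left r two_pos)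
  rw [cavityMoment, div_eq_mul_fluctScale_sq, mul_pow, add_mul]
  gcongr

theorem pow_succ_le_pow_add_pow {x s : ℝ} (hx : 0 ≤ x) (hs : 0 < s) (r : ℕ) :
    x ^ (r + 1) ≤ s * x ^ r + s⁻¹ * x ^ (r + 2) := by
  have hamgm : x ≤ s + s⁻¹ * x ^ 2 := by
    have hsq := two_mul_le_add_sq s x
    rw [← mul_le_mul_iff_right₀ hs, mul_add, mul_inv_cancel_left₀ hs.ne']
    nlinarith [mul_nonneg hs.le hx]
  calc x ^ (r + 1) = x ^ r * x := pow_succ x r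
    _ ≤ x ^ r * (s + s⁻¹ * x ^ 2) := by gcongr
    _ = s * x ^ r + s⁻¹ * x ^ (r + 2) := by ring

theorem overlapMoment_succ_le (N : ℕ) [NeZero N] {s : ℝ} (hs : 0 < s) (r : ℕ) :
    overlapMoment P p q N (r + 1)
      ≤ s * overlapMoment P p q N r + s⁻¹ * overlapMoment P p q N (r + 2) := by
  have hmoment : ∀ {n : ℕ} (k l : Fin n),
      (modelAvg P fun σ : Fin n → Config N P.S => |overlap p q σ k l| ^ (r + 1))
        ≤ s * (modelAvg P fun σ : Fin n → Config N P.S => |overlap p q σ k l| ^ r)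
          + s⁻¹ * modelAvg P fun σ : Fin n → Config N P.S => |overlap p q σ k l| ^ (r + 2) :=
    fun k l => by
      simp only [← modelAvg_const_mul, ← modelAvg_add]
      exact modelAvg_mono P fun σ => pow_succ_le_pow_add_pow (abs_nonneg _) hs r
  unfold overlapMoment
  linarith [hmoment (0 : Fin 2) 1, hmoment (0 : Fin 1) 0]

theorem HasMomentBound.succ (hr : HasMomentBound P p q r) (hr2 : HasMomentBound P p q (r + 2)) :
    HasMomentBound P p q (r + 1) := by
  obtain ⟨C, hC0, hC⟩ := hr
  obtain ⟨C', hC'0, hC'⟩ := hr2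
  refine ⟨C + C', add_nonneg hC0 hC'0, fun N _ => ?_⟩
  have hs := fluctScale_pos N
  calc _ ≤ fluctScale N * (C * fluctScale N ^ r)
        + (fluctScale N)⁻¹ * (C' * fluctScale N ^ (r + 2)) :=
        (overlapMoment_succ_le N hs r).trans (by gcongr; exacts [hC N, hC' N])
    _ = _ := by field_simp; ring

theorem HasMomentBound.add_two (h : IsReplicaSymmetric P p q) (hβ : P.β ^ 2 ≤ 1)
    (hsmall : 4 * (P.β ^ 2 * momentRate P.S) ≤ 1) (hr : r ≤ 2) (heven : Even r)
    (hbound : HasMomentBound P p q r) : HasMomentBound P p q (r + 2) := by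
  obtain ⟨C, hC0, hC⟩ := hbound
  refine ⟨((P.S : ℝ) ^ 2) ^ (r + 2) + 120 * (P.S : ℝ) ^ 4 * (C + ((P.S : ℝ) ^ 2) ^ r),
    by positivity, fun N _ => ?_⟩
  have hscale : (fluctScale N ^ 2) ^ (r + 2) ≤ fluctScale N ^ (r + 2) := by
    rw [← pow_mul]
    exact pow_le_pow_of_le_one (fluctScale_nonneg N) (fluctScale_le_one N)
      (Nat.le_mul_of_pos_left _ two_pos)
  refine (overlapMoment_add_two_le h hβ hr heven hsmall).trans ?_
  rw [div_eq_mul_fluctScale_sq, div_eq_mul_fluctScale_sq, mul_pow]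
  calc _ ≤ ((P.S : ℝ) ^ 2) ^ (r + 2) * fluctScale N ^ (r + 2)
        + 120 * (P.S : ℝ) ^ 4 * fluctScale N ^ 2 *
          ((C + ((P.S : ℝ) ^ 2) ^ r) * fluctScale N ^ r) := by
        gcongr
        exact cavityMoment_le N (hC N)
    _ = _ := by ring

theorem hasMomentBound_of_le_three (h : IsReplicaSymmetric P p q) (hβ : P.β ^ 2 ≤ 1)
    (hsmall : 4 * (P.β ^ 2 * momentRate P.S) ≤ 1) (hr : r ≤ 3) : HasMomentBound P p q r := by
  have hzero := hasMomentBound_zero P p q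
  have htwo := hzero.add_two h hβ hsmall zero_le_two Even.zero
  have hfour := htwo.add_two h hβ hsmall le_rfl even_two
  interval_cases r
  exacts [hzero, hzero.succ htwo, htwo, htwo.succ hfour]

/-- The overlaps are of order `N ^ (-1/2)`, with constant `C` for the first three moments. -/
def HasFluctuationBound (P : Params) (p q C : ℝ) : Prop :=
  ∀ (N : ℕ) [NeZero N] (n : ℕ) (k l : Fin n) (r : ℕ), r ≤ 3 →
    (modelAvg P fun σ : Fin n → Config N P.S => |overlap p q σ k l| ^ r) ≤ C * fluctScale N ^ r ∧
    ∀ i, (modelAvg P fun σ : Fin n → Config N P.S => |cavityOverlap p q i σ k l| ^ r)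
      ≤ C * fluctScale N ^ r

theorem exists_hasFluctuationBound (h : IsReplicaSymmetric P p q) (hβ : P.β ^ 2 ≤ 1)
    (hsmall : 4 * (P.β ^ 2 * momentRate P.S) ≤ 1) : ∃ C, HasFluctuationBound P p q C := by
  choose! C hC0 hC using fun (r : ℕ) (hr : r ≤ 3) =>
    hasMomentBound_of_le_three h hβ hsmall hr
  let K : ℕ → ℝ := fun r => 2 ^ r * (C r + ((P.S : ℝ) ^ 2) ^ r)
  have hK : ∀ r ≤ 3, K r ≤ ∑ r ∈ Finset.range 4, K r := fun r hr =>
    Finset.single_le_sum (fun s hs => mul_nonneg (by positivity)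
      (add_nonneg (hC0 s (Finset.mem_range_succ_iff.1 hs)) (by positivity)))
      (Finset.mem_range_succ_iff.2 hr)
  refine ⟨∑ r ∈ Finset.range 4, K r, fun N _ n k l r hr => ?_⟩
  have hs := pow_nonneg (fluctScale_nonneg N) r
  have hcavity := cavityMoment_le N (hC r hr N)
  have hbound : 2 ^ r * cavityMoment P p q N r
      ≤ (∑ r ∈ Finset.range 4, K r) * fluctScale N ^ r := by
    calc _ ≤ 2 ^ r * ((C r + ((P.S : ℝ) ^ 2) ^ r) * fluctScale N ^ r) := by gcongr
      _ = K r * fluctScale N ^ r := (mul_assoc _ _ _).symm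
      _ ≤ _ := mul_le_mul_of_nonneg_right (hK r hr) hs
  refine ⟨?_, fun i => (modelAvg_abs_cavityOverlap_pow_le i k l r).trans hbound⟩
  calc _ ≤ overlapMoment P p q N r := modelAvg_abs_overlap_pow_le k l r
    _ ≤ cavityMoment P p q N r := le_add_of_nonneg_right (by positivity)
    _ ≤ 2 ^ r * cavityMoment P p q N r :=
        le_mul_of_one_le_left (cavityMoment_nonneg r) (one_le_pow₀ one_le_two)
    _ ≤ _ := hbound

end MomentBounds

section Covariances

/-- The covariance of two overlaps. -/
def overlapCov (P : Params) (p q : ℝ) (N : ℕ) {n : ℕ} (k l k' l' : Fin n) : ℝ :=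
  modelAvg P fun σ : Fin n → Config N P.S => overlap p q σ k l * overlap p q σ k' l'

/-- The covariance of two products of cavity spins; the constants of the paper are of this form. -/
def cavityCov (P : Params) (p q : ℝ) {n : ℕ} (k l k' l' : Fin n) : ℝ :=
  nu0 P p q fun ε : Fin n → ℝ => (ε k * ε l - rsParam p q k l) * (ε k' * ε l')

/-- The leading term given by the cavity interpolation for the covariance of two overlaps, on top
of the contribution of one site. -/
def cavitySum (P : Params) (p q : ℝ) (N : ℕ) {n : ℕ} (k l k' l' : Fin n) : ℝ :=
  P.β ^ 2 / 2 * ∑ a : Fin (n + 2), ∑ b : Fin (n + 2), driftU n a * driftV n b *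
    (cavityCov P p q k.castSucc.castSucc l.castSucc.castSucc a b *
      overlapCov P p q N k'.castSucc.castSucc l'.castSucc.castSucc a b)

/-- Bounds the difference between the covariance of two overlaps and its analogue without
interaction with the cavity site, in units of `fluctScale N ^ 3`. -/
def siteRemovalConst (S n : ℕ) (C : ℝ) : ℝ := driftConst S n * (3 * C) + 2 * (S : ℝ) ^ 2 * C

/-- The constant of the error term in the cavity equation for `n` replicas. -/
def cavityErrorConst (S n : ℕ) (C : ℝ) : ℝ :=
  driftSqConst S n * (2 * (S : ℝ) ^ 2 * (3 * C))
    + ((n : ℝ) + 1) ^ 2 * (n + 2) ^ 2 * (S : ℝ) ^ 4 * siteRemovalConst S (n + 2) C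

theorem mul_mul_le_cube_add {a b c : ℝ} (ha : 0 ≤ a) (hb : 0 ≤ b) (hc : 0 ≤ c) :
    a * b * c ≤ a ^ 3 + b ^ 3 + c ^ 3 := by
  have h1 : 0 ≤ (a + b + c) * ((a - b) ^ 2 + (b - c) ^ 2 + (c - a) ^ 2) := by positivity
  have h2 : 0 ≤ a ^ 3 + b ^ 3 + c ^ 3 := by positivity
  nlinarith

variable {P : Params} {p q C : ℝ}

theorem abs_cavityCov_le (h : IsReplicaSymmetric P p q) {n : ℕ} (k l k' l' : Fin n) :
    |cavityCov P p q k l k' l'| ≤ 2 * (P.S : ℝ) ^ 2 * (P.S : ℝ) ^ 2 := by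
  refine abs_nu0_le P p q fun ε => ?_
  rw [abs_mul]
  refine mul_le_mul ?_ (Spin.abs_val_mul_val_le _ _) (abs_nonneg _) (by positivity)
  have htriangle := abs_sub ((ε k).val * (ε l).val) (rsParam p q k l)
  linarith [Spin.abs_val_mul_val_le (ε k) (ε l), abs_rsParam_le h.abs_le.1 h.abs_le.2 k l]

variable {N n : ℕ}

theorem HasFluctuationBound.abs_overlap (hC : HasFluctuationBound P p q C) [NeZero N]
    (k l : Fin n) :
    (modelAvg P fun σ : Fin n → Config N P.S => |overlap p q σ k l|) ≤ C * fluctScale N := by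
  simpa only [pow_one] using (hC N n k l 1 (by norm_num)).1

theorem HasFluctuationBound.abs_cavityOverlap (hC : HasFluctuationBound P p q C) (i : Fin N)
    (k l : Fin n) : (modelAvg P fun σ : Fin n → Config N P.S => |cavityOverlap p q i σ k l|)
      ≤ C * fluctScale N := by
  have : NeZero N := .of_pos i.pos
  simpa only [pow_one] using (hC N n k l 1 (by norm_num)).2 i

theorem HasFluctuationBound.abs_cavityOverlap_mul_mul (hC : HasFluctuationBound P p q C)
    (i : Fin N) (a b c a' b' c' : Fin n) :
    (modelAvg P fun σ : Fin n → Config N P.S => |cavityOverlap p q i σ a a'| *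
      |cavityOverlap p q i σ b b'| * |cavityOverlap p q i σ c c'|) ≤ 3 * C * fluctScale N ^ 3 := by
  have : NeZero N := .of_pos i.pos
  refine (modelAvg_mono P fun σ => mul_mul_le_cube_add (abs_nonneg _) (abs_nonneg _)
    (abs_nonneg _)).trans ?_
  rw [modelAvg_add, modelAvg_add]
  linarith [(hC N n a a' 3 le_rfl).2 i, (hC N n b b' 3 le_rfl).2 i, (hC N n c c' 3 le_rfl).2 i]

theorem abs_cavityOverlap_mul_sub_overlap_mul_le (i : Fin N) {S : ℕ} (σ : Fin n → Config N S)
    (k l k' l' : Fin n) :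
    |cavityOverlap p q i σ k l * cavityOverlap p q i σ k' l'
        - overlap p q σ k l * overlap p q σ k' l'|
      ≤ (S : ℝ) ^ 2 / N * (|cavityOverlap p q i σ k' l'| + |overlap p q σ k l|) := by
  have hsplit : cavityOverlap p q i σ k l * cavityOverlap p q i σ k' l'
      - overlap p q σ k l * overlap p q σ k' l'
      = -((overlap p q σ k l - cavityOverlap p q i σ k l) * cavityOverlap p q i σ k' l'
        + (overlap p q σ k' l' - cavityOverlap p q i σ k' l') * overlap p q σ k l) := by ring
  rw [hsplit, abs_neg, mul_add]
  refine (abs_add_le _ _).trans (add_le_add ?_ ?_) <;> rw [abs_mul]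
  · exact mul_le_mul_of_nonneg_right (abs_overlap_sub_cavityOverlap_le p q i σ k l) (abs_nonneg _)
  · exact mul_le_mul_of_nonneg_right (abs_overlap_sub_cavityOverlap_le p q i σ k' l')
      (abs_nonneg _)

theorem abs_modelAvg_cavityOverlap_mul_sub_overlapCov_le (hC : HasFluctuationBound P p q C)
    (i : Fin N) (k l k' l' : Fin n) :
    |(modelAvg P fun σ : Fin n → Config N P.S =>
        cavityOverlap p q i σ k l * cavityOverlap p q i σ k' l') - overlapCov P p q N k l k' l'|
      ≤ 2 * (P.S : ℝ) ^ 2 * C * fluctScale N ^ 3 := by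
  have : NeZero N := .of_pos i.pos
  unfold overlapCov
  rw [← modelAvg_sub]
  refine (abs_modelAvg_le P fun σ =>
    abs_cavityOverlap_mul_sub_overlap_mul_le i σ k l k' l').trans ?_
  rw [modelAvg_const_mul, modelAvg_add, div_eq_mul_fluctScale_sq]
  calc _ ≤ (P.S : ℝ) ^ 2 * fluctScale N ^ 2 * (C * fluctScale N + C * fluctScale N) := by
        gcongr
        exacts [hC.abs_cavityOverlap i k' l', hC.abs_overlap k l]
    _ = _ := by ring

section CavityAverages

variable (h : IsReplicaSymmetric P p q) (i : Fin N) (k l k' l' : Fin n)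

theorem avg_zero_spinProduct_mul_cavityOverlap_mul (a b a' b' : Fin n) :
    ((cavityPath P p q h.nonneg i).avg 0 fun σ : Fin n → Config N P.S =>
      (spinProduct i σ k l - rsParam p q k l) * spinProduct i σ k' l' *
        (cavityOverlap p q i σ a b * cavityOverlap p q i σ a' b'))
      = cavityCov P p q k l k' l' * (cavityPath P p q h.nonneg i).avg 0
        fun σ : Fin n → Config N P.S => cavityOverlap p q i σ a b * cavityOverlap p q i σ a' b' :=
  cavityPath_avg_zero_mul P p q h.nonneg i
    (fun ε => (ε k * ε l - rsParam p q k l) * (ε k' * ε l'))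
    fun σ => by simp only [cavityOverlap_eraseSpin]

theorem avg_zero_centered_spinProduct_mul_cavityOverlap :
    ((cavityPath P p q h.nonneg i).avg 0 fun σ : Fin n → Config N P.S =>
      (spinProduct i σ k l - rsParam p q k l) * cavityOverlap p q i σ k' l') = 0 := by
  have hfactor := cavityPath_avg_zero_mul P p q h.nonneg i (fun ε => ε k * ε l - rsParam p q k l)
    (Y := fun σ => cavityOverlap p q i σ k' l')
    fun σ => cavityOverlap_eraseSpin p q i σ k' l'
  rwa [h.nu0_mul_sub, zero_mul] at hfactor

theorem avg_zero_centered_spinProduct_mul_spinProduct :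
    ((cavityPath P p q h.nonneg i).avg 0 fun σ : Fin n → Config N P.S =>
      (spinProduct i σ k l - rsParam p q k l) * spinProduct i σ k' l')
      = cavityCov P p q k l k' l' := by
  have hfactor := cavityPath_avg_zero_mul P p q h.nonneg i
    (fun ε => (ε k * ε l - rsParam p q k l) * (ε k' * ε l')) (Y := fun _ => 1) fun _ => rfl
  simp only [mul_one, GaussianPath.avg_const] at hfactor
  exact hfactor

theorem avg_zero_drift_centered_spinProduct_mul_cavityOverlap :
    1 / 2 * (cavityPath P p q h.nonneg i).avg 0 ((cavityPath P p q h.nonneg i).drift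
      fun σ : Fin n → Config N P.S =>
        (spinProduct i σ k l - rsParam p q k l) * cavityOverlap p q i σ k' l')
      = P.β ^ 2 / 2 * ∑ a : Fin (n + 2), ∑ b : Fin (n + 2), driftU n a * driftV n b *
        (cavityCov P p q k.castSucc.castSucc l.castSucc.castSucc a b *
          (cavityPath P p q h.nonneg i).avg 0 fun σ : Fin (n + 2) → Config N P.S =>
            cavityOverlap p q i σ k'.castSucc.castSucc l'.castSucc.castSucc *
              cavityOverlap p q i σ a b) := by
  have hι : Function.Injective fun k : Fin n => k.castSucc.castSucc :=
    (Fin.castSucc_injective _).comp (Fin.castSucc_injective _)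
  simp_rw [← avg_zero_spinProduct_mul_cavityOverlap_mul h i, ← GaussianPath.avg_const_mul,
    ← GaussianPath.avg_sum, ← GaussianPath.avg_const_mul]
  congr 1
  funext σ
  simp only [cavityPath_drift, cavityOverlap_comp p q hι, spinProduct_comp,
    ← rsParam_comp p q hι k l, Finset.mul_sum]
  exact Finset.sum_congr rfl fun a _ => Finset.sum_congr rfl fun b _ => by ring

end CavityAverages

section CavityEquation

variable (h : IsReplicaSymmetric P p q) (hβ : P.β ^ 2 ≤ 1) (hC : HasFluctuationBound P p q C)
  (i : Fin N) (k l k' l' : Fin n)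

include h hβ hC

theorem abs_modelAvg_centered_spinProduct_mul_spinProduct_sub_le :
    |(modelAvg P fun σ : Fin n → Config N P.S =>
      (spinProduct i σ k l - rsParam p q k l) * spinProduct i σ k' l') - cavityCov P p q k l k' l'|
      ≤ driftConst P.S n * (2 * (P.S : ℝ) ^ 4 * C) * fluctScale N := by
  have : NeZero N := .of_pos i.pos
  have hbound : ∀ σ : Fin n → Config N P.S,
      |(spinProduct i σ k l - rsParam p q k l) * spinProduct i σ k' l'|
        ≤ 2 * (P.S : ℝ) ^ 4 := fun σ => by
    rw [abs_mul]
    calc _ ≤ 2 * (P.S : ℝ) ^ 2 * (P.S : ℝ) ^ 2 := by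
          gcongr
          exacts [abs_spinProduct_sub_rsParam_le h.abs_le.1 h.abs_le.2 i σ k l,
            abs_spinProduct_le i σ k' l']
      _ = _ := by ring
  have hmoment : ∀ a b : Fin (n + 2), (modelAvg P fun σ : Fin (n + 2) → Config N P.S =>
      2 * (P.S : ℝ) ^ 4 * |cavityOverlap p q i σ a b|)
      ≤ 2 * (P.S : ℝ) ^ 4 * (C * fluctScale N) := fun a b => by
    rw [modelAvg_const_mul]
    gcongr
    exact hC.abs_cavityOverlap i a b
  have hM : 0 ≤ 2 * (P.S : ℝ) ^ 4 * (C * fluctScale N) :=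
    (modelAvg_nonneg P fun σ => by positivity).trans (hmoment 0 0)
  have hdrift := driftConst_nonneg P.S n
  rw [← avg_zero_centered_spinProduct_mul_spinProduct h i k l k' l']
  calc _ ≤ P.β ^ 2 * driftConst P.S n * (2 * (P.S : ℝ) ^ 4 * (C * fluctScale N)) :=
        abs_modelAvg_sub_avg_zero_le h.nonneg i hβ h.abs_le.1 h.abs_le.2 hbound hmoment
    _ ≤ 1 * driftConst P.S n * (2 * (P.S : ℝ) ^ 4 * (C * fluctScale N)) := by gcongr
    _ = _ := by ring

theorem abs_modelAvg_cavityOverlap_mul_sub_avg_zero_le :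
    |(modelAvg P fun σ : Fin n → Config N P.S =>
        cavityOverlap p q i σ k l * cavityOverlap p q i σ k' l')
      - (cavityPath P p q h.nonneg i).avg 0 (fun σ : Fin n → Config N P.S =>
        cavityOverlap p q i σ k l * cavityOverlap p q i σ k' l')|
      ≤ driftConst P.S n * (3 * C) * fluctScale N ^ 3 := by
  have : NeZero N := .of_pos i.pos
  have hι : Function.Injective fun k : Fin n => k.castSucc.castSucc :=
    (Fin.castSucc_injective _).comp (Fin.castSucc_injective _)
  have hmoment : ∀ a b : Fin (n + 2), (modelAvg P fun σ : Fin (n + 2) → Config N P.S =>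
      |cavityOverlap p q i (fun m : Fin n => σ m.castSucc.castSucc) k l *
        cavityOverlap p q i (fun m : Fin n => σ m.castSucc.castSucc) k' l'| *
        |cavityOverlap p q i σ a b|) ≤ 3 * C * fluctScale N ^ 3 := fun a b => by
    simp only [cavityOverlap_comp p q hι, abs_mul]
    exact hC.abs_cavityOverlap_mul_mul i _ _ _ _ _ _
  have hM : 0 ≤ 3 * C * fluctScale N ^ 3 :=
    (modelAvg_nonneg P fun σ => by positivity).trans (hmoment 0 0)
  have hdrift := driftConst_nonneg P.S n
  calc _ ≤ P.β ^ 2 * driftConst P.S n * (3 * C * fluctScale N ^ 3) :=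
        abs_modelAvg_sub_avg_zero_le h.nonneg i hβ h.abs_le.1 h.abs_le.2
          (g := fun σ => |cavityOverlap p q i σ k l * cavityOverlap p q i σ k' l'|)
          (fun _ => le_rfl) hmoment
    _ ≤ 1 * driftConst P.S n * (3 * C * fluctScale N ^ 3) := by gcongr
    _ = _ := by ring

theorem abs_avg_zero_cavityOverlap_mul_sub_overlapCov_le :
    |(cavityPath P p q h.nonneg i).avg 0 (fun σ : Fin n → Config N P.S =>
      cavityOverlap p q i σ k l * cavityOverlap p q i σ k' l') - overlapCov P p q N k l k' l'|
      ≤ siteRemovalConst P.S n C * fluctScale N ^ 3 := by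
  have hpath := abs_modelAvg_cavityOverlap_mul_sub_avg_zero_le h hβ hC i k l k' l'
  have hsite := abs_modelAvg_cavityOverlap_mul_sub_overlapCov_le hC i k l k' l'
  rw [abs_sub_comm] at hpath
  refine (abs_sub_le _ _ _).trans ((add_le_add hpath hsite).trans_eq ?_)
  rw [siteRemovalConst, add_mul]

theorem abs_avg_zero_drift_sub_cavitySum_le :
    |1 / 2 * (cavityPath P p q h.nonneg i).avg 0 ((cavityPath P p q h.nonneg i).drift
        fun σ : Fin n → Config N P.S =>
          (spinProduct i σ k l - rsParam p q k l) * cavityOverlap p q i σ k' l')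
        - cavitySum P p q N k l k' l'|
      ≤ ((n : ℝ) + 1) ^ 2 * (n + 2) ^ 2 * (P.S : ℝ) ^ 4 *
        (siteRemovalConst P.S (n + 2) C * fluctScale N ^ 3) := by
  let A : Fin (n + 2) → Fin (n + 2) → ℝ := fun a b =>
    (cavityPath P p q h.nonneg i).avg 0 fun σ : Fin (n + 2) → Config N P.S =>
      cavityOverlap p q i σ k'.castSucc.castSucc l'.castSucc.castSucc * cavityOverlap p q i σ a b
  let E := siteRemovalConst P.S (n + 2) C * fluctScale N ^ 3
  have hA : ∀ a b, |A a b - overlapCov P p q N k'.castSucc.castSucc l'.castSucc.castSucc a b| ≤ E :=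
    fun a b => abs_avg_zero_cavityOverlap_mul_sub_overlapCov_le h hβ hC i _ _ _ _
  have hterm : ∀ a b : Fin (n + 2), |driftU n a * driftV n b *
      (cavityCov P p q k.castSucc.castSucc l.castSucc.castSucc a b *
        (A a b - overlapCov P p q N k'.castSucc.castSucc l'.castSucc.castSucc a b))|
      ≤ ((n : ℝ) + 1) * (n + 1) * (2 * (P.S : ℝ) ^ 2 * (P.S : ℝ) ^ 2 * E) := fun a b => by
    rw [abs_mul, abs_mul, abs_mul]
    gcongr
    exacts [abs_driftU_le a, abs_driftV_le b, abs_cavityCov_le h _ _ _ _, hA a b]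
  rw [avg_zero_drift_centered_spinProduct_mul_cavityOverlap h, cavitySum, ← mul_sub, abs_mul,
    abs_of_nonneg (by positivity)]
  simp_rw [← Finset.sum_sub_distrib, ← mul_sub]
  calc _ ≤ 1 / 2 * (((n + 2 : ℕ) : ℝ) ^ 2 *
        (((n : ℝ) + 1) * (n + 1) * (2 * (P.S : ℝ) ^ 2 * (P.S : ℝ) ^ 2 * E))) := by
        gcongr
        exact (Finset.abs_sum_le_sum_abs _ _).trans <| (Finset.sum_le_sum fun a _ =>
          Finset.abs_sum_le_sum_abs _ _).trans (sum_sum_fin_le hterm)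
    _ = _ := by simp only [E]; push_cast; ring

theorem abs_modelAvg_sub_avg_zero_drift_le :
    |(modelAvg P fun σ : Fin n → Config N P.S =>
        (spinProduct i σ k l - rsParam p q k l) * cavityOverlap p q i σ k' l')
        - 1 / 2 * (cavityPath P p q h.nonneg i).avg 0 ((cavityPath P p q h.nonneg i).drift
          fun σ : Fin n → Config N P.S =>
            (spinProduct i σ k l - rsParam p q k l) * cavityOverlap p q i σ k' l')|
      ≤ driftSqConst P.S n * (2 * (P.S : ℝ) ^ 2 * (3 * C)) * fluctScale N ^ 3 := by
  have : NeZero N := .of_pos i.pos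
  have hι : Function.Injective fun k : Fin n => k.castSucc.castSucc.castSucc.castSucc := by
    intro a b hab
    simpa only [Fin.castSucc_inj] using hab
  have hbound : ∀ σ : Fin n → Config N P.S,
      |(spinProduct i σ k l - rsParam p q k l) * cavityOverlap p q i σ k' l'|
        ≤ 2 * (P.S : ℝ) ^ 2 * |cavityOverlap p q i σ k' l'| := fun σ => by
    rw [abs_mul]
    gcongr
    exact abs_spinProduct_sub_rsParam_le h.abs_le.1 h.abs_le.2 i σ k l
  have hmoment : ∀ (c d : Fin (n + 2)) (a b : Fin (n + 4)),
      (modelAvg P fun σ : Fin (n + 4) → Config N P.S => 2 * (P.S : ℝ) ^ 2 *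
        |cavityOverlap p q i (fun m : Fin n => σ m.castSucc.castSucc.castSucc.castSucc) k' l'| *
        |cavityOverlap p q i σ c.castSucc.castSucc d.castSucc.castSucc| *
        |cavityOverlap p q i σ a b|) ≤ 2 * (P.S : ℝ) ^ 2 * (3 * C * fluctScale N ^ 3) :=
      fun c d a b => by
    simp only [cavityOverlap_comp p q hι, mul_assoc (2 * (P.S : ℝ) ^ 2)]
    rw [modelAvg_const_mul]
    gcongr
    exact hC.abs_cavityOverlap_mul_mul i _ _ _ _ _ _
  have hM : 0 ≤ 2 * (P.S : ℝ) ^ 2 * (3 * C * fluctScale N ^ 3) :=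
    (modelAvg_nonneg P fun σ => by positivity).trans (hmoment 0 0 0 0)
  have hdrift := driftSqConst_nonneg P.S n
  have hβ4 : P.β ^ 4 ≤ 1 := by nlinarith [sq_nonneg P.β]
  have htaylor := abs_modelAvg_sub_avg_zero_sub_le h.nonneg i hβ h.abs_le.1 h.abs_le.2 hbound
    hmoment
  rw [avg_zero_centered_spinProduct_mul_cavityOverlap h, sub_zero] at htaylor
  refine htaylor.trans ?_
  calc _ ≤ 1 * driftSqConst P.S n * (2 * (P.S : ℝ) ^ 2 * (3 * C * fluctScale N ^ 3)) := by gcongr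
    _ = _ := by ring

theorem abs_modelAvg_centered_spinProduct_mul_cavityOverlap_sub_le :
    |(modelAvg P fun σ : Fin n → Config N P.S =>
      (spinProduct i σ k l - rsParam p q k l) * cavityOverlap p q i σ k' l')
        - cavitySum P p q N k l k' l'| ≤ cavityErrorConst P.S n C * fluctScale N ^ 3 := by
  refine (abs_sub_le _ _ _).trans ((add_le_add
    (abs_modelAvg_sub_avg_zero_drift_le h hβ hC i k l k' l')
    (abs_avg_zero_drift_sub_cavitySum_le h hβ hC i k l k' l')).trans_eq ?_)
  unfold cavityErrorConst
  ring

omit h hβ hC in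
theorem overlapCov_eq_sum [NeZero N] : overlapCov P p q N k l k' l' = 1 / (N : ℝ) * ∑ i,
    ((modelAvg P fun σ : Fin n → Config N P.S =>
        (spinProduct i σ k l - rsParam p q k l) * cavityOverlap p q i σ k' l')
      + 1 / (N : ℝ) * modelAvg P fun σ : Fin n → Config N P.S =>
        (spinProduct i σ k l - rsParam p q k l) * spinProduct i σ k' l') := by
  simp only [← modelAvg_const_mul, ← modelAvg_add, ← modelAvg_sum]
  unfold overlapCov
  congr 1
  funext σ
  rw [overlap_eq_sum p q σ k l, mul_assoc, Finset.sum_mul]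
  congr 1
  refine Finset.sum_congr rfl fun i _ => ?_
  unfold cavityOverlap
  ring

theorem abs_overlapCov_sub_le [NeZero N] :
    |overlapCov P p q N k l k' l' - 1 / N * cavityCov P p q k l k' l'
      - cavitySum P p q N k l k' l'| ≤ (cavityErrorConst P.S n C +
        driftConst P.S n * (2 * (P.S : ℝ) ^ 4 * C)) * fluctScale N ^ 3 := by
  have hN : (0 : ℝ) < N := Nat.cast_pos.2 (NeZero.pos N)
  let U : Fin N → ℝ := fun i => modelAvg P fun σ : Fin n → Config N P.S =>
    (spinProduct i σ k l - rsParam p q k l) * cavityOverlap p q i σ k' l'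
  let W : Fin N → ℝ := fun i => modelAvg P fun σ : Fin n → Config N P.S =>
    (spinProduct i σ k l - rsParam p q k l) * spinProduct i σ k' l'
  have hmean : overlapCov P p q N k l k' l' - 1 / N * cavityCov P p q k l k' l'
      - cavitySum P p q N k l k' l' = 1 / (N : ℝ) * ∑ i, ((U i - cavitySum P p q N k l k' l')
        + 1 / N * (W i - cavityCov P p q k l k' l')) := by
    rw [overlapCov_eq_sum]
    simp only [U, W, Finset.sum_add_distrib, ← Finset.mul_sum, Finset.sum_sub_distrib,
      Finset.sum_const, Finset.card_univ, Fintype.card_fin, nsmul_eq_mul]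
    field_simp
    ring
  have hsite : ∀ i, |(U i - cavitySum P p q N k l k' l')
      + 1 / N * (W i - cavityCov P p q k l k' l')| ≤ cavityErrorConst P.S n C * fluctScale N ^ 3
        + 1 / N * (driftConst P.S n * (2 * (P.S : ℝ) ^ 4 * C) * fluctScale N) := fun i => by
    refine (abs_add_le _ _).trans (add_le_add
      (abs_modelAvg_centered_spinProduct_mul_cavityOverlap_sub_le h hβ hC i k l k' l') ?_)
    rw [abs_mul, abs_of_nonneg (by positivity : (0 : ℝ) ≤ 1 / N)]
    gcongr
    exact abs_modelAvg_centered_spinProduct_mul_spinProduct_sub_le h hβ hC i k l k' l'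
  rw [hmean, abs_mul, abs_of_nonneg (by positivity), one_div_mul_eq_div, div_le_iff₀' hN]
  refine (Finset.abs_sum_le_sum_abs _ _).trans ((Finset.sum_le_sum fun i _ => hsite i).trans_eq ?_)
  rw [← fluctScale_sq]
  simp only [Finset.sum_const, Finset.card_univ, Fintype.card_fin, nsmul_eq_mul]
  ring

end CavityEquation

end Covariances

theorem injective_triple {α : Type*} {x y z : α} (hxy : x ≠ y) (hxz : x ≠ z) (hyz : y ≠ z) :
    Function.Injective ![x, y, z] := by
  intro a b
  fin_cases a <;> fin_cases b <;> simp [hxy, hxy.symm, hxz, hxz.symm, hyz, hyz.symm]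

theorem injective_quadruple {α : Type*} {x y z w : α} (hxy : x ≠ y) (hxz : x ≠ z) (hxw : x ≠ w)
    (hyz : y ≠ z) (hyw : y ≠ w) (hzw : z ≠ w) : Function.Injective ![x, y, z, w] := by
  intro a b
  fin_cases a <;> fin_cases b <;> simp [hxy, hxy.symm, hxz, hxz.symm, hxw, hxw.symm, hyz, hyz.symm,
    hyw, hyw.symm, hzw, hzw.symm]

/-- The patterns of coincidences among the replicas of two unordered pairs. In `same`, `chain` and
`disjoint` both pairs consist of distinct replicas, in `diagMeet` and `diagApart` exactly one of
them is a repeated replica, and in `diagSame` and `diagDiag` both are. -/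
inductive Pattern
  | same
  | chain
  | disjoint
  | diagMeet
  | diagApart
  | diagSame
  | diagDiag
deriving DecidableEq

instance : Fintype Pattern where
  elems := {.same, .chain, .disjoint, .diagMeet, .diagApart, .diagSame, .diagDiag}
  complete x := by cases x <;> decide

/-- The pattern of the pairs `(k, l)` and `(a, b)`. -/
def pattern {n : ℕ} (k l a b : Fin n) : Pattern :=
  if k = l then
    if a = b then if k = a then .diagSame else .diagDiag
    else if k = a ∨ k = b then .diagMeet else .diagApart
  else if a = b then if a = k ∨ a = l then .diagMeet else .diagApart
  else if (k = a ∧ l = b) ∨ (k = b ∧ l = a) then .same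
  else if k = a ∨ k = b ∨ l = a ∨ l = b then .chain
  else .disjoint

theorem pattern_swap_pairs {n : ℕ} (k l a b : Fin n) : pattern k l a b = pattern a b k l := by
  unfold pattern
  grind

/-- A function of two pairs of replicas that depends neither on the labels of the replicas, nor on
the order within the pairs, nor on the order of the pairs. -/
structure IsPairInvariant (T : ∀ {n : ℕ}, Fin n → Fin n → Fin n → Fin n → ℝ) : Prop where
  comp_injective {m n : ℕ} {ι : Fin m → Fin n} (hι : Function.Injective ι) (k l a b : Fin m) :
    T (ι k) (ι l) (ι a) (ι b) = T k l a b
  swap_left {n : ℕ} (k l a b : Fin n) : T k l a b = T l k a b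
  swap_pairs {n : ℕ} (k l a b : Fin n) : T k l a b = T a b k l

/-- The values taken by a function of two pairs of replicas on the patterns, each evaluated with as
few replicas as possible. -/
def patternValues (T : ∀ {n : ℕ}, Fin n → Fin n → Fin n → Fin n → ℝ) : Pattern → ℝ
  | .same => T (0 : Fin 2) 1 0 1
  | .chain => T (0 : Fin 3) 1 0 2
  | .disjoint => T (0 : Fin 4) 1 2 3
  | .diagMeet => T (0 : Fin 2) 0 0 1
  | .diagApart => T (0 : Fin 3) 0 1 2
  | .diagSame => T (0 : Fin 1) 0 0 0
  | .diagDiag => T (0 : Fin 2) 0 1 1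

namespace IsPairInvariant

variable {T : ∀ {n : ℕ}, Fin n → Fin n → Fin n → Fin n → ℝ} (hT : IsPairInvariant T) {n : ℕ}

include hT

theorem swap_right (k l a b : Fin n) : T k l a b = T k l b a := by
  rw [hT.swap_pairs, hT.swap_left, hT.swap_pairs]

theorem eq_same {k l : Fin n} (hkl : k ≠ l) : T k l k l = patternValues T .same :=
  hT.comp_injective (injective_pair hkl) 0 1 0 1

theorem eq_chain {k l b : Fin n} (hkl : k ≠ l) (hkb : k ≠ b) (hlb : l ≠ b) :
    T k l k b = patternValues T .chain :=
  hT.comp_injective (injective_triple hkl hkb hlb) 0 1 0 2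

theorem eq_diagMeet {k b : Fin n} (hkb : k ≠ b) : T k k k b = patternValues T .diagMeet :=
  hT.comp_injective (injective_pair hkb) 0 0 0 1

theorem eq_patternValues_of_diag (k a b : Fin n) :
    T k k a b = patternValues T (pattern k k a b) := by
  by_cases hab : a = b
  · subst hab
    by_cases hka : k = a
    · subst hka
      simpa [pattern, patternValues] using hT.comp_injective (injective_singleton k) 0 0 0 0
    · simpa [pattern, patternValues, hka] using
        hT.comp_injective (injective_pair hka) 0 0 1 1
  by_cases hka : k = a
  · subst hka
    simpa [pattern, hab] using hT.eq_diagMeet hab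
  by_cases hkb : k = b
  · subst hkb
    rw [hT.swap_right]
    simpa [pattern, hab] using hT.eq_diagMeet hka
  · simpa [pattern, patternValues, hab, hka, hkb] using
      hT.comp_injective (injective_triple hka hkb hab) 0 0 1 2

theorem eq_patternValues_of_ne {k l a b : Fin n} (hkl : k ≠ l) (hab : a ≠ b) :
    T k l a b = patternValues T (pattern k l a b) := by
  by_cases hka : k = a
  · subst hka
    by_cases hlb : l = b
    · subst hlb
      simpa [pattern, hkl] using hT.eq_same hkl
    · simpa [pattern, hkl, hab, hlb] using hT.eq_chain hkl hab hlb
  by_cases hkb : k = b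
  · subst hkb
    rw [hT.swap_right]
    by_cases hla : l = a
    · subst hla
      simpa [pattern, hkl, hab] using hT.eq_same hkl
    · simpa [pattern, hkl, hab, hka, hla] using hT.eq_chain hkl hka hla
  by_cases hla : l = a
  · subst hla
    rw [hT.swap_left]
    simpa [pattern, hkl, hab, hkb] using hT.eq_chain hkl.symm hab hkb
  by_cases hlb : l = b
  · subst hlb
    rw [hT.swap_left, hT.swap_right]
    simpa [pattern, hkl, hab, hka, hla] using hT.eq_chain hkl.symm hla hka
  · simpa [pattern, patternValues, hkl, hab, hka, hkb, hla, hlb] using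
      hT.comp_injective (injective_quadruple hkl hka hkb hla hlb hab) 0 1 2 3

theorem eq_patternValues (k l a b : Fin n) : T k l a b = patternValues T (pattern k l a b) := by
  by_cases hkl : k = l
  · subst hkl
    exact hT.eq_patternValues_of_diag k a b
  by_cases hab : a = b
  · subst hab
    rw [hT.swap_pairs, pattern_swap_pairs]
    exact hT.eq_patternValues_of_diag a k l
  · exact hT.eq_patternValues_of_ne hkl hab

end IsPairInvariant

section Covariances

variable {P : Params} {p q : ℝ}

theorem overlap_swap {N S n : ℕ} (σ : Fin n → Config N S) (k l : Fin n) :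
    overlap p q σ k l = overlap p q σ l k := by
  simp only [overlap, spinProduct, rsParam, mul_comm (σ k _).val, eq_comm (a := k)]

theorem isPairInvariant_overlapCov {N : ℕ} [NeZero N] : IsPairInvariant (overlapCov P p q N) where
  comp_injective hι k l a b := by
    unfold overlapCov
    simp only [← overlap_comp p q hι]
    exact modelAvg_comp_injective P hι fun σ => overlap p q σ k l * overlap p q σ a b
  swap_left k l a b := by simp only [overlapCov, overlap_swap _ k l]
  swap_pairs k l a b := by simp only [overlapCov, mul_comm (overlap p q _ k l)]

theorem cavityCov_eq (h : IsReplicaSymmetric P p q) {n : ℕ} (k l a b : Fin n) :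
    cavityCov P p q k l a b
      = (nu0 P p q fun ε => ε k * ε l * (ε a * ε b)) - rsParam p q k l * rsParam p q a b := by
  unfold cavityCov
  simp_rw [sub_mul]
  rw [nu0_sub h.nonneg, nu0_const_mul h.nonneg, h.nu0_mul a b]

theorem isPairInvariant_cavityCov (h : IsReplicaSymmetric P p q) :
    IsPairInvariant (cavityCov P p q) where
  comp_injective hι k l a b := by
    unfold cavityCov
    simp only [rsParam_comp p q hι]
    exact nu0_comp_injective P p q hι fun ε => (ε k * ε l - rsParam p q k l) * (ε a * ε b)
  swap_left k l a b := by
    simp only [cavityCov, rsParam, mul_comm (_ : ℝ) _, eq_comm (a := k)]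
  swap_pairs k l a b := by
    rw [cavityCov_eq h, cavityCov_eq h, mul_comm (rsParam p q k l)]
    simp only [mul_comm (_ * _ : ℝ) (_ * _ : ℝ)]

end Covariances

/-- Four replicas, listed as two pairs, that realize a pattern. -/
def Pattern.rep : Pattern → Fin 4 → Fin 4
  | .same => ![0, 1, 0, 1]
  | .chain => ![0, 1, 0, 2]
  | .disjoint => ![0, 1, 2, 3]
  | .diagMeet => ![0, 0, 0, 1]
  | .diagApart => ![0, 0, 1, 2]
  | .diagSame => ![0, 0, 0, 0]
  | .diagDiag => ![0, 0, 1, 1]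

theorem Pattern.pattern_rep (x : Pattern) :
    pattern (x.rep 0) (x.rep 1) (x.rep 2) (x.rep 3) = x := by
  cases x <;> rfl

/-- The linear operator acting on the covariances `v` of the overlaps in the cavity equations, up to
the factor `β² / 2`. Its coefficients are the covariances `z` of the cavity spins. -/
def cavityLinear (z v : Pattern → ℝ) (x : Pattern) : ℝ :=
  ∑ a : Fin 6, ∑ b : Fin 6, driftU 4 a * driftV 4 b *
    (z (pattern (x.rep 0).castSucc.castSucc (x.rep 1).castSucc.castSucc a b) *
      v (pattern (x.rep 2).castSucc.castSucc (x.rep 3).castSucc.castSucc a b))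

theorem cavityLinear_sub (z v w : Pattern → ℝ) :
    cavityLinear z (v - w) = cavityLinear z v - cavityLinear z w := by
  funext x
  simp only [cavityLinear, Pi.sub_apply, mul_sub, Finset.sum_sub_distrib]

theorem norm_cavityLinear_le (z v : Pattern → ℝ) : ‖cavityLinear z v‖ ≤ 900 * (‖z‖ * ‖v‖) := by
  refine (pi_norm_le_iff_of_nonneg (by positivity)).2 fun x => ?_
  have hterm : ∀ (a b : Fin 6) (y y' : Pattern),
      |driftU 4 a * driftV 4 b * (z y * v y')| ≤ 5 * 5 * (‖z‖ * ‖v‖) := fun a b y y' => by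
    rw [abs_mul, abs_mul, abs_mul]
    have hU := abs_driftU_le (n := 4) a
    have hV := abs_driftV_le (n := 4) b
    norm_num at hU hV
    gcongr
    · exact norm_le_pi_norm z y
    · exact norm_le_pi_norm v y'
  calc ‖cavityLinear z v x‖
      ≤ ∑ a : Fin 6, ∑ b : Fin 6, |driftU 4 a * driftV 4 b *
          (z (pattern (x.rep 0).castSucc.castSucc (x.rep 1).castSucc.castSucc a b) *
            v (pattern (x.rep 2).castSucc.castSucc (x.rep 3).castSucc.castSucc a b))| :=
        (Finset.abs_sum_le_sum_abs _ _).trans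
          (Finset.sum_le_sum fun _ _ => Finset.abs_sum_le_sum_abs _ _)
    _ ≤ ((6 : ℕ) : ℝ) ^ 2 * (5 * 5 * (‖z‖ * ‖v‖)) :=
        sum_sum_fin_le fun a b => hterm a b _ _
    _ = 900 * (‖z‖ * ‖v‖) := by ring

theorem norm_sub_le_of_cavityEquation {z u v w : Pattern → ℝ} {c K : ℝ}
    (hw : w = u + c • cavityLinear z w) (hc : 1800 * (|c| * ‖z‖) ≤ 1)
    (hv : ‖v - u - c • cavityLinear z v‖ ≤ K) : ‖v - w‖ ≤ 2 * K := by
  have hsplit : v - w = (v - u - c • cavityLinear z v) + c • cavityLinear z (v - w) := by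
    nth_rw 1 [hw]
    rw [cavityLinear_sub, smul_sub]
    abel
  have hcontract : ‖c • cavityLinear z (v - w)‖ ≤ 1 / 2 * ‖v - w‖ :=
    calc ‖c • cavityLinear z (v - w)‖ ≤ |c| * (900 * (‖z‖ * ‖v - w‖)) := by
          rw [norm_smul, Real.norm_eq_abs]
          gcongr
          exact norm_cavityLinear_le z _
      _ = 1 / 2 * (1800 * (|c| * ‖z‖) * ‖v - w‖) := by ring
      _ ≤ 1 / 2 * ‖v - w‖ := by gcongr; exact mul_le_of_le_one_left (norm_nonneg _) hc
  have hle : ‖v - w‖ ≤ K + 1 / 2 * ‖v - w‖ := by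
    conv_lhs => rw [hsplit]
    exact (norm_add_le _ _).trans (add_le_add hv hcontract)
  linarith

/-- The covariances of the overlaps when `T_{kl} + T_k + T_l + T` and `S_k + S` are the
decompositions of the overlap of the replicas `k ≠ l` and of the self-overlap of the replica `k`
into orthogonal components. Here `a₂ = ν(T_{kl}²)`, `a₁ = ν(T_k²)`, `a₀ = ν(T²)`, `c₁ = ν(S_k T_k)`,
`c₀ = ν(S T)`, `b₁ = ν(S_k²)` and `b₀ = ν(S²)`. -/
def ofBasis (a₂ a₁ a₀ c₁ c₀ b₁ b₀ : ℝ) : Pattern → ℝ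
  | .same => a₂ + 2 * a₁ + a₀
  | .chain => a₁ + a₀
  | .disjoint => a₀
  | .diagMeet => c₁ + c₀
  | .diagApart => c₀
  | .diagSame => b₁ + b₀
  | .diagDiag => b₀

theorem sum_drift_four (f : Fin 6 → Fin 6 → ℝ) :
    ∑ a : Fin 6, ∑ b : Fin 6, driftU 4 a * driftV 4 b * f a b
      = ∑ a : Fin 4, (∑ b : Fin 5, f a.castSucc.castSucc b.castSucc - 5 * f a.castSucc.castSucc 5)
        - 4 * (∑ b : Fin 5, f 4 b.castSucc - 5 * f 4 5) := by
  simp_rw [mul_assoc, ← Finset.mul_sum, sum_driftV_mul]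
  rw [sum_driftU_mul]
  norm_num
  rfl

theorem cavityLinear_ofBasis (a₂ a₁ a₀ c₁ c₀ b₁ b₀ A₂ A₁ A₀ C₁ C₀ B₁ B₀ : ℝ) :
    cavityLinear (ofBasis a₂ a₁ a₀ c₁ c₀ b₁ b₀) (ofBasis A₂ A₁ A₀ C₁ C₀ B₁ B₀)
      = ofBasis (2 * a₂ * A₂)
        (2 * a₂ * A₁ + 2 * a₁ * A₂ - 4 * a₁ * A₁ + c₁ * C₁)
        (2 * a₂ * A₀ + 8 * a₁ * A₁ - 4 * a₁ * A₀ + 2 * a₀ * A₂ - 4 * a₀ * A₁ + 2 * c₁ * C₀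
          + 2 * c₀ * C₁)
        (2 * c₁ * A₂ - 4 * c₁ * A₁ + b₁ * C₁)
        (4 * c₁ * A₁ - 2 * c₁ * A₀ + 2 * c₀ * A₂ - 4 * c₀ * A₁ + b₁ * C₀ + 2 * b₀ * C₁)
        (b₁ * B₁ - 4 * c₁ * C₁)
        (2 * c₁ * C₁ - 2 * c₁ * C₀ - 2 * c₀ * C₁ + b₁ * B₀ + b₀ * B₁) := by
  funext x
  unfold cavityLinear
  rw [sum_drift_four]
  cases x <;>
  · simp only [Pattern.rep, pattern, ofBasis, Fin.sum_univ_four, Fin.sum_univ_five,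
      Matrix.cons_val, Fin.reduceCastSucc, Fin.reduceEq, ↓reduceIte, or_true, true_or, or_false,
      false_or, and_true, and_false, or_self, and_self]
    ring

section Constants

variable {P : Params} {p q : ℝ} (h : IsReplicaSymmetric P p q)

include h

theorem nu0_mul_sub_mul {n : ℕ} (k l a b k' l' a' b' : Fin n) {φ : (Fin n → ℝ) → ℝ}
    (hr : rsParam p q k l * rsParam p q a b = rsParam p q k' l' * rsParam p q a' b')
    (hφ : ∀ ε, φ ε = ε k * ε l * (ε a * ε b) - ε k' * ε l' * (ε a' * ε b')) :
    nu0 P p q φ = patternValues (cavityCov P p q) (pattern k l a b)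
      - patternValues (cavityCov P p q) (pattern k' l' a' b') := by
  have hcov := isPairInvariant_cavityCov h
  rw [← hcov.eq_patternValues, ← hcov.eq_patternValues, cavityCov_eq h, cavityCov_eq h, hr,
    funext hφ, nu0_sub h.nonneg]
  ring

theorem constF_eq : constF P p q
    = patternValues (cavityCov P p q) .same - patternValues (cavityCov P p q) .chain :=
  nu0_mul_sub_mul h 0 2 0 2 1 2 0 2 rfl fun _ => by ring

theorem constG_eq : constG P p q
    = patternValues (cavityCov P p q) .chain - patternValues (cavityCov P p q) .disjoint :=
  nu0_mul_sub_mul h 0 2 0 3 1 2 0 3 rfl fun _ => by ring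

theorem constE_eq : constE P p q
    = patternValues (cavityCov P p q) .diagMeet - patternValues (cavityCov P p q) .diagApart :=
  nu0_mul_sub_mul h 0 0 0 2 1 1 0 2 rfl fun _ => by ring

theorem constD_eq : constD P p q
    = patternValues (cavityCov P p q) .diagSame - patternValues (cavityCov P p q) .diagDiag :=
  nu0_mul_sub_mul h 0 0 0 0 1 1 0 0 rfl fun _ => by ring

theorem constA_eq : constA P p q = constF P p q - constG P p q := by
  have hsame : (nu0 P p q fun ε : Fin 4 → ℝ => ε 0 * ε 1 * (ε 0 * ε 1) - ε 0 * ε 3 * (ε 0 * ε 1))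
      = constF P p q :=
    (nu0_mul_sub_mul h 0 1 0 1 0 3 0 1 rfl fun _ => rfl).trans (constF_eq h).symm
  have hchain : (nu0 P p q fun ε : Fin 4 → ℝ => ε 2 * ε 1 * (ε 0 * ε 1) - ε 2 * ε 3 * (ε 0 * ε 1))
      = constG P p q :=
    (nu0_mul_sub_mul h 2 1 0 1 2 3 0 1 rfl fun _ => rfl).trans (constG_eq h).symm
  rw [← hsame, ← hchain, ← nu0_sub h.nonneg]
  unfold constA
  congr 1
  funext ε
  ring

theorem constM3_eq : constM3 P p q = 1 - P.β ^ 2 * constA P p q := by rw [constM3, constA_eq h]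

theorem constI5_eq : constI5 P p q = patternValues (cavityCov P p q) .diagApart :=
  (isPairInvariant_cavityCov h).eq_patternValues (0 : Fin 4) 1 2 2

theorem constK3_eq : constK3 P p q = constI5 P p q :=
  ((isPairInvariant_cavityCov h).eq_patternValues (0 : Fin 4) 0 1 2).trans (constI5_eq h).symm

theorem constK4_eq : constK4 P p q = patternValues (cavityCov P p q) .diagDiag :=
  (isPairInvariant_cavityCov h).eq_patternValues (0 : Fin 4) 0 1 1

theorem patternValues_cavityCov : patternValues (cavityCov P p q)
    = ofBasis (constA P p q) (constG P p q) (constI3 P p q) (constE P p q) (constI5 P p q)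
      (constD P p q) (constK4 P p q) := by
  rw [constA_eq h, constF_eq h, constG_eq h, constE_eq h, constD_eq h, constI5_eq h,
    constK4_eq h, show constI3 P p q = patternValues (cavityCov P p q) .disjoint from rfl]
  funext x
  cases x <;> simp only [ofBasis] <;> ring

theorem norm_patternValues_cavityCov_le :
    ‖patternValues (cavityCov P p q)‖ ≤ 2 * (P.S : ℝ) ^ 4 := by
  have hbound {n : ℕ} (k l a b : Fin n) : |cavityCov P p q k l a b| ≤ 2 * (P.S : ℝ) ^ 4 :=
    (abs_cavityCov_le h k l a b).trans_eq (by ring)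
  exact (pi_norm_le_iff_of_nonneg (by positivity)).2 fun x => by cases x <;> exact hbound _ _ _ _

end Constants

section LeadingTerms

variable {P : Params} {p q : ℝ} {N : ℕ}

theorem A2sq_eq (h : IsReplicaSymmetric P p q) (hN : (N : ℝ) ≠ 0) (hM3 : constM3 P p q ≠ 0) :
    A2sq P p q N
      = 1 / N * constA P p q + P.β ^ 2 / 2 * (2 * constA P p q * A2sq P p q N) := by
  unfold A2sq
  rw [← constM3_eq h]
  field_simp
  rw [constM3_eq h]
  ring

theorem A1sq_eq (h : IsReplicaSymmetric P p q) (hN : (N : ℝ) ≠ 0) (hM3 : constM3 P p q ≠ 0)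
    (hM : constM P p q ≠ 0) :
    A1sq P p q N
      = 1 / N * constG P p q + P.β ^ 2 / 2 * (2 * constA P p q * A1sq P p q N
        + 2 * constG P p q * A2sq P p q N - 4 * constG P p q * A1sq P p q N
        + constE P p q * C1sq P p q N) := by
  unfold A2sq A1sq C1sq
  rw [← constM3_eq h, constA_eq h]
  field_simp
  simp only [constM, constM1, constM2, constM3]
  ring

theorem A0sq_eq (h : IsReplicaSymmetric P p q) (hN : (N : ℝ) ≠ 0) (hM3 : constM3 P p q ≠ 0)
    (hM : constM P p q ≠ 0) :
    A0sq P p q N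
      = 1 / N * constI3 P p q + P.β ^ 2 / 2 * (2 * constA P p q * A0sq P p q N
        + 8 * constG P p q * A1sq P p q N - 4 * constG P p q * A0sq P p q N
        + 2 * constI3 P p q * A2sq P p q N - 4 * constI3 P p q * A1sq P p q N
        + 2 * constE P p q * C0 P p q N + 2 * constI5 P p q * C1sq P p q N) := by
  unfold A0sq C0 A2sq A1sq B1sq C1sq
  rw [← constM3_eq h, constA_eq h, constK3_eq h]
  field_simp
  simp only [constM, constM1, constM2, constM3]
  ring

theorem C1sq_eq (h : IsReplicaSymmetric P p q) (hN : (N : ℝ) ≠ 0) (hM3 : constM3 P p q ≠ 0)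
    (hM : constM P p q ≠ 0) :
    C1sq P p q N
      = 1 / N * constE P p q + P.β ^ 2 / 2 * (2 * constE P p q * A2sq P p q N
        - 4 * constE P p q * A1sq P p q N + constD P p q * C1sq P p q N) := by
  unfold A2sq A1sq C1sq
  rw [← constM3_eq h, constA_eq h]
  field_simp
  simp only [constM, constM1, constM2, constM3]
  ring

theorem C0_eq (h : IsReplicaSymmetric P p q) (hN : (N : ℝ) ≠ 0) (hM3 : constM3 P p q ≠ 0)
    (hM : constM P p q ≠ 0) :
    C0 P p q N
      = 1 / N * constI5 P p q + P.β ^ 2 / 2 * (4 * constE P p q * A1sq P p q N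
        - 2 * constE P p q * A0sq P p q N + 2 * constI5 P p q * A2sq P p q N
        - 4 * constI5 P p q * A1sq P p q N + constD P p q * C0 P p q N
        + 2 * constK4 P p q * C1sq P p q N) := by
  unfold A0sq C0 A2sq A1sq B1sq C1sq
  rw [← constM3_eq h, constA_eq h, constK3_eq h]
  field_simp
  simp only [constM, constM1, constM2, constM3]
  ring

theorem B1sq_eq (hN : (N : ℝ) ≠ 0) (hM : constM P p q ≠ 0) :
    B1sq P p q N
      = 1 / N * constD P p q
        + P.β ^ 2 / 2 * (constD P p q * B1sq P p q N - 4 * constE P p q * C1sq P p q N) := by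
  unfold B1sq C1sq
  field_simp
  simp only [constM, constM1, constM2]
  ring

theorem B0sq_eq (h : IsReplicaSymmetric P p q) (hN : (N : ℝ) ≠ 0) (hM : constM P p q ≠ 0) :
    B0sq P p q N
      = 1 / N * constK4 P p q + P.β ^ 2 / 2 * (2 * constE P p q * C1sq P p q N
        - 2 * constE P p q * C0 P p q N - 2 * constI5 P p q * C1sq P p q N
        + constD P p q * B0sq P p q N + constK4 P p q * B1sq P p q N) := by
  unfold B0sq C0 B1sq C1sq
  rw [constK3_eq h]
  field_simp
  simp only [constM, constM1, constM2]
  ring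

end LeadingTerms

section Covariances

/-- The leading terms of the covariances of the overlaps. -/
def leadingValues (P : Params) (p q : ℝ) (N : ℕ) : Pattern → ℝ :=
  ofBasis (A2sq P p q N) (A1sq P p q N) (A0sq P p q N) (C1sq P p q N) (C0 P p q N) (B1sq P p q N)
    (B0sq P p q N)

variable {P : Params} {p q C : ℝ} (h : IsReplicaSymmetric P p q) {N : ℕ}

include h

theorem leadingValues_eq (hN : (N : ℝ) ≠ 0) (hM3 : constM3 P p q ≠ 0) (hM : constM P p q ≠ 0) :
    leadingValues P p q N = (1 / N : ℝ) • patternValues (cavityCov P p q)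
      + (P.β ^ 2 / 2) • cavityLinear (patternValues (cavityCov P p q)) (leadingValues P p q N) := by
  have hA2 := A2sq_eq h hN hM3
  have hA1 := A1sq_eq h hN hM3 hM
  have hA0 := A0sq_eq h hN hM3 hM
  have hC1 := C1sq_eq h hN hM3 hM
  have hC0 := C0_eq h hN hM3 hM
  have hB1 := B1sq_eq hN hM
  have hB0 := B0sq_eq h hN hM
  rw [patternValues_cavityCov h, leadingValues, cavityLinear_ofBasis]
  funext x
  cases x <;> simp only [Pi.add_apply, Pi.smul_apply, smul_eq_mul, ofBasis]
  case same => linear_combination hA2 + 2 * hA1 + hA0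
  case chain => linear_combination hA1 + hA0
  case disjoint => linear_combination hA0
  case diagMeet => linear_combination hC1 + hC0
  case diagApart => linear_combination hC0
  case diagSame => linear_combination hB1 + hB0
  case diagDiag => linear_combination hB0

variable [NeZero N]

theorem cavitySum_rep (x : Pattern) :
    cavitySum P p q N (x.rep 0) (x.rep 1) (x.rep 2) (x.rep 3)
      = P.β ^ 2 / 2 * cavityLinear (patternValues (cavityCov P p q))
        (patternValues (overlapCov P p q N)) x := by
  unfold cavitySum cavityLinear
  simp only [(isPairInvariant_cavityCov h).eq_patternValues,
    isPairInvariant_overlapCov.eq_patternValues]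

theorem norm_patternValues_overlapCov_sub_le (hβ : P.β ^ 2 ≤ 1)
    (hC : HasFluctuationBound P p q C) :
    ‖patternValues (overlapCov P p q N) - (1 / N : ℝ) • patternValues (cavityCov P p q)
        - (P.β ^ 2 / 2) • cavityLinear (patternValues (cavityCov P p q))
          (patternValues (overlapCov P p q N))‖
      ≤ (cavityErrorConst P.S 4 C + driftConst P.S 4 * (2 * P.S ^ 4 * C)) * fluctScale N ^ 3 := by
  have hbound (x : Pattern) :=
    abs_overlapCov_sub_le h hβ hC (N := N) (x.rep 0) (x.rep 1) (x.rep 2) (x.rep 3)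
  simp only [cavitySum_rep h, (isPairInvariant_cavityCov h).eq_patternValues,
    isPairInvariant_overlapCov.eq_patternValues, Pattern.pattern_rep] at hbound
  exact (pi_norm_le_iff_of_nonneg ((abs_nonneg _).trans (hbound .same))).2 hbound

theorem norm_patternValues_overlapCov_sub_leadingValues_le (hβ : P.β ^ 2 ≤ 1)
    (hsmall : 1800 * (P.β ^ 2 * (P.S : ℝ) ^ 4) ≤ 1) (hC : HasFluctuationBound P p q C)
    (hM3 : constM3 P p q ≠ 0) (hM : constM P p q ≠ 0) :
    ‖patternValues (overlapCov P p q N) - leadingValues P p q N‖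
      ≤ 2 * ((cavityErrorConst P.S 4 C + driftConst P.S 4 * (2 * P.S ^ 4 * C))
        * fluctScale N ^ 3) := by
  have hN : (N : ℝ) ≠ 0 := Nat.cast_ne_zero.2 (NeZero.ne N)
  refine norm_sub_le_of_cavityEquation (leadingValues_eq h hN hM3 hM) ?_
    (norm_patternValues_overlapCov_sub_le h hβ hC)
  rw [abs_of_nonneg (by positivity)]
  calc 1800 * (P.β ^ 2 / 2 * ‖patternValues (cavityCov P p q)‖)
      ≤ 1800 * (P.β ^ 2 / 2 * (2 * (P.S : ℝ) ^ 4)) := by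
        gcongr
        exact norm_patternValues_cavityCov_le h
    _ ≤ 1 := by linarith

end Covariances

section Positivity

variable {P : Params} {p q : ℝ} (h : IsReplicaSymmetric P p q)
  (hsmall : 1800 * (P.β ^ 2 * (P.S : ℝ) ^ 4) ≤ 1)

include h

theorem abs_patternValues_cavityCov_le (x : Pattern) :
    |patternValues (cavityCov P p q) x| ≤ 2 * (P.S : ℝ) ^ 4 :=
  (norm_le_pi_norm _ x).trans (norm_patternValues_cavityCov_le h)

include hsmall

theorem constM1_pos : 0 < constM1 P p q := by
  have hle : constF P p q - 3 * constG P p q ≤ 16 * (P.S : ℝ) ^ 4 := by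
    have hsame := abs_le.1 (abs_patternValues_cavityCov_le h .same)
    have hchain := abs_le.1 (abs_patternValues_cavityCov_le h .chain)
    have hdisjoint := abs_le.1 (abs_patternValues_cavityCov_le h .disjoint)
    rw [constF_eq h, constG_eq h]
    linarith
  have hmul := mul_le_mul_of_nonneg_left hle (sq_nonneg P.β)
  unfold constM1
  linarith

theorem constM2_pos : 0 < constM2 P p q := by
  have hle : constD P p q ≤ 4 * (P.S : ℝ) ^ 4 := by
    have hsame := abs_le.1 (abs_patternValues_cavityCov_le h .diagSame)
    have hdiag := abs_le.1 (abs_patternValues_cavityCov_le h .diagDiag)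
    rw [constD_eq h]
    linarith
  have hmul := mul_le_mul_of_nonneg_left hle (sq_nonneg P.β)
  unfold constM2
  linarith

theorem constM3_pos : 0 < constM3 P p q := by
  have hle : constF P p q - constG P p q ≤ 8 * (P.S : ℝ) ^ 4 := by
    have hsame := abs_le.1 (abs_patternValues_cavityCov_le h .same)
    have hchain := abs_le.1 (abs_patternValues_cavityCov_le h .chain)
    have hdisjoint := abs_le.1 (abs_patternValues_cavityCov_le h .disjoint)
    rw [constF_eq h, constG_eq h]
    linarith
  have hmul := mul_le_mul_of_nonneg_left hle (sq_nonneg P.β)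
  unfold constM3
  linarith

theorem constM_pos : 0 < constM P p q := by
  have hM := mul_pos (constM1_pos h hsmall) (constM2_pos h hsmall)
  unfold constM
  positivity

end Positivity

section Basis

variable (P : Params) {p q : ℝ} {N : ℕ}

theorem basisT_eq (p : ℝ) (g : Disorder N) :
    basisT P q g = gibbsAvg (hamiltonian P g)
      fun σ : Fin 2 → Config N P.S => overlap p q σ 0 1 := by
  have hsite : ∀ i, siteMean P g i ^ 2 = gibbsAvg (hamiltonian P g)
      fun σ : Fin 2 → Config N P.S => spinProduct i σ 0 1 := fun i => by
    rw [sq]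
    exact (gibbsAvg_append (hamiltonian P g) (fun σ : Fin 1 → Config N P.S => (σ 0 i).val)
      fun σ : Fin 1 → Config N P.S => (σ 0 i).val).symm
  unfold basisT
  simp_rw [hsite]
  exact (gibbsAvg_affine _ _ _ _).symm

theorem basisS_eq (q : ℝ) (g : Disorder N) :
    basisS P p g = gibbsAvg (hamiltonian P g)
      fun σ : Fin 1 → Config N P.S => overlap p q σ 0 0 := by
  have hsite : ∀ i, siteSecondMoment P g i = gibbsAvg (hamiltonian P g)
      fun σ : Fin 1 → Config N P.S => spinProduct i σ 0 0 := fun i => by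
    simp only [spinProduct, ← sq]
    rfl
  unfold basisS
  simp_rw [hsite]
  exact (gibbsAvg_affine _ _ _ _).symm

theorem gibbs_const {n : ℕ} (g : Disorder N) (a : ℝ) :
    gibbs P g (fun _ : Fin n → Config N P.S => a) = a := by
  change gibbsAvg (hamiltonian P g) (fun _ : Fin n → Config N P.S => a) = a
  unfold gibbsAvg
  rw [← Finset.sum_mul, sum_prod_gibbsProb, one_mul]

theorem overlapCov_eq_integral_mul {m n : ℕ} (k l : Fin m) (a b : Fin n) :
    overlapCov P p q N (k.castAdd n) (l.castAdd n) (a.natAdd m) (b.natAdd m)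
      = ∫ g, gibbsAvg (hamiltonian P g) (fun σ : Fin m → Config N P.S => overlap p q σ k l)
        * gibbsAvg (hamiltonian P g) (fun σ : Fin n → Config N P.S => overlap p q σ a b)
          ∂disorderLaw N := by
  unfold overlapCov modelAvg
  refine integral_congr_ae (.of_forall fun g => ?_)
  simp only [← gibbsAvg_append, overlap_comp p q (Fin.castAdd_injective m n),
    overlap_comp p q (Fin.natAdd_injective n m)]
  rfl

theorem nu_basisT_sq {n : ℕ} (p : ℝ) :
    nu P (fun (g : Disorder N) (_ : Fin n → Config N P.S) => basisT P q g ^ 2)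
      = patternValues (overlapCov P p q N) .disjoint := by
  simp only [nu, gibbs_const, sq, basisT_eq P p]
  exact (overlapCov_eq_integral_mul P (0 : Fin 2) 1 (0 : Fin 2) 1).symm

theorem nu_basisS_sq {n : ℕ} (q : ℝ) :
    nu P (fun (g : Disorder N) (_ : Fin n → Config N P.S) => basisS P p g ^ 2)
      = patternValues (overlapCov P p q N) .diagDiag := by
  simp only [nu, gibbs_const, sq, basisS_eq P q]
  exact (overlapCov_eq_integral_mul P (0 : Fin 1) 0 (0 : Fin 1) 0).symm

theorem nu_basisS_mul_basisT {n : ℕ} :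
    nu P (fun (g : Disorder N) (_ : Fin n → Config N P.S) => basisS P p g * basisT P q g)
      = patternValues (overlapCov P p q N) .diagApart := by
  simp only [nu, gibbs_const, basisS_eq P q, basisT_eq P p]
  exact (overlapCov_eq_integral_mul P (0 : Fin 1) 0 (0 : Fin 2) 1).symm

end Basis

section HighTemperature

/-- The explicit high-temperature regime in which the theorem is proved. The condition depends on
`β` and `S` only. -/
def IsHighTemperature (P : Params) : Prop := P.β ^ 2 * (4 * momentRate P.S + 1) ≤ 1

theorem pow_four_le_momentRate (S : ℕ) : 9216 * (S : ℝ) ^ 4 ≤ momentRate S := by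
  have hexp : 1 ≤ Real.exp (cavityRate S 4) := Real.one_le_exp (by unfold cavityRate; positivity)
  calc 9216 * (S : ℝ) ^ 4 ≤ 9216 * (S : ℝ) ^ 4 * Real.exp (cavityRate S 4) :=
        le_mul_of_one_le_right (by positivity) hexp
    _ = momentRate S := by unfold momentRate driftConst; norm_num; ring

theorem momentRate_nonneg (S : ℕ) : 0 ≤ momentRate S :=
  le_trans (by positivity) (pow_four_le_momentRate S)

variable {P : Params}

theorem IsHighTemperature.of_nonneg_of_lt (hβ : 0 ≤ P.β)
    (hlt : P.β < 1 / (4 * momentRate P.S + 1)) : IsHighTemperature P := by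
  have hrate := momentRate_nonneg P.S
  have hmul : P.β * (4 * momentRate P.S + 1) ≤ 1 := ((lt_div_iff₀ (by positivity)).1 hlt).le
  have hle : P.β ≤ 1 := hlt.le.trans ((div_le_one (by positivity)).2 (by linarith))
  calc P.β ^ 2 * (4 * momentRate P.S + 1) = P.β * (P.β * (4 * momentRate P.S + 1)) := by ring
    _ ≤ 1 := mul_le_one₀ hle (by positivity) hmul

variable (hP : IsHighTemperature P)

include hP

theorem IsHighTemperature.sq_mul_momentRate_le : 4 * (P.β ^ 2 * momentRate P.S) ≤ 1 := by
  unfold IsHighTemperature at hP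
  linarith [sq_nonneg P.β]

theorem IsHighTemperature.sq_le_one : P.β ^ 2 ≤ 1 := by
  have hnonneg := mul_nonneg (sq_nonneg P.β) (momentRate_nonneg P.S)
  unfold IsHighTemperature at hP
  linarith

theorem IsHighTemperature.mul_sq_mul_pow_four_le {c : ℝ} (hc : c ≤ 36864) :
    c * (P.β ^ 2 * (P.S : ℝ) ^ 4) ≤ 1 := by
  have hrate := mul_le_mul_of_nonneg_left (pow_four_le_momentRate P.S) (sq_nonneg P.β)
  calc c * (P.β ^ 2 * (P.S : ℝ) ^ 4) ≤ 36864 * (P.β ^ 2 * (P.S : ℝ) ^ 4) := by gcongr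
    _ ≤ 1 := by linarith [hP.sq_mul_momentRate_le]

end HighTemperature

theorem exists_norm_patternValues_overlapCov_sub_leadingValues_le {P : Params}
    (hP : IsHighTemperature P) {p q : ℝ} (h : IsReplicaSymmetric P p q) :
    ∃ K : ℝ, ∀ N : ℕ, 1 ≤ N →
      ‖patternValues (overlapCov P p q N) - leadingValues P p q N‖
        ≤ K * (N : ℝ) ^ (-(3 / 2) : ℝ) := by
  have hsmall := hP.mul_sq_mul_pow_four_le (c := 1800) (by norm_num)
  obtain ⟨C, hC⟩ := exists_hasFluctuationBound h hP.sq_le_one hP.sq_mul_momentRate_le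
  refine ⟨2 * (cavityErrorConst P.S 4 C + driftConst P.S 4 * (2 * P.S ^ 4 * C)), fun N hN => ?_⟩
  have : NeZero N := ⟨by omega⟩
  rw [← fluctScale_cube, mul_assoc]
  exact norm_patternValues_overlapCov_sub_leadingValues_le h hP.sq_le_one hsmall hC
    (constM3_pos h hsmall).ne' (constM_pos h hsmall).ne'

end GhatakSherrington

end

open GhatakSherrington in
theorem mainTheorem7_general (P : Params) (hP : IsHighTemperature P) :
    ∃ p q : ℝ, IsReplicaSymmetric P p q ∧
      (∀ p' q' : ℝ, IsReplicaSymmetric P p' q' → p' = p ∧ q' = q) ∧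
      0 < constM1 P p q ∧ 0 < constM2 P p q ∧ 0 < constM3 P p q ∧ 0 < constM P p q ∧
      ∃ K : ℝ, ∀ N : ℕ, 1 ≤ N →
        |nu P (fun (g : Disorder N) (_ : Fin 1 → Config N P.S) => basisT P q g ^ 2)
            - A0sq P p q N| ≤ K * (N : ℝ) ^ (-(3 / 2) : ℝ) ∧
        |nu P (fun (g : Disorder N) (_ : Fin 1 → Config N P.S) => basisS P p g ^ 2)
            - B0sq P p q N| ≤ K * (N : ℝ) ^ (-(3 / 2) : ℝ) ∧
        |nu P (fun (g : Disorder N) (_ : Fin 1 → Config N P.S) => basisS P p g * basisT P q g)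
            - C0 P p q N| ≤ K * (N : ℝ) ^ (-(3 / 2) : ℝ) := by
  have hsmall := hP.mul_sq_mul_pow_four_le (c := 1800) (by norm_num)
  obtain ⟨p, q, h, hunique⟩ := existsUnique_isReplicaSymmetric (P := P)
    (by linarith [hP.mul_sq_mul_pow_four_le (c := 336) (by norm_num)])
  obtain ⟨K, hK⟩ := exists_norm_patternValues_overlapCov_sub_leadingValues_le hP h
  refine ⟨p, q, h, hunique, constM1_pos h hsmall, constM2_pos h hsmall, constM3_pos h hsmall,
    constM_pos h hsmall, K, fun N hN => ?_⟩
  have hpattern (x : Pattern) :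
      |patternValues (overlapCov P p q N) x - leadingValues P p q N x|
        ≤ K * (N : ℝ) ^ (-(3 / 2) : ℝ) :=
    (norm_le_pi_norm (patternValues (overlapCov P p q N) - leadingValues P p q N) x).trans (hK N hN)
  rw [nu_basisT_sq P p, nu_basisS_sq P q, nu_basisS_mul_basisT P]
  exact ⟨hpattern .disjoint, hpattern .diagDiag, hpattern .diagApart⟩

open GhatakSherrington in
theorem mainTheorem7 (S : ℕ) (hS : 1 ≤ S) :
    ∃ β' : ℝ, 0 < β' ∧ ∀ P : Params, P.S = S → 0 ≤ P.β → P.β < β' → 0 ≤ P.h →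
      ∃ p q : ℝ, IsReplicaSymmetric P p q ∧
        (∀ p' q' : ℝ, IsReplicaSymmetric P p' q' → p' = p ∧ q' = q) ∧
        0 < constM1 P p q ∧ 0 < constM2 P p q ∧ 0 < constM3 P p q ∧ 0 < constM P p q ∧
        ∃ K : ℝ, ∀ N : ℕ, 1 ≤ N →
          |nu P (fun (g : Disorder N) (_ : Fin 1 → Config N P.S) => basisT P q g ^ 2)
              - A0sq P p q N| ≤ K * (N : ℝ) ^ (-(3 / 2) : ℝ) ∧
          |nu P (fun (g : Disorder N) (_ : Fin 1 → Config N P.S) => basisS P p g ^ 2)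
              - B0sq P p q N| ≤ K * (N : ℝ) ^ (-(3 / 2) : ℝ) ∧
          |nu P (fun (g : Disorder N) (_ : Fin 1 → Config N P.S) => basisS P p g * basisT P q g)
              - C0 P p q N| ≤ K * (N : ℝ) ^ (-(3 / 2) : ℝ) := by
  refine ⟨1 / (4 * momentRate S + 1), by have := momentRate_nonneg S; positivity, ?_⟩
  rintro P rfl hβ hlt _
  exact mainTheorem7_general P (.of_nonneg_of_lt hβ hlt)
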